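/- **Lemma 8.1.** Let $n\ge1$, $M\ge 0$, $\varrho>0$, $0<\delta<1$, and for $\lambda\ge1$ let $$u_\lambda(x)=\lambda^{(n-1)\delta/2}\,e^{i\lambda\omega(x)}\sum_{j=0}^M\varphi_j(\lambda^\delta x)\,\lambda^{-j\varrho},\qquad x\in\mathbb R^n .$$ Here $\omega=\omega_\lambda\in C^\infty(\mathbb R^n)$ and $\varphi_j=\varphi_{j,\lambda}\in C_0^\infty(\mathbb R^n)$ may depend on $\lambda\ge 1$ and on a further parameter $s$ in an arbitrary index set, subject to the following conditions with bounds that do not depend on $\lambda$ and $s$: all derivatives of $\omega$ are bounded on every compact set, $\operatorname{Im}\omega\ge0$ and $|d\operatorname{Re}\omega|\ge c>0$ on $\mathbb R^n$; all derivatives of $\varphi_j$ are bounded, and there are a fixed index $i_0$ and a constant $R$ such that $|y_i|\le R$ for $i\ne i_0$ and $|y_{i_0}|\le R\lambda^\delta$ whenever $\varphi_j(y)\neq0$. Let $\|u\|_{(k)}=\big((2\pi)^{-n}\int(1+|\xi|^2)^k|\hat u(\xi)|^2\,d\xi\big)^{1/2}$ be the $L^2$ Sobolev norm, where $\hat u(\xi)=\int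 e^{-i\langle x,\xi\rangle}u(x)\,dx$. (a) For every integer $N$ there is a constant $C$, independent of $\lambda$ and $s$, such that $\|u_\lambda\|_{(-N)}\le C\lambda^{-N}$ for all $\lambda\ge1$. (b) Suppose that there are $\kappa>0$ and points $x_0$ (which may depend on $s$ but not on $\lambda$) such that $|\varphi_{0}(\lambda^\delta x_0)|\ge\kappa$ and $\operatorname{Im}\omega(x_0)=0$ for all $\lambda\ge1$ and $s$ (for $x_0=0$ and $\varphi_0$, $\omega$ fixed this means $\varphi_0(0)\ne0$, $\operatorname{Im}\omega(0)=0$). Then there is $\lambda_0\ge1$ such that for every integer $N$ there is $c'>0$, with $\lambda_0$ and $c'$ independent of $\lambda$ and $s$, so that $$\|u_\lambda\|_{(-N)}\ge c'\lambda^{-N-\frac n2+\frac{(n-1)\delta}2}\qquad\text{for all }\lambda\ge\lambda_0 .$$ (c) Put $S_{\lambda}=\bigcup_j\operatorname{supp}\varphi_{j}(\lambda^\delta\,\cdot)$ and let $\Gamma$ be the cone $\{(x,t\xi): t>0\}$ generated by all limit points $(x,\xi)$ of $(y,\partial\operatorname{Re}\omega_\lambda(y))$ as $\lambda\to\infty$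 ($s$ arbitrary), $y\in S_{\lambda}$ and $\operatorname{Im}\omega_\lambda(y)\to0$. Then for every real $k$, $\lambda^ku_\lambda\to0$ in $\mathcal D'_\Gamma$ as $\lambda\to\infty$, uniformly in $s$; that is, $\operatorname{WF}(u_\lambda)\subseteq\Gamma$ for large $\lambda$, $\lambda^k\int u_\lambda\psi\,dx\to0$ for every $\psi\in C_0^\infty(\mathbb R^n)$, and $\sup_{\xi\in V}|\xi|^m\lambda^k|\widehat{\chi u_\lambda}(\xi)|\to0$ for all integers $m\ge0$, $\chi\in C_0^\infty(\mathbb R^n)$ and closed cones $V\subseteq\mathbb R^n$ with $\Gamma\cap(\operatorname{supp}\chi\times V)=\emptyset$. (d) If $A$ is a pseudodifferential operator on $\mathbb R^n$ (the quantization of a symbol in some class $S^m_{1,0}$, with estimates locally uniform in $x$, plus an operator with smooth kernel) and $\operatorname{WF}(A)\cap\Gamma=\emptyset$, then for every real $k$, $\lambda^kAu_\lambda\to0$ in $C^\infty(\mathbb R^n)$ as $\lambda\to\infty$, uniformly in $s$. (e) If $\omega$ depends neither on $\lambda$ nor on $s$ and $S_{\lambda}$ decreases as $\lambda$ increases (for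 each $s$), then $\Gamma$ is the cone generated by $\{(x,\partial\omega(x)):\ x\in\Sigma,\ \operatorname{Im}\omega(x)=0\}$, where $\Sigma=\bigcap_{\lambda\ge1}\overline{\bigcup_sS_{\lambda}}$; when there is no parameter $s$, this is $\Sigma=\bigcap_{\lambda\ge1}\bigcup_j\operatorname{supp}\varphi_j(\lambda^\delta\,\cdot)$. -/

import Mathlib

open MeasureTheory Filter Topology Set
open scoped ContDiff ENNReal

noncomputable section

namespace OscSum

/-- `ℝⁿ` with its Euclidean norm. -/
abbrev Rn (n : ℕ) : Type := EuclideanSpace ℝ (Fin n)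

/-- The Fourier transform `û(ξ) = ∫ e^{-i⟨x, ξ⟩} u(x) dx`. -/
def hat {n : ℕ} (u : Rn n → ℂ) (ξ : Rn n) : ℂ :=
  ∫ x : Rn n, Complex.exp (-Complex.I * ((inner ℝ x ξ : ℝ) : ℂ)) * u x

/-- The `L²` Sobolev norm of order `s`,
`‖u‖_{(s)} = ((2π)^{-n} ∫ (1 + |ξ|²)^s |û(ξ)|² dξ)^{1/2}`, with values in `[0, ∞]`. -/
def sobolevNorm {n : ℕ} (s : ℝ) (u : Rn n → ℂ) : ℝ≥0∞ :=
  ENNReal.ofReal ((2 * Real.pi) ^ (-(n : ℝ) / 2)) *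
    eLpNorm (fun ξ : Rn n => (((1 + ‖ξ‖ ^ 2) ^ (s / 2) : ℝ) : ℂ) * hat u ξ) 2 volume

/-- Smooth functions with compact support. -/
def IsTest {n : ℕ} (χ : Rn n → ℂ) : Prop :=
  ContDiff ℝ ∞ χ ∧ HasCompactSupport χ

/-- The oscillatory sum
`λ^{(n-1)δ/2} exp(i λ w(x)) ∑_{j=0}^{M} φ_j(λ^δ x) λ^{-jϱ}`. -/
def oscSum {n M : ℕ} (δ ϱ lam : ℝ) (w : Rn n → ℂ) (φ : Fin (M + 1) → Rn n → ℂ) (x : Rn n) : ℂ :=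
  ((lam ^ (((n : ℝ) - 1) * δ / 2) : ℝ) : ℂ) * Complex.exp (Complex.I * (lam : ℂ) * w x) *
    ∑ j : Fin (M + 1), φ j (lam ^ δ • x) * ((lam ^ (-((j : ℕ) : ℝ) * ϱ) : ℝ) : ℂ)

/-- The set `⋃_j supp φ_j(λ^δ ·)`. -/
def oscSupport {n M : ℕ} (δ lam : ℝ) (φ : Fin (M + 1) → Rn n → ℂ) : Set (Rn n) :=
  ⋃ j : Fin (M + 1), tsupport (fun x : Rn n => φ j (lam ^ δ • x))

/-- The gradient of the real part of `w`. Where `Im w` attains the minimum value `0`, the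
differential of `Im w` vanishes, so there this is the full (real) covector `∂w(x)`. -/
def reGrad {n : ℕ} (w : Rn n → ℂ) (x : Rn n) : Rn n :=
  gradient (fun y : Rn n => (w y).re) x

/-- The cone (in the second variable) generated by a subset of `T*ℝⁿ = ℝⁿ × ℝⁿ`. -/
def coneGen {n : ℕ} (G : Set (Rn n × Rn n)) : Set (Rn n × Rn n) :=
  {p | ∃ q ∈ G, ∃ t : ℝ, 0 < t ∧ p = (q.1, t • q.2)}

/-- The set of limit points `(x, ξ)`, along the filter `l`, of `(y, ∂ Re w_a(y))` where
`y ∈ S_a` and `Im w_a(y) → 0`. -/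
def limitSet {n : ℕ} {α : Type*} (l : Filter α) (S : α → Set (Rn n)) (w : α → Rn n → ℂ) :
    Set (Rn n × Rn n) :=
  {p | ∀ ε : ℝ, 0 < ε → ∃ᶠ a in l, ∃ y ∈ S a,
    dist y p.1 < ε ∧ dist (reGrad (w a) y) p.2 < ε ∧ (w a y).im < ε}

/-- The wave front set of a locally integrable function `u`: `(x, ξ)` with `ξ ≠ 0` is outside it
iff, for some test function `χ` with `χ(x) ≠ 0`, the Fourier transform of `χ u` is rapidly
decreasing in a conic neighbourhood of `ξ`. -/
def waveFront {n : ℕ} (u : Rn n → ℂ) : Set (Rn n × Rn n) :=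
  {p | p.2 ≠ 0 ∧ ¬ ∃ χ : Rn n → ℂ, IsTest χ ∧ χ p.1 ≠ 0 ∧ ∃ V ∈ 𝓝 p.2,
    ∀ m : ℕ, ∃ C : ℝ, ∀ η ∈ V, ∀ t : ℝ, 0 < t →
      ‖hat (fun x => χ x * u x) (t • η)‖ ≤ C * (1 + ‖t • η‖) ^ (-(m : ℝ))}

/-- Convergence to `0` in `𝓓'_Γ` along a filter, for locally integrable functions regarded as
distributions: the wave front sets are in `Γ`, there is weak convergence in `𝓓'`, and
`sup_{ξ ∈ V} |ξ|^m |(χ u_a)^(ξ)| → 0` for all `m`, all test functions `χ` and all closed cones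
`V` such that `Γ ∩ (supp χ × V) = ∅`. -/
def TendstoZeroDGamma {n : ℕ} {α : Type*} (Γ : Set (Rn n × Rn n)) (l : Filter α)
    (u : α → Rn n → ℂ) : Prop :=
  (∀ᶠ a in l, LocallyIntegrable (u a) volume ∧ waveFront (u a) ⊆ Γ) ∧
  (∀ ψ : Rn n → ℂ, IsTest ψ → Tendsto (fun a => ∫ x : Rn n, u a x * ψ x) l (𝓝 0)) ∧
  (∀ (χ : Rn n → ℂ) (V : Set (Rn n)), IsTest χ → IsClosed V →
    (∀ ξ ∈ V, ∀ t : ℝ, 0 < t → t • ξ ∈ V) → Disjoint Γ (tsupport χ ×ˢ V) →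
    ∀ m : ℕ, ∀ ε : ℝ, 0 < ε →
      ∀ᶠ a in l, ∀ ξ ∈ V, ‖ξ‖ ^ m * ‖hat (fun x => χ x * u a x) ξ‖ ≤ ε)

/-- Convergence to `0` in `C^∞(ℝⁿ)` along a filter: all derivatives tend to `0` uniformly on
compact sets. -/
def TendstoZeroSmooth {n : ℕ} {α : Type*} (l : Filter α) (f : α → Rn n → ℂ) : Prop :=
  (∀ᶠ a in l, ContDiff ℝ ∞ (f a)) ∧
  ∀ (i : ℕ) (K : Set (Rn n)), IsCompact K → ∀ ε : ℝ, 0 < ε →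
    ∀ᶠ a in l, ∀ x ∈ K, ‖iteratedFDeriv ℝ i (f a) x‖ ≤ ε

/-- The norm of the mixed derivative `∂_x^i ∂_ξ^j a(x, ξ)`. -/
def mixedDerivNorm {n : ℕ} (a : Rn n → Rn n → ℂ) (i j : ℕ) (x ξ : Rn n) : ℝ :=
  ‖iteratedFDeriv ℝ i (fun y : Rn n => iteratedFDeriv ℝ j (a y) ξ) x‖

/-- The symbol class `S^m(ℝⁿ × ℝⁿ)` (type `1, 0`, estimates locally uniform in `x`). -/
def IsSymbol {n : ℕ} (m : ℝ) (a : Rn n → Rn n → ℂ) : Prop :=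
  ContDiff ℝ ∞ (fun p : Rn n × Rn n => a p.1 p.2) ∧
  ∀ (i j : ℕ) (K : Set (Rn n)), IsCompact K → ∃ C : ℝ, ∀ x ∈ K, ∀ ξ : Rn n,
    mixedDerivNorm a i j x ξ ≤ C * (1 + ‖ξ‖) ^ (m - (j : ℝ))

/-- A pseudodifferential operator on `ℝⁿ`: the quantization of a symbol in some `S^m` plus an
operator with smooth kernel. -/
structure PseudoDiffOp (n : ℕ) where
  /-- the order `m` -/
  order : ℝ
  /-- the full symbol `a(x, ξ)` -/
  symbol : Rn n → Rn n → ℂ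
  /-- the kernel `K(x, y)` of the smoothing part -/
  kernel : Rn n → Rn n → ℂ
  isSymbol : IsSymbol order symbol
  kernel_smooth : ContDiff ℝ ∞ (fun p : Rn n × Rn n => kernel p.1 p.2)

/-- `A u(x) = (2π)^{-n} ∫ e^{i⟨x, ξ⟩} a(x, ξ) û(ξ) dξ + ∫ K(x, y) u(y) dy`, for test functions
`u`. -/
def PseudoDiffOp.apply {n : ℕ} (A : PseudoDiffOp n) (u : Rn n → ℂ) (x : Rn n) : ℂ :=
  (((2 * Real.pi) ^ (-(n : ℝ)) : ℝ) : ℂ) *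
      (∫ ξ : Rn n, Complex.exp (Complex.I * ((inner ℝ x ξ : ℝ) : ℂ)) * A.symbol x ξ * hat u ξ) +
    ∫ y : Rn n, A.kernel x y * u y

/-- The wave front set of a pseudodifferential operator: `(x, ξ)` with `ξ ≠ 0` is outside it iff
the full symbol is of order `-∞` in a conic neighbourhood of `(x, ξ)`. -/
def PseudoDiffOp.waveFront {n : ℕ} (A : PseudoDiffOp n) : Set (Rn n × Rn n) :=
  {p | p.2 ≠ 0 ∧ ¬ ∃ U ∈ 𝓝 p.1, ∃ V ∈ 𝓝 p.2, ∀ i j m : ℕ, ∃ C : ℝ,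
    ∀ x ∈ U, ∀ η ∈ V, ∀ t : ℝ, 0 < t →
      mixedDerivNorm A.symbol i j x (t • η) ≤ C * (1 + ‖t • η‖) ^ (-(m : ℝ))}

/-- The cone `Γ` of a family `(w_{s,λ}, φ_{s,λ})`, `s ∈ ι`: generated by the limit points, as
`λ → ∞` and with `s` arbitrary, of `(y, ∂w_{s,λ}(y))` where `y ∈ ⋃_j supp φ_{s,λ,j}(λ^δ ·)` and
`Im w_{s,λ}(y) → 0`. -/
def oscCone {n M : ℕ} {ι : Type*} (δ : ℝ) (w : ι → ℝ → Rn n → ℂ)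
    (φ : ι → ℝ → Fin (M + 1) → Rn n → ℂ) : Set (Rn n × Rn n) :=
  coneGen (limitSet ((⊤ : Filter ι) ×ˢ (atTop : Filter ℝ))
    (fun a => oscSupport δ a.2 (φ a.1 a.2)) (fun a => w a.1 a.2))

end OscSum

end

open MeasureTheory Filter Topology Set
open scoped ContDiff ENNReal

noncomputable section

namespace OscSum

/-! ### Uniform symbol-type bounds for families of smooth functions -/

section Calculus

variable {α β E F G : Type*} [NormedAddCommGroup E] [NormedSpace ℝ E]
  [NormedAddCommGroup F] [NormedSpace ℝ F] [NormedAddCommGroup G] [NormedSpace ℝ G]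

/-! Write u_λ = λ^{(n-1)δ/2} e^{iλω} b with b(x) = ∑ φ_j(λ^δ x) λ^{-jϱ}. A derivative of b costs
λ^δ, while an integration by parts against e^{iλω} gains λ^{-1} because |d Re ω| ≥ c. Since δ < 1,
each step gains λ^{δ-1} in all, and enough steps give any power of λ. `nonstationary_decomposition`
is one such step, in a form that is used both under the integral sign (`nonstationary_phase`) and
for Sobolev norms. Uniformity is obtained by treating (s, λ), and where needed also ξ or x, as one
index of a family in `USmooth`.

Upper bound. For order 0, Plancherel reduces the claim to the volume of the support, a box with n -
1 sides of length O(λ^{-δ}); the factor λ^{(n-1)δ/2} cancels its square root. Raising the order by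
one costs a derivative, that is, a factor λ. To lower it, e^{iλω} b is written as λ^{-1} times a
divergence plus λ^{δ-1} times a function of the same kind, and the remainder is treated again
(`sobolevBound_pred`).

Lower bound. The transform of u_λ is paired with a wave packet at position x₀ and frequency λη, η =
dω(x₀). This covector is real since Im ω has a minimum at x₀, so on the scale 1/λ the function
e^{iλω} b is a plane wave up to O(λ^{δ-1}) (`norm_osc_sub_planeWave_le`). The pairing therefore
stays away from 0, and Cauchy-Schwarz on a ball of radius comparable to λ, consisting of frequencies
of size λ, gives the factor λ^{-N-n/2} (`wNorm_ge`).

Convergence in 𝓓'_Γ. The transform of χu_λ at ξ has the phase λω - ⟨x, ξ⟩. If the closed cone V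
misses Γ over supp χ, then compactness yields |λ d Re ω - ξ| ≥ ε(λ + |ξ|) for ξ ∈ V wherever Im ω <
ε (`exists_separation`). Non-stationary phase applies there, and elsewhere e^{iλω} is exponentially
small (`norm_hat_cut_le`).

Pseudodifferential operators. Near a point x₀ the function is split by a cutoff. For the distant
part, integrations by parts in ξ lower the order of the symbol at will
(`norm_integral_symbolIntegrand_le_of_separated`). For the near part every direction is either
outside Γ, where the transform decreases rapidly, or outside WF(A), where the symbol does; finitely
many such directions suffice (`exists_nearBound`). Derivatives in x only replace b by iξ_k b + ∂_k
b, which stays in the class `SymbolAt`. The smooth kernel is harmless by non-stationary phase.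

Description of Γ. For a fixed phase the gradient is continuous, and for decreasing supports a point
used at a large λ is available at every smaller λ, so limit points are exactly the points over Σ
with Im ω = 0. -/

/-- A family of smooth functions whose derivatives of order `i` are `O(μ ^ i)` on `K`,
uniformly in the family. -/
structure USmooth (K : Set E) (μ : α → ℝ) (f : α → E → F) : Prop where
  smooth : ∀ a, ContDiff ℝ ∞ (f a)
  bound : ∀ i : ℕ, ∃ C : ℝ, 0 ≤ C ∧ ∀ a, ∀ x ∈ K, ‖iteratedFDeriv ℝ i (f a) x‖ ≤ C * μ a ^ i

namespace USmooth

variable {K : Set E} {μ : α → ℝ}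

theorem mono {f : α → E → F} (hf : USmooth K μ f) {L : Set E} (hL : L ⊆ K) {ν : α → ℝ}
    (h0 : ∀ a, 0 ≤ μ a) (hν : ∀ a, μ a ≤ ν a) : USmooth L ν f := by
  refine ⟨hf.smooth, fun i => ?_⟩
  obtain ⟨C, hC, h⟩ := hf.bound i
  refine ⟨C, hC, fun a x hx => (h a x (hL hx)).trans ?_⟩
  have := h0 a
  have := hν a
  gcongr

theorem reindex {f : α → E → F} (hf : USmooth K μ f) (r : β → α) :
    USmooth K (fun b => μ (r b)) (fun b => f (r b)) :=
  ⟨fun _ => hf.smooth _, fun i => (hf.bound i).imp fun _ h => ⟨h.1, fun b => h.2 (r b)⟩⟩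

theorem fixed [ProperSpace E] {f : E → F} (hf : ContDiff ℝ ∞ f) (hK : Bornology.IsBounded K) :
    USmooth K (fun _ : α => 1) (fun _ => f) := by
  refine ⟨fun _ => hf, fun i => ?_⟩
  have hc : Continuous fun x => ‖iteratedFDeriv ℝ i f x‖ :=
    (hf.continuous_iteratedFDeriv (by exact_mod_cast le_top)).norm
  obtain ⟨C, hC⟩ := (hK.isCompact_closure.image hc).bddAbove
  refine ⟨max C 0, le_max_right _ _, fun _ x hx => ?_⟩
  have : ‖iteratedFDeriv ℝ i f x‖ ≤ C := hC ⟨x, subset_closure hx, rfl⟩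
  simpa using Or.inl this

theorem const {c : α → F} {B : ℝ} (hc : ∀ a, ‖c a‖ ≤ B) :
    USmooth K (fun _ => 1) (fun a (_ : E) => c a) := by
  refine ⟨fun _ => contDiff_const, fun i => ⟨max B 0, le_max_right _ _, fun a x _ => ?_⟩⟩
  rcases eq_or_ne i 0 with rfl | hi
  · simpa using Or.inl (hc a)
  · rw [iteratedFDeriv_const_of_ne hi]
    simp

theorem add {f g : α → E → F} (hf : USmooth K μ f) (hg : USmooth K μ g) :
    USmooth K μ (fun a x => f a x + g a x) := by
  refine ⟨fun a => (hf.smooth a).add (hg.smooth a), fun i => ?_⟩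
  obtain ⟨C, hC, h⟩ := hf.bound i
  obtain ⟨D, hD, h'⟩ := hg.bound i
  refine ⟨C + D, by positivity, fun a x hx => ?_⟩
  have e : iteratedFDeriv ℝ i (fun x => f a x + g a x) x =
      iteratedFDeriv ℝ i (f a) x + iteratedFDeriv ℝ i (g a) x :=
    iteratedFDeriv_add_apply ((hf.smooth a).contDiffAt.of_le (by exact_mod_cast le_top))
      ((hg.smooth a).contDiffAt.of_le (by exact_mod_cast le_top))
  rw [e, add_mul]
  exact (norm_add_le _ _).trans (add_le_add (h a x hx) (h' a x hx))

theorem clm_comp {f : α → E → F} (hf : USmooth K μ f) (L : F →L[ℝ] G) :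
    USmooth K μ (fun a x => L (f a x)) := by
  refine ⟨fun a => L.contDiff.comp (hf.smooth a), fun i => ?_⟩
  obtain ⟨C, hC, h⟩ := hf.bound i
  refine ⟨‖L‖ * C, by positivity, fun a x hx => ?_⟩
  refine (L.norm_iteratedFDeriv_comp_left (hf.smooth a).contDiffAt
    (by exact_mod_cast le_top)).trans ?_
  rw [mul_assoc]
  exact mul_le_mul_of_nonneg_left (h a x hx) (norm_nonneg _)

theorem neg {f : α → E → F} (hf : USmooth K μ f) : USmooth K μ (fun a x => -f a x) :=
  hf.clm_comp (-ContinuousLinearMap.id ℝ F)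

theorem sum {κ : Type*} (s : Finset κ) {f : κ → α → E → F}
    (hf : ∀ k ∈ s, USmooth K μ (f k)) :
    USmooth K μ (fun a x => ∑ k ∈ s, f k a x) := by
  classical
  induction s using Finset.induction_on with
  | empty =>
    refine ⟨fun a => by simpa using contDiff_const, fun i => ⟨0, le_rfl, fun a x _ => ?_⟩⟩
    simp only [Finset.sum_empty]
    rw [iteratedFDeriv_fun_zero]
    simp
  | insert k s hk ih =>
    simp only [Finset.sum_insert hk]
    exact (hf k (by simp)).add (ih fun j hj => hf j (by simp [hj]))

/-- Leibniz' rule: the weights combine because μ^j μ^{i-j} = μ^i. -/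
theorem mul {A : Type*} [NormedRing A] [NormedAlgebra ℝ A] {f g : α → E → A}
    (hf : USmooth K μ f) (hg : USmooth K μ g) (hμ : ∀ a, 0 ≤ μ a) :
    USmooth K μ (fun a x => f a x * g a x) := by
  refine ⟨fun a => (hf.smooth a).mul (hg.smooth a), fun i => ?_⟩
  choose C hC h using hf.bound
  choose D hD h' using hg.bound
  refine ⟨∑ j ∈ Finset.range (i + 1), (i.choose j : ℝ) * C j * D (i - j),
    Finset.sum_nonneg fun j _ => by have := hC j; have := hD (i - j); positivity,
    fun a x hx => ?_⟩
  refine (norm_iteratedFDeriv_mul_le (hf.smooth a) (hg.smooth a) x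
    (by exact_mod_cast le_top)).trans ?_
  rw [Finset.sum_mul]
  refine Finset.sum_le_sum fun j hj => ?_
  have hji : j ≤ i := Nat.lt_succ_iff.mp (Finset.mem_range.mp hj)
  have h1 := h j a x hx
  have h2 := h' (i - j) a x hx
  have := hμ a
  have := hC j
  calc _ ≤ (i.choose j : ℝ) * (C j * μ a ^ j) * (D (i - j) * μ a ^ (i - j)) := by gcongr
    _ = (i.choose j : ℝ) * C j * D (i - j) * (μ a ^ j * μ a ^ (i - j)) := by ring
    _ = _ := by rw [← pow_add, Nat.add_sub_cancel' hji]

/-- The values on K lie in one closed ball, which is compact, so the derivatives of g are bounded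
there and the Faà di Bruno estimate is uniform. -/
theorem comp [ProperSpace F] {f : α → E → F} (hf : USmooth K (fun _ => 1) f) {g : F → G}
    (hg : ContDiff ℝ ∞ g) : USmooth K (fun _ => 1) (fun a x => g (f a x)) := by
  refine ⟨fun a => hg.comp (hf.smooth a), fun i => ?_⟩
  choose C hC h using hf.bound
  have hb : ∀ a, ∀ x ∈ K, f a x ∈ Metric.closedBall (0 : F) (C 0) := fun a x hx => by
    simpa using h 0 a x hx
  choose D hD h' using (fixed (α := Unit) hg (Metric.isBounded_closedBall (x := 0) (r := C 0))).bound
  -- The summand 1 ensures M ≥ 1, so that C j ≤ M ≤ M ^ j for j ≥ 1, the form needed by the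
  -- composition estimate.
  set M := 1 + ∑ j ∈ Finset.range (i + 1), C j
  set N := ∑ j ∈ Finset.range (i + 1), D j
  have hM : 1 ≤ M := le_add_of_nonneg_right (Finset.sum_nonneg fun j _ => hC j)
  have hN : 0 ≤ N := Finset.sum_nonneg fun j _ => hD j
  refine ⟨i.factorial * N * M ^ i, by positivity, fun a x hx => ?_⟩
  simp only [one_pow, mul_one]
  refine norm_iteratedFDeriv_comp_le hg (hf.smooth a) (by exact_mod_cast le_top) x ?_ ?_
  · intro j hj
    have := h' j () (f a x) (hb a x hx)
    simp only [one_pow, mul_one] at this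
    exact this.trans (Finset.single_le_sum (fun j _ => hD j)
      (Finset.mem_range.mpr (Nat.lt_succ_of_le hj)))
  · intro j hj1 hj
    have := h j a x hx
    simp only [one_pow, mul_one] at this
    refine this.trans ((Finset.single_le_sum (fun j _ => hC j)
      (Finset.mem_range.mpr (Nat.lt_succ_of_le hj))).trans ?_)
    exact (le_add_of_nonneg_left zero_le_one).trans (le_self_pow₀ hM (by omega))

/-- The factor μ⁻¹ pays for the extra derivative, so normalized derivatives remain in the class and
integrations by parts can be iterated. -/
theorem fderiv {f : α → E → F} (hf : USmooth K μ f) (hμ : ∀ a, 0 < μ a) (v : E) :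
    USmooth K μ (fun a x => (μ a)⁻¹ • fderiv ℝ (f a) x v) := by
  have hsm : ∀ a, ContDiff ℝ ∞ (_root_.fderiv ℝ (f a)) := fun a =>
    (hf.smooth a).fderiv_right (by simp)
  refine ⟨fun a => ((hsm a).clm_apply contDiff_const).const_smul _, fun i => ?_⟩
  obtain ⟨C, hC, h⟩ := hf.bound (i + 1)
  refine ⟨‖ContinuousLinearMap.apply ℝ F v‖ * C, by positivity, fun a x hx => ?_⟩
  have e : (fun x => (μ a)⁻¹ • _root_.fderiv ℝ (f a) x v) =
      ((μ a)⁻¹ • ContinuousLinearMap.apply ℝ F v) ∘ _root_.fderiv ℝ (f a) := by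
    ext x; simp
  rw [e]
  refine (ContinuousLinearMap.norm_iteratedFDeriv_comp_left _ (hsm a).contDiffAt
    (by exact_mod_cast le_top)).trans ?_
  rw [norm_iteratedFDeriv_fderiv, norm_smul, norm_inv, Real.norm_of_nonneg (hμ a).le]
  have := h a x hx
  have := hμ a
  calc _ ≤ (μ a)⁻¹ * ‖ContinuousLinearMap.apply ℝ F v‖ * (C * μ a ^ (i + 1)) := by gcongr
    _ = _ := by rw [pow_succ]; field_simp

theorem fderiv_one {f : α → E → F} (hf : USmooth K (fun _ => 1) f) (v : E) :
    USmooth K (fun _ => 1) (fun a x => _root_.fderiv ℝ (f a) x v) := by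
  simpa using hf.fderiv (fun _ => one_pos) v

/-- Rescaling the variable. -/
theorem rescale {f : α → E → F} (hf : USmooth univ (fun _ => 1) f) (hμ : ∀ a, 0 ≤ μ a) :
    USmooth K μ (fun a x => f a (μ a • x)) := by
  refine ⟨fun a => (hf.smooth a).comp (contDiff_const_smul _), fun i => ?_⟩
  obtain ⟨C, hC, h⟩ := hf.bound i
  refine ⟨C, hC, fun a x _ => ?_⟩
  have := (μ a • ContinuousLinearMap.id ℝ E).iteratedFDeriv_comp_right (hf.smooth a) x (i := i)
    (by exact_mod_cast le_top)
  have e : (f a ∘ (μ a • ContinuousLinearMap.id ℝ E : E →L[ℝ] E)) = fun x => f a (μ a • x) := by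
    ext; simp
  rw [e] at this
  rw [this]
  refine (ContinuousMultilinearMap.norm_compContinuousLinearMap_le _ _).trans ?_
  have hn : ‖(μ a • ContinuousLinearMap.id ℝ E : E →L[ℝ] E)‖ ≤ μ a := by
    refine (norm_smul_le (μ a) (ContinuousLinearMap.id ℝ E)).trans ?_
    rw [Real.norm_of_nonneg (hμ a)]
    exact mul_le_of_le_one_right (hμ a) ContinuousLinearMap.norm_id_le
  have h1 := h a ((μ a • ContinuousLinearMap.id ℝ E : E →L[ℝ] E) x) (mem_univ _)
  rw [one_pow, mul_one] at h1
  have := hμ a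
  rw [Finset.prod_const, Finset.card_univ, Fintype.card_fin]
  gcongr

theorem norm_le {f : α → E → F} (hf : USmooth K μ f) :
    ∃ C : ℝ, 0 ≤ C ∧ ∀ a, ∀ x ∈ K, ‖f a x‖ ≤ C := by
  obtain ⟨C, hC, h⟩ := hf.bound 0
  exact ⟨C, hC, fun a x hx => by simpa using h a x hx⟩

end USmooth

end Calculus

end OscSum
end

open MeasureTheory Filter Topology Set
open scoped ContDiff ENNReal

noncomputable section

namespace OscSum

/-! ### The Fourier transform with kernel e^{-i⟨x, ξ⟩} -/

section FourierTransform

open scoped FourierTransform SchwartzMap LineDeriv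

variable {n : ℕ}

/-- The `k`-th standard basis vector. -/
def stdVec (k : Fin n) : Rn n := EuclideanSpace.single k 1

theorem norm_stdVec (k : Fin n) : ‖stdVec k‖ = 1 := by simp [stdVec]

theorem inner_stdVec (x : Rn n) (k : Fin n) : inner ℝ x (stdVec k) = x k := by
  simp [stdVec, EuclideanSpace.inner_single_right]

/-- The `k`-th partial derivative. -/
def pd (k : Fin n) (f : Rn n → ℂ) (x : Rn n) : ℂ := fderiv ℝ f x (stdVec k)

theorem contDiff_pd {f : Rn n → ℂ} (hf : ContDiff ℝ ∞ f) (k : Fin n) : ContDiff ℝ ∞ (pd k f) :=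
  (hf.fderiv_right (m := ∞) (by simp)).clm_apply contDiff_const

theorem tsupport_pd_subset (f : Rn n → ℂ) (k : Fin n) : tsupport (pd k f) ⊆ tsupport f :=
  tsupport_fderiv_apply_subset ℝ (stdVec k)

theorem IsTest.pd {f : Rn n → ℂ} (hf : IsTest f) (k : Fin n) : IsTest (OscSum.pd k f) :=
  ⟨contDiff_pd hf.1 k, hf.2.mono' ((subset_tsupport _).trans (tsupport_pd_subset f k))⟩

theorem pd_mul {f g : Rn n → ℂ} {x : Rn n} (hf : DifferentiableAt ℝ f x)
    (hg : DifferentiableAt ℝ g x) (k : Fin n) :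
    pd k (fun y => f y * g y) x = pd k f x * g x + f x * pd k g x := by
  simp only [pd]
  rw [fderiv_fun_mul hf hg]
  simp
  ring

/-- The Schwartz function given by a test function. -/
def IsTest.toSchwartz {u : Rn n → ℂ} (hu : IsTest u) : 𝓢(Rn n, ℂ) := hu.2.toSchwartzMap hu.1

theorem IsTest.coe_toSchwartz {u : Rn n → ℂ} (hu : IsTest u) : ⇑hu.toSchwartz = u := rfl

theorem IsTest.integrable {u : Rn n → ℂ} (hu : IsTest u) : Integrable u :=
  hu.toSchwartz.integrable

theorem schwartz_decay (g : 𝓢(Rn n, ℂ)) (N : ℕ) :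
    ∃ C : ℝ, 0 ≤ C ∧ ∀ x, ‖g x‖ ≤ C * ((1 + ‖x‖) ^ N)⁻¹ := by
  refine ⟨2 ^ N * (Finset.Iic (N, 0)).sup (fun m => SchwartzMap.seminorm ℝ m.1 m.2) g,
    by positivity, fun x => ?_⟩
  have := SchwartzMap.one_add_le_sup_seminorm_apply (𝕜 := ℝ) (m := (N, 0)) (k := N) (n := 0)
    le_rfl le_rfl g x
  rw [norm_iteratedFDeriv_zero] at this
  rw [← div_eq_mul_inv, le_div_iff₀ (by positivity), mul_comm]
  simpa using this

/-- `𝓕` has the kernel e^{-2πi⟨x, ξ⟩}. This dilation transfers its theory and produces all the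
powers of 2π below. -/
theorem hat_eq (u : Rn n → ℂ) (ξ : Rn n) : hat u ξ = 𝓕 u ((2 * Real.pi)⁻¹ • ξ) := by
  rw [Real.fourier_eq', hat]
  congr 1
  ext x
  rw [inner_smul_right, smul_eq_mul]
  congr 2
  push_cast
  have : (Real.pi : ℂ) ≠ 0 := by exact_mod_cast Real.pi_ne_zero
  field_simp

/-- The Fourier transform (with the convention of `hat`) of a Schwartz function. -/
def hatS (f : 𝓢(Rn n, ℂ)) : 𝓢(Rn n, ℂ) :=
  SchwartzMap.compCLMOfContinuousLinearEquiv ℝ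
    (ContinuousLinearEquiv.smulLeft (R₁ := ℝ) (M₁ := Rn n)
      (Units.mk0 ((2 * Real.pi)⁻¹ : ℝ) (by positivity))) (𝓕 f)

theorem coe_hatS (f : 𝓢(Rn n, ℂ)) : ⇑(hatS f) = hat f := by
  ext ξ
  rw [hat_eq]
  rw [← SchwartzMap.fourier_coe]
  rfl

theorem hat_pd (f : 𝓢(Rn n, ℂ)) (k : Fin n) (ξ : Rn n) :
    hat (pd k f) ξ = Complex.I * (ξ k : ℂ) * hat f ξ := by
  have h := SchwartzMap.fourier_lineDerivOp_eq f (stdVec k)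
  have h1 : ((∂_{stdVec k} f : 𝓢(Rn n, ℂ)) : Rn n → ℂ) = pd k f := by
    ext x
    rfl
  have hg : (inner ℝ · (stdVec k : Rn n)).HasTemperateGrowth :=
    ((innerSL ℝ).flip (stdVec k)).hasTemperateGrowth
  rw [hat_eq, hat_eq, ← h1, ← SchwartzMap.fourier_coe, h]
  simp only [_root_.smul_apply, SchwartzMap.smulLeftCLM_apply_apply hg]
  rw [← SchwartzMap.fourier_coe]
  simp only [inner_stdVec]
  simp only [PiLp.smul_apply, smul_eq_mul, Complex.real_smul]
  have : (Real.pi : ℂ) ≠ 0 := by exact_mod_cast Real.pi_ne_zero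
  push_cast
  field_simp

theorem pd_hat (f : 𝓢(Rn n, ℂ)) (k : Fin n) (ξ : Rn n) :
    pd k (hat f) ξ = hat (fun y => -Complex.I * (y k : ℂ) * f y) ξ := by
  have h := SchwartzMap.lineDerivOp_fourier_eq f (stdVec k)
  have hg : (inner ℝ · (stdVec k : Rn n)).HasTemperateGrowth :=
    ((innerSL ℝ).flip (stdVec k)).hasTemperateGrowth
  have e : hat f = fun ξ => (𝓕 f) ((2 * Real.pi)⁻¹ • ξ) := by
    ext ξ
    rw [hat_eq, SchwartzMap.fourier_coe]
  have hd : pd k (hat f) ξ = (2 * Real.pi)⁻¹ • (∂_{stdVec k} (𝓕 f)) ((2 * Real.pi)⁻¹ • ξ) := by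
    have h2 : HasFDerivAt (fun ξ : Rn n => (𝓕 f) ((2 * Real.pi)⁻¹ • ξ))
        ((fderiv ℝ (⇑(𝓕 f : 𝓢(Rn n, ℂ))) ((2 * Real.pi)⁻¹ • ξ)).comp
          ((2 * Real.pi)⁻¹ • ContinuousLinearMap.id ℝ (Rn n))) ξ :=
      HasFDerivAt.comp ξ (SchwartzMap.differentiableAt (𝓕 f)).hasFDerivAt
        ((2 * Real.pi)⁻¹ • ContinuousLinearMap.id ℝ (Rn n)).hasFDerivAt
    rw [pd, e, h2.fderiv]
    simp
    rfl
  rw [hd, h, hat_eq, SchwartzMap.fourier_coe, Real.fourier_eq, Real.fourier_eq,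
    ← integral_smul]
  congr 1
  ext x
  simp only [_root_.smul_apply, SchwartzMap.smulLeftCLM_apply_apply hg]
  simp only [inner_stdVec]
  have : (Real.pi : ℂ) ≠ 0 := by exact_mod_cast Real.pi_ne_zero
  simp only [Circle.smul_def, smul_eq_mul, Complex.real_smul]
  push_cast
  field_simp

theorem integral_comp_two_pi (g : Rn n → ℂ) :
    ∫ ξ, g ((2 * Real.pi)⁻¹ • ξ) = ((2 * Real.pi) ^ n : ℝ) • ∫ ξ, g ξ := by
  rw [Measure.integral_comp_smul]
  congr 1
  rw [finrank_euclideanSpace, Fintype.card_fin, inv_pow, inv_inv, abs_of_nonneg (by positivity)]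

/-- Fourier inversion at the origin. In the lower Sobolev bound it makes the pairing with a wave
packet nonzero. -/
theorem integral_hat (f : 𝓢(Rn n, ℂ)) : ∫ ξ, hat f ξ = ((2 * Real.pi) ^ n : ℝ) * f 0 := by
  have h : (𝓕⁻ (𝓕 f)) 0 = f 0 := by simp
  rw [SchwartzMap.fourierInv_coe, Real.fourierInv_eq] at h
  simp only [inner_zero_right, AddChar.map_zero_eq_one, one_smul] at h
  rw [← h, ← Complex.real_smul, ← integral_comp_two_pi]
  congr 1
  ext ξ
  rw [hat_eq, SchwartzMap.fourier_coe]

theorem plancherel (f : 𝓢(Rn n, ℂ)) :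
    eLpNorm (hat f) 2 volume = ENNReal.ofReal ((2 * Real.pi) ^ ((n : ℝ) / 2)) * eLpNorm f 2 volume := by
  rw [← coe_hatS, ((hatS f).memLp 2 volume).eLpNorm_eq_integral_rpow_norm (by simp) (by simp),
    (f.memLp 2 volume).eLpNorm_eq_integral_rpow_norm (by simp) (by simp),
    ← ENNReal.ofReal_mul (by positivity)]
  congr 1
  have h1 := SchwartzMap.integral_norm_sq_fourier f
  have h2 : ∫ ξ, ‖hatS f ξ‖ ^ (2 : ℝ) = (2 * Real.pi) ^ n * ∫ x, ‖f x‖ ^ (2 : ℝ) := by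
    simp only [Real.rpow_two]
    rw [← h1, coe_hatS]
    simp only [hat_eq]
    rw [Measure.integral_comp_smul volume (fun ξ => ‖𝓕 (⇑f) ξ‖ ^ 2), finrank_euclideanSpace,
      Fintype.card_fin, inv_pow, inv_inv, abs_of_nonneg (by positivity), smul_eq_mul,
      SchwartzMap.fourier_coe]
  simp only [ENNReal.toReal_ofNat]
  rw [h2, Real.mul_rpow (by positivity) (integral_nonneg fun _ => by positivity),
    ← Real.rpow_natCast, ← Real.rpow_mul (by positivity)]
  congr 2

theorem integrable_hat_integrand {u : Rn n → ℂ} (hu : Integrable u) (ξ : Rn n) :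
    Integrable (fun x => Complex.exp (-Complex.I * ((inner ℝ x ξ : ℝ) : ℂ)) * u x) := by
  refine hu.bdd_mul (c := 1) (Continuous.aestronglyMeasurable (by fun_prop))
    (ae_of_all _ fun x => ?_)
  rw [Complex.norm_exp]
  simp

theorem hat_add {u v : Rn n → ℂ} (hu : Integrable u) (hv : Integrable v) (ξ : Rn n) :
    hat (fun x => u x + v x) ξ = hat u ξ + hat v ξ := by
  simp only [hat, mul_add]
  exact integral_add (integrable_hat_integrand hu ξ) (integrable_hat_integrand hv ξ)

theorem hat_const_mul (c : ℂ) (u : Rn n → ℂ) (ξ : Rn n) :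
    hat (fun x => c * u x) ξ = c * hat u ξ := by
  simp only [hat]
  rw [← integral_const_mul]
  congr 1
  ext x
  ring

theorem hat_sum {κ : Type*} (s : Finset κ) {u : κ → Rn n → ℂ} (hu : ∀ k ∈ s, Integrable (u k))
    (ξ : Rn n) : hat (fun x => ∑ k ∈ s, u k x) ξ = ∑ k ∈ s, hat (u k) ξ := by
  simp only [hat, Finset.mul_sum]
  exact integral_finsetSum _ fun k hk => integrable_hat_integrand (hu k hk) ξ

theorem norm_integral_le_of_support {u : Rn n → ℂ} {K : Set (Rn n)} (hK : IsCompact K) {C : ℝ}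
    (hu : ∀ x, ‖u x‖ ≤ C) (hs : ∀ x, x ∉ K → u x = 0) :
    ‖∫ x, u x‖ ≤ C * volume.real K := by
  rw [← setIntegral_eq_integral_of_forall_compl_eq_zero hs]
  exact norm_setIntegral_le_of_norm_le_const hK.measure_lt_top fun x _ => hu x

theorem norm_hat_le {u : Rn n → ℂ} {K : Set (Rn n)} (hK : IsCompact K) {C : ℝ}
    (hu : ∀ x, ‖u x‖ ≤ C) (hs : ∀ x, x ∉ K → u x = 0) (ξ : Rn n) :
    ‖hat u ξ‖ ≤ C * volume.real K := by
  refine norm_integral_le_of_support hK (fun x => ?_) fun x hx => by simp [hs x hx]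
  rw [norm_mul, Complex.norm_exp]
  simpa using hu x

/-- The transform of a derivative carries the factor ξ_k, which vanishes at ξ = 0. -/
theorem integral_pd_eq_zero {f : Rn n → ℂ} (hf : IsTest f) (k : Fin n) : ∫ x, pd k f x = 0 := by
  have h := hat_pd hf.toSchwartz k 0
  simpa [hat, hf.coe_toSchwartz] using h

end FourierTransform

end OscSum
end

open MeasureTheory Filter Topology Set
open scoped ContDiff ENNReal

noncomputable section

namespace OscSum

/-! ### Integration by parts and non-stationary phase for complex phases -/

section NonStationaryPhase

variable {α : Type*} {n : ℕ}

theorem pd_cexp {Ψ : Rn n → ℂ} (hΨ : ContDiff ℝ ∞ Ψ) (ρ : ℝ) (k : Fin n) (x : Rn n) :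
    pd k (fun y => Complex.exp (Complex.I * (ρ : ℂ) * Ψ y)) x =
      Complex.I * (ρ : ℂ) * pd k Ψ x * Complex.exp (Complex.I * (ρ : ℂ) * Ψ x) := by
  have h := ((hΨ.differentiable (by simp) x).hasFDerivAt.const_mul (Complex.I * (ρ : ℂ))).cexp
  rw [pd, h.fderiv, pd]
  simp
  ring

theorem contDiff_cexp_phase {Ψ : Rn n → ℂ} (hΨ : ContDiff ℝ ∞ Ψ) (ρ : ℝ) :
    ContDiff ℝ ∞ (fun y => Complex.exp (Complex.I * (ρ : ℂ) * Ψ y)) :=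
  (contDiff_const.mul hΨ).cexp

theorem norm_cexp_phase_le {z : ℂ} (hz : 0 ≤ z.im) {ρ : ℝ} (hρ : 0 ≤ ρ) :
    ‖Complex.exp (Complex.I * (ρ : ℂ) * z)‖ ≤ 1 := by
  rw [Complex.norm_exp, Real.exp_le_one_iff]
  have : (Complex.I * (ρ : ℂ) * z).re = -(ρ * z.im) := by simp
  rw [this]
  have := mul_nonneg hρ hz
  linarith

/-- A smooth function on the line that equals `1 / t` for `t ≥ ε`. -/
def invCut (ε t : ℝ) : ℝ := Real.smoothTransition ((t - ε / 2) / (ε / 2)) / t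

theorem contDiff_invCut {ε : ℝ} (hε : 0 < ε) : ContDiff ℝ ∞ (invCut ε) := by
  rw [contDiff_iff_contDiffAt]
  intro t
  rcases lt_or_ge t (ε / 2) with ht | ht
  · have : invCut ε =ᶠ[𝓝 t] fun _ => 0 := by
      filter_upwards [gt_mem_nhds ht] with s hs
      rw [invCut, Real.smoothTransition.zero_of_nonpos, zero_div]
      exact div_nonpos_of_nonpos_of_nonneg (by linarith) (by linarith)
    exact contDiffAt_const.congr_of_eventuallyEq this
  · have h : ContDiff ℝ ∞ (fun t : ℝ => Real.smoothTransition ((t - ε / 2) / (ε / 2))) :=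
      Real.smoothTransition.contDiff.comp ((contDiff_id.sub contDiff_const).div_const _)
    exact h.contDiffAt.div contDiffAt_id (by simp; linarith)

theorem invCut_of_le {ε t : ℝ} (hε : 0 < ε) (ht : ε ≤ t) : invCut ε t = t⁻¹ := by
  rw [invCut, Real.smoothTransition.one_of_one_le, one_div]
  rw [le_div_iff₀ (by linarith)]
  linarith

/-- The square of the length of the complex gradient. -/
def gradSq (Ψ : Rn n → ℂ) (x : Rn n) : ℝ := ∑ k, ‖pd k Ψ x‖ ^ 2

theorem USmooth.pd_one {K : Set (Rn n)} {f : α → Rn n → ℂ} (hf : USmooth K (fun _ => 1) f)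
    (k : Fin n) : USmooth K (fun _ => 1) (fun a => pd k (f a)) :=
  hf.fderiv_one (stdVec k)

theorem USmooth.pd {K : Set (Rn n)} {μ : α → ℝ} {f : α → Rn n → ℂ} (hf : USmooth K μ f)
    (hμ : ∀ a, 0 < μ a) (k : Fin n) :
    USmooth K μ (fun a x => ((μ a)⁻¹ : ℝ) • OscSum.pd k (f a) x) :=
  hf.fderiv hμ (stdVec k)

theorem USmooth.const_mul {K : Set (Rn n)} {μ : α → ℝ} {f : α → Rn n → ℂ} (hf : USmooth K μ f)
    (c : ℂ) : USmooth K μ (fun a x => c * f a x) :=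
  hf.clm_comp (ContinuousLinearMap.mul ℝ ℂ c)

theorem USmooth.gradSq {K : Set (Rn n)} {f : α → Rn n → ℂ} (hf : USmooth K (fun _ => 1) f) :
    USmooth K (fun _ => 1) (fun a => gradSq (f a)) := by
  refine USmooth.sum _ fun k _ => ?_
  have h := hf.pd_one k
  have h2 := (h.clm_comp Complex.reCLM).mul (h.clm_comp Complex.reCLM) fun _ => zero_le_one
  have h3 := (h.clm_comp Complex.imCLM).mul (h.clm_comp Complex.imCLM) fun _ => zero_le_one
  have e : (fun a x => ‖OscSum.pd k (f a) x‖ ^ 2) = fun a x =>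
      Complex.reCLM (OscSum.pd k (f a) x) * Complex.reCLM (OscSum.pd k (f a) x) +
      Complex.imCLM (OscSum.pd k (f a) x) * Complex.imCLM (OscSum.pd k (f a) x) := by
    ext a x
    rw [Complex.sq_norm, Complex.normSq_apply]
    rfl
  rw [e]
  exact h2.add h3

/-- Away from critical points an oscillatory function is a sum of derivatives of oscillatory
functions and a lower order term. -/
theorem nonstationary_decomposition {K : Set (Rn n)} {ρ μ : α → ℝ}
    {Ψ b : α → Rn n → ℂ} {ε : ℝ} (hε : 0 < ε) (hρ : ∀ a, 0 < ρ a) (hμ : ∀ a, 1 ≤ μ a)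
    (hΨ : USmooth K (fun _ => 1) Ψ) (hb : USmooth K μ b)
    (hgrad : ∀ a, ∀ x ∈ tsupport (b a), ε ≤ gradSq (Ψ a) x) :
    ∃ (B : Fin n → α → Rn n → ℂ) (B' : α → Rn n → ℂ),
      (∀ k, USmooth K μ (B k)) ∧ USmooth K μ B' ∧
      (∀ k a, tsupport (B k a) ⊆ tsupport (b a)) ∧ (∀ a, tsupport (B' a) ⊆ tsupport (b a)) ∧
      ∀ a x, Complex.exp (Complex.I * (ρ a : ℂ) * Ψ a x) * b a x =
        (((ρ a)⁻¹ : ℝ) : ℂ) *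
          ∑ k, pd k (fun y => Complex.exp (Complex.I * (ρ a : ℂ) * Ψ a y) * B k a y) x +
        ((μ a / ρ a : ℝ) : ℂ) * (Complex.exp (Complex.I * (ρ a : ℂ) * Ψ a x) * B' a x) := by
  have hμ0 : ∀ a, 0 < μ a := fun a => one_pos.trans_le (hμ a)
  -- The vector field with coefficients M k sends Ψ to 1 on the support of b. The conjugate is there
  -- because Ψ is complex, and `invCut` makes the reciprocal of the squared gradient smooth
  -- everywhere.
  set M : Fin n → α → Rn n → ℂ := fun k a x =>
    (starRingEnd ℂ) (pd k (Ψ a) x) * ((invCut ε (gradSq (Ψ a) x) : ℝ) : ℂ) with hM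
  have hMs : ∀ k, USmooth K μ (M k) := fun k => by
    have h1 : USmooth K (fun _ => 1) (fun a x => (starRingEnd ℂ) (pd k (Ψ a) x)) :=
      (hΨ.pd_one k).clm_comp (Complex.conjCLE : ℂ →L[ℝ] ℂ)
    have h2 : USmooth K (fun _ => 1) (fun a x => ((invCut ε (gradSq (Ψ a) x) : ℝ) : ℂ)) :=
      (hΨ.gradSq.comp (contDiff_invCut hε)).clm_comp Complex.ofRealCLM
    exact (h1.mul h2 fun _ => zero_le_one).mono subset_rfl (fun _ => zero_le_one) hμ
  set B : Fin n → α → Rn n → ℂ := fun k a x => -Complex.I * (b a x * M k a x) with hB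
  have hBs : ∀ k, USmooth K μ (B k) := fun k =>
    (hb.mul (hMs k) fun a => (hμ0 a).le).const_mul _
  have hBt : ∀ k a, tsupport (B k a) ⊆ tsupport (b a) := fun k a =>
    closure_mono fun x hx => by
      contrapose! hx
      simp [hB, Function.notMem_support.mp hx]
  -- The derivatives falling on B k are compensated here. Dividing by μ keeps B' in the class, and
  -- the factor μ / ρ in the identity restores the size.
  set B' : α → Rn n → ℂ := fun a x => -∑ k, ((μ a)⁻¹ : ℝ) • pd k (B k a) x with hB'
  have hBs' : USmooth K μ B' :=
    (USmooth.sum _ fun k _ => (hBs k).pd hμ0 k).neg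
  refine ⟨B, B', hBs, hBs', hBt, fun a => ?_, fun a x => ?_⟩
  · refine closure_minimal (fun x hx => ?_) (isClosed_tsupport _)
    contrapose! hx
    have : ∀ k, pd k (B k a) x = 0 := fun k =>
      image_eq_zero_of_notMem_tsupport fun h => hx (hBt k a (tsupport_pd_subset _ _ h))
    simp [hB', this]
  · set e := Complex.exp (Complex.I * (ρ a : ℂ) * Ψ a x) with he
    have hpd : ∀ k, pd k (fun y => Complex.exp (Complex.I * (ρ a : ℂ) * Ψ a y) * B k a y) x =
        Complex.I * (ρ a : ℂ) * pd k (Ψ a) x * e * B k a x + e * pd k (B k a) x := fun k => by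
      rw [pd_mul ((contDiff_cexp_phase (hΨ.smooth a) _).differentiable (by simp) x)
        (((hBs k).smooth a).differentiable (by simp) x), pd_cexp (hΨ.smooth a)]
    have hkey : b a x * ∑ k, pd k (Ψ a) x * M k a x = b a x := by
      by_cases hx : x ∈ tsupport (b a)
      · have hg := hgrad a x hx
        have : ∑ k, pd k (Ψ a) x * M k a x = 1 := by
          simp only [hM]
          rw [invCut_of_le hε hg]
          simp only [← mul_assoc, Complex.mul_conj, ← Finset.sum_mul]
          have : (∑ k, ((Complex.normSq (pd k (Ψ a) x) : ℝ) : ℂ)) = ((gradSq (Ψ a) x : ℝ) : ℂ) := by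
            rw [gradSq]
            push_cast
            exact Finset.sum_congr rfl fun k _ => by rw [← Complex.sq_norm]; push_cast; rfl
          rw [this, ← Complex.ofReal_mul, mul_inv_cancel₀ (by linarith)]
          simp
        rw [this, mul_one]
      · simp [image_eq_zero_of_notMem_tsupport hx]
    have hρ' : (ρ a : ℂ) ≠ 0 := by exact_mod_cast (hρ a).ne'
    have hμ' : (μ a : ℂ) ≠ 0 := by exact_mod_cast (hμ0 a).ne'
    simp only [hpd, Finset.sum_add_distrib, ← Finset.mul_sum]
    have h1 : ∑ k, Complex.I * (ρ a : ℂ) * pd k (Ψ a) x * e * B k a x =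
        (ρ a : ℂ) * e * (b a x * ∑ k, pd k (Ψ a) x * M k a x) := by
      rw [Finset.mul_sum, Finset.mul_sum]
      refine Finset.sum_congr rfl fun k _ => ?_
      simp only [hB]
      linear_combination (-(ρ a : ℂ) * pd k (Ψ a) x * e * b a x * M k a x) * Complex.I_sq
    rw [h1, hkey]
    simp only [hB', Complex.real_smul, ← Finset.mul_sum]
    push_cast
    field_simp
    ring

theorem isTest_osc {K : Set (Rn n)} (hK : IsCompact K) {ρ : ℝ} {Ψ b : Rn n → ℂ}
    (hΨ : ContDiff ℝ ∞ Ψ) (hb : ContDiff ℝ ∞ b) (hs : tsupport b ⊆ K) :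
    IsTest (fun y => Complex.exp (Complex.I * (ρ : ℂ) * Ψ y) * b y) :=
  ⟨(contDiff_cexp_phase hΨ ρ).mul hb,
    HasCompactSupport.mul_left (hK.of_isClosed_subset (isClosed_tsupport _) hs)⟩

/-- Non-stationary phase. -/
theorem nonstationary_phase {K : Set (Rn n)} (hK : IsCompact K) {ρ μ : α → ℝ}
    {Ψ : α → Rn n → ℂ} {ε : ℝ} (hε : 0 < ε) (hρ : ∀ a, 0 < ρ a) (hμ : ∀ a, 1 ≤ μ a)
    (hΨ : USmooth K (fun _ => 1) Ψ) (him : ∀ a, ∀ x ∈ K, 0 ≤ (Ψ a x).im) (N : ℕ) :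
    ∀ b : α → Rn n → ℂ, USmooth K μ b → (∀ a, tsupport (b a) ⊆ K) →
    (∀ a, ∀ x ∈ tsupport (b a), ε ≤ gradSq (Ψ a) x) →
    ∃ C : ℝ, 0 ≤ C ∧ ∀ a, ‖∫ x, Complex.exp (Complex.I * (ρ a : ℂ) * Ψ a x) * b a x‖ ≤
      C * (μ a / ρ a) ^ N := by
  induction N with
  | zero =>
    intro b hb hs _
    obtain ⟨C, hC, h⟩ := hb.norm_le
    refine ⟨C * volume.real K, by positivity, fun a => ?_⟩
    rw [pow_zero, mul_one]
    have h0 : ∀ x, x ∉ K → b a x = 0 := fun x hx =>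
      image_eq_zero_of_notMem_tsupport fun h => hx (hs a h)
    refine norm_integral_le_of_support hK (fun x => ?_) fun x hx => by simp [h0 x hx]
    by_cases hx : x ∈ K
    · rw [norm_mul]
      exact (mul_le_of_le_one_left (norm_nonneg _)
        (norm_cexp_phase_le (him a x hx) (hρ a).le)).trans (h a x hx)
    · simpa [h0 x hx] using hC
  | succ N ih =>
    intro b hb hs hg
    obtain ⟨B, B', hB, hB', hBt, hBt', hdec⟩ :=
      nonstationary_decomposition hε hρ hμ hΨ hb hg
    obtain ⟨C, hC, h⟩ := ih B' hB' (fun a => (hBt' a).trans (hs a))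
      fun a x hx => hg a x (hBt' a hx)
    refine ⟨C, hC, fun a => ?_⟩
    have ht : ∀ k, IsTest (fun y => Complex.exp (Complex.I * (ρ a : ℂ) * Ψ a y) * B k a y) :=
      fun k => isTest_osc hK (hΨ.smooth a) ((hB k).smooth a) ((hBt k a).trans (hs a))
    have ht' : IsTest (fun y => Complex.exp (Complex.I * (ρ a : ℂ) * Ψ a y) * B' a y) :=
      isTest_osc hK (hΨ.smooth a) (hB'.smooth a) ((hBt' a).trans (hs a))
    have hint : ∀ k, Integrable
        (pd k (fun y => Complex.exp (Complex.I * (ρ a : ℂ) * Ψ a y) * B k a y)) :=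
      fun k => ((ht k).pd k).integrable
    simp_rw [hdec a]
    rw [integral_add ((integrable_finsetSum _ fun k _ => hint k).const_mul _)
      (ht'.integrable.const_mul _), integral_const_mul, integral_const_mul,
      integral_finsetSum _ fun k _ => hint k]
    -- The divergence integrates to zero. The remaining amplitude B' is of the same kind as b, and a
    -- factor μ / ρ has been gained.
    simp only [integral_pd_eq_zero (ht _), Finset.sum_const_zero, mul_zero, zero_add]
    have hq : 0 ≤ μ a / ρ a := div_nonneg (zero_le_one.trans (hμ a)) (hρ a).le
    rw [norm_mul, Complex.norm_real, Real.norm_of_nonneg hq, pow_succ]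
    calc _ ≤ μ a / ρ a * (C * (μ a / ρ a) ^ N) := mul_le_mul_of_nonneg_left (h a) hq
      _ = _ := by ring

end NonStationaryPhase

end OscSum
end

open MeasureTheory Filter Topology Set
open scoped ContDiff ENNReal

noncomputable section

namespace OscSum

/-! ### Fourier transforms of oscillatory functions -/

section HatEstimates

variable {α : Type*} {n : ℕ}

theorem reGrad_apply {w : Rn n → ℂ} (hw : ContDiff ℝ ∞ w) (x : Rn n) (k : Fin n) :
    reGrad w x k = (pd k w x).re := by
  have h : HasFDerivAt (fun y => (w y).re) (Complex.reCLM.comp (fderiv ℝ w x)) x :=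
    Complex.reCLM.hasFDerivAt.comp x (hw.differentiable (by simp) x).hasFDerivAt
  rw [← inner_stdVec, reGrad, gradient, InnerProductSpace.toDual_symm_apply, h.fderiv]
  rfl

/-- Real parts are dominated by absolute values, so a lower bound for d Re Ψ alone excludes
stationary points of the complex phase. -/
theorem norm_sq_le_gradSq {Ψ : Rn n → ℂ} {x v : Rn n} (h : ∀ k, v k = (pd k Ψ x).re) :
    ‖v‖ ^ 2 ≤ gradSq Ψ x := by
  rw [EuclideanSpace.norm_sq_eq, gradSq]
  refine Finset.sum_le_sum fun k _ => ?_
  rw [h k, Real.norm_eq_abs]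
  exact pow_le_pow_left₀ (abs_nonneg _) (Complex.abs_re_le_norm _) 2

theorem continuous_reGrad {w : Rn n → ℂ} (hw : ContDiff ℝ ∞ w) : Continuous (reGrad w) := by
  have : reGrad w = fun x => WithLp.toLp 2 fun k => (pd k w x).re := by
    ext x k
    exact reGrad_apply hw x k
  rw [this]
  refine (PiLp.continuous_toLp 2 _).comp (continuous_pi fun k => ?_)
  exact Complex.continuous_re.comp (contDiff_pd hw k).continuous

/-- The gain per integration by parts is at most ρ^{δ-1} with δ - 1 < 0, so M ≥ N / (1 - δ) steps
produce ρ^{-N}. This is where δ < 1 enters. -/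
theorem pow_rpow_div_le {δ : ℝ} (hδ1 : δ < 1) (N : ℕ) :
    ∃ M : ℕ, ∀ ρ lam : ℝ, 1 ≤ lam → lam ≤ ρ → 0 ≤ δ → (lam ^ δ / ρ) ^ M ≤ (ρ ^ N)⁻¹ := by
  obtain ⟨M, hM⟩ := exists_nat_ge ((N : ℝ) / (1 - δ))
  refine ⟨M, fun ρ lam h1 h2 h0 => ?_⟩
  have hρ : 1 ≤ ρ := h1.trans h2
  rw [div_le_iff₀ (by linarith)] at hM
  have h3 : lam ^ δ / ρ ≤ ρ ^ (δ - 1) := by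
    rw [Real.rpow_sub_one (by linarith)]
    gcongr
  calc (lam ^ δ / ρ) ^ M ≤ (ρ ^ (δ - 1)) ^ M := by gcongr
    _ = ρ ^ ((δ - 1) * M) := by rw [← Real.rpow_natCast, ← Real.rpow_mul (by linarith)]
    _ ≤ ρ ^ (-(N : ℝ)) := Real.rpow_le_rpow_of_exponent_le hρ (by nlinarith)
    _ = _ := by rw [Real.rpow_neg (by linarith), Real.rpow_natCast]

theorem USmooth.inner_const {K : Set (Rn n)} (hK : Bornology.IsBounded K) {v : α → Rn n} {B : ℝ}
    (hv : ∀ a, ‖v a‖ ≤ B) :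
    USmooth K (fun _ => 1) (fun a (y : Rn n) => ((inner ℝ y (v a) : ℝ) : ℂ)) := by
  have e : (fun a (y : Rn n) => ((inner ℝ y (v a) : ℝ) : ℂ)) =
      fun a y => ∑ k, (v a k : ℂ) * (y k : ℂ) := by
    ext a y
    simp [PiLp.inner_apply]
  rw [e]
  refine USmooth.sum _ fun k _ => ?_
  refine (USmooth.const (B := B) fun a => ?_).mul (USmooth.fixed (f := fun y : Rn n => (y k : ℂ))
    (Complex.ofRealCLM.contDiff.comp (contDiff_euclidean.mp contDiff_id k)) hK)
    fun _ => zero_le_one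
  rw [Complex.norm_real]
  exact (PiLp.norm_apply_le _ k).trans (hv a)

/-- The function `e^{iλw} b`. -/
def osc (lam : ℝ) (w b : Rn n → ℂ) (x : Rn n) : ℂ :=
  Complex.exp (Complex.I * (lam : ℂ) * w x) * b x

variable {K : Set (Rn n)} {δ : ℝ} {lam : α → ℝ} {W b : α → Rn n → ℂ}

/-- Rapid decay of the Fourier transform of an oscillatory function away from the
frequencies of its phase. -/
theorem norm_hat_osc_le (hK : IsCompact K) (hδ0 : 0 ≤ δ) (hδ1 : δ < 1) (hlam : ∀ a, 1 ≤ lam a)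
    (hW : USmooth K (fun _ => 1) W) (him : ∀ a, ∀ x ∈ K, 0 ≤ (W a x).im)
    (hb : USmooth K (fun a => lam a ^ δ) b) (hs : ∀ a, tsupport (b a) ⊆ K)
    (ξ : α → Rn n) {ε : ℝ} (hε : 0 < ε)
    (hg : ∀ a, ∀ x ∈ tsupport (b a), ε * (lam a + ‖ξ a‖) ≤ ‖lam a • reGrad (W a) x - ξ a‖)
    (N : ℕ) :
    ∃ C : ℝ, 0 ≤ C ∧ ∀ a, ‖hat (osc (lam a) (W a) (b a)) (ξ a)‖ ≤
      C * ((lam a + ‖ξ a‖) ^ N)⁻¹ := by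
  set ρ : α → ℝ := fun a => lam a + ‖ξ a‖ with hρdef
  have hlρ : ∀ a, lam a ≤ ρ a := fun a => le_add_of_nonneg_right (norm_nonneg _)
  have hρ1 : ∀ a, 1 ≤ ρ a := fun a => (hlam a).trans (hlρ a)
  have hρ : ∀ a, 0 < ρ a := fun a => one_pos.trans_le (hρ1 a)
  -- Dividing λW - ⟨y, ξ⟩ by ρ = λ + |ξ| makes both coefficients bounded by 1. The phases are then
  -- uniformly smooth for all ξ, with ρ as the large parameter.
  set Ψ : α → Rn n → ℂ := fun a y =>
    ((lam a / ρ a : ℝ) : ℂ) * W a y + -((inner ℝ y ((ρ a)⁻¹ • ξ a) : ℝ) : ℂ) with hΨdef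
  have hΨ : USmooth K (fun _ => 1) Ψ := by
    refine ((USmooth.const (B := 1) fun a => ?_).mul hW fun _ => zero_le_one).add
      (USmooth.inner_const (B := 1) hK.isBounded fun a => ?_).neg
    · rw [Complex.norm_real, Real.norm_of_nonneg (div_nonneg (by linarith [hlam a]) (hρ a).le)]
      exact (div_le_one (hρ a)).mpr (hlρ a)
    · rw [norm_smul, norm_inv, Real.norm_of_nonneg (hρ a).le, inv_mul_le_iff₀ (hρ a)]
      simp only [hρdef]
      linarith [hlam a]
  have himΨ : ∀ a, ∀ x ∈ K, 0 ≤ (Ψ a x).im := fun a x hx => by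
    simp only [hΨdef, Complex.add_im, Complex.neg_im, Complex.ofReal_im, neg_zero, add_zero,
      Complex.im_ofReal_mul]
    exact mul_nonneg (div_nonneg (by linarith [hlam a]) (hρ a).le) (him a x hx)
  have hpd : ∀ a x k, (pd k (Ψ a) x).re = ((ρ a)⁻¹ • (lam a • reGrad (W a) x - ξ a)) k := by
    intro a x k
    have h1 := ((hW.smooth a).differentiable (by simp) x).hasFDerivAt.const_mul
      ((lam a / ρ a : ℝ) : ℂ)
    have h2 : HasFDerivAt (fun y : Rn n => ((inner ℝ y ((ρ a)⁻¹ • ξ a) : ℝ) : ℂ))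
        (Complex.ofRealCLM.comp ((innerSL ℝ).flip ((ρ a)⁻¹ • ξ a))) x :=
      (Complex.ofRealCLM.comp ((innerSL ℝ).flip ((ρ a)⁻¹ • ξ a))).hasFDerivAt
    have h3 := (h1.add h2.neg).fderiv
    have h4 : pd k (Ψ a) x = ((lam a / ρ a : ℝ) : ℂ) * pd k (W a) x +
        -((((ρ a)⁻¹ • ξ a) k : ℝ) : ℂ) := by
      rw [pd]
      refine (DFunLike.congr_fun h3 (stdVec k)).trans ?_
      simp [pd, stdVec, innerSL_apply_apply ℝ, EuclideanSpace.inner_single_right]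
    rw [h4]
    simp [reGrad_apply (hW.smooth a)]
    ring
  obtain ⟨M, hM⟩ := pow_rpow_div_le hδ1 N
  obtain ⟨C, hC, h⟩ := nonstationary_phase hK (μ := fun a => lam a ^ δ) (ε := ε ^ 2)
    (by positivity) hρ (fun a => Real.one_le_rpow (hlam a) hδ0) hΨ himΨ M b hb hs
    fun a x hx => by
      refine le_trans ?_ (norm_sq_le_gradSq fun k => (hpd a x k).symm)
      refine pow_le_pow_left₀ hε.le ?_ 2
      rw [norm_smul, norm_inv, Real.norm_of_nonneg (hρ a).le, le_inv_mul_iff₀ (hρ a), mul_comm]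
      exact hg a x hx
  refine ⟨C, hC, fun a => ?_⟩
  refine le_trans (le_of_eq ?_) ((h a).trans
    (mul_le_mul_of_nonneg_left (hM _ _ (hlam a) (hlρ a) hδ0) hC))
  rw [hat]
  congr 2
  ext x
  rw [osc, ← mul_assoc, ← Complex.exp_add]
  congr 2
  simp only [hΨdef, inner_smul_right]
  have : (ρ a : ℂ) ≠ 0 := by exact_mod_cast (hρ a).ne'
  push_cast
  field_simp
  ring

theorem norm_osc_le (hlam : ∀ a, 1 ≤ lam a) (him : ∀ a, ∀ x ∈ K, 0 ≤ (W a x).im)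
    (hs : ∀ a, tsupport (b a) ⊆ K) (a : α) (x : Rn n) :
    ‖osc (lam a) (W a) (b a) x‖ ≤ ‖b a x‖ := by
  by_cases hx : x ∈ tsupport (b a)
  · rw [osc, norm_mul]
    exact mul_le_of_le_one_left (norm_nonneg _)
      (norm_cexp_phase_le (him a x (hs a hx)) (zero_le_one.trans (hlam a)))
  · simp [osc, image_eq_zero_of_notMem_tsupport hx]

theorem norm_hat_osc_le_const (hK : IsCompact K) (hlam : ∀ a, 1 ≤ lam a)
    (him : ∀ a, ∀ x ∈ K, 0 ≤ (W a x).im)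
    {μ : α → ℝ} (hb : USmooth K μ b) (hs : ∀ a, tsupport (b a) ⊆ K) :
    ∃ C : ℝ, 0 ≤ C ∧ ∀ a ξ, ‖hat (osc (lam a) (W a) (b a)) ξ‖ ≤ C := by
  obtain ⟨C, hC, h⟩ := hb.norm_le
  refine ⟨C * volume.real K, by positivity, fun a ξ => ?_⟩
  have h0 : ∀ x, x ∉ K → b a x = 0 := fun x hx =>
    image_eq_zero_of_notMem_tsupport fun h => hx (hs a h)
  refine norm_hat_le hK (fun x => (norm_osc_le hlam him hs a x).trans ?_)
    (fun x hx => by simp [osc, h0 x hx]) ξ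
  by_cases hx : x ∈ K
  · exact h a x hx
  · simpa [h0 x hx] using hC

/-- The Fourier transform of an oscillatory function without stationary points is rapidly
decreasing in `λ`, up to powers of the frequency. -/
theorem norm_hat_osc_le_poly (hK : IsCompact K) (hδ0 : 0 ≤ δ) (hδ1 : δ < 1)
    (hlam : ∀ a, 1 ≤ lam a)
    (hW : USmooth K (fun _ => 1) W) (him : ∀ a, ∀ x ∈ K, 0 ≤ (W a x).im)
    (hb : USmooth K (fun a => lam a ^ δ) b) (hs : ∀ a, tsupport (b a) ⊆ K)
    {c : ℝ} (hc : 0 < c) (hg : ∀ a, ∀ x ∈ K, c ≤ ‖reGrad (W a) x‖) (N : ℕ) :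
    ∃ C : ℝ, 0 ≤ C ∧ ∀ a ξ, ‖hat (osc (lam a) (W a) (b a)) ξ‖ ≤
      C * (lam a ^ N)⁻¹ * (1 + ‖ξ‖) ^ N := by
  obtain ⟨C₁, hC₁, h₁⟩ := norm_hat_osc_le_const hK hlam him hb hs
  -- For these frequencies |λ∇ Re W - ξ| ≥ cλ / 2, while λ + |ξ| ≤ (1 + c / 2)λ; hence the value of
  -- ε. Including ξ in the index makes the constant independent of it.
  set β := {p : α × Rn n // ‖p.2‖ ≤ c / 2 * lam p.1}
  obtain ⟨C₂, hC₂, h₂⟩ := norm_hat_osc_le (α := β) hK hδ0 hδ1 (fun p => hlam p.1.1)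
    (hW.reindex fun p : β => p.1.1) (fun p => him p.1.1) (hb.reindex fun p : β => p.1.1)
    (fun p => hs p.1.1) (fun p => p.1.2) (ε := c / 2 / (1 + c / 2)) (by positivity)
    (fun p x hx => by
      have hl := hlam p.1.1
      have h1 : ‖lam p.1.1 • reGrad (W p.1.1) x‖ = lam p.1.1 * ‖reGrad (W p.1.1) x‖ := by
        rw [norm_smul, Real.norm_of_nonneg (by linarith)]
      have h2 := norm_sub_norm_le (lam p.1.1 • reGrad (W p.1.1) x) p.1.2
      have h3 := hg p.1.1 x (hs p.1.1 hx)
      have h4 := p.2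
      have h5 : c * lam p.1.1 ≤ lam p.1.1 * ‖reGrad (W p.1.1) x‖ := by nlinarith
      refine le_trans (b := c / 2 * lam p.1.1) ?_ (by linarith)
      rw [div_mul_eq_mul_div, div_le_iff₀ (by positivity)]
      nlinarith) N
  refine ⟨C₂ + C₁ * (2 / c) ^ N, by positivity, fun a ξ => ?_⟩
  have hl := hlam a
  have hl0 : 0 < lam a := by linarith
  have hn := norm_nonneg ξ
  by_cases hξ : ‖ξ‖ ≤ c / 2 * lam a
  · refine (h₂ ⟨(a, ξ), hξ⟩).trans ?_
    calc C₂ * ((lam a + ‖ξ‖) ^ N)⁻¹ ≤ C₂ * (lam a ^ N)⁻¹ * 1 := by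
          rw [mul_one]; gcongr; linarith
      _ ≤ (C₂ + C₁ * (2 / c) ^ N) * (lam a ^ N)⁻¹ * (1 + ‖ξ‖) ^ N := by
          gcongr
          · exact le_add_of_nonneg_right (by positivity)
          · exact one_le_pow₀ (by linarith)
  · push Not at hξ
    refine (h₁ a ξ).trans ?_
    -- For |ξ| > cλ / 2 nothing has to be gained by oscillation: powers of the frequency already pay
    -- for powers of λ.
    have h3 : 1 ≤ 2 / c * (lam a)⁻¹ * (1 + ‖ξ‖) := by
      rw [← div_eq_mul_inv, div_div, div_mul_eq_mul_div, le_div_iff₀ (by positivity)]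
      linarith
    calc C₁ = C₁ * 1 := (mul_one _).symm
      _ ≤ C₁ * (2 / c * (lam a)⁻¹ * (1 + ‖ξ‖)) ^ N := by gcongr; exact one_le_pow₀ h3
      _ = C₁ * (2 / c) ^ N * (lam a ^ N)⁻¹ * (1 + ‖ξ‖) ^ N := by
          rw [mul_pow, mul_pow, inv_pow]; ring
      _ ≤ _ := by
          gcongr
          exact le_add_of_nonneg_left hC₂

end HatEstimates

end OscSum
end

open MeasureTheory Filter Topology Set
open scoped ContDiff ENNReal

noncomputable section

namespace OscSum

/-! ### Upper bounds for Sobolev norms of integer order -/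

section SobolevUpper

variable {α : Type*} {n : ℕ}

/-- The weighted `L²` norm of the Fourier transform. -/
def wNorm (s : ℝ) (u : Rn n → ℂ) : ℝ≥0∞ :=
  eLpNorm (fun ξ : Rn n => (((1 + ‖ξ‖ ^ 2) ^ (s / 2) : ℝ) : ℂ) * hat u ξ) 2 volume

theorem continuous_weight (s : ℝ) : Continuous fun ξ : Rn n => (1 + ‖ξ‖ ^ 2) ^ (s / 2) :=
  (by fun_prop : Continuous fun ξ : Rn n => 1 + ‖ξ‖ ^ 2).rpow_const
    fun ξ => Or.inl (by positivity)

theorem continuous_hat {u : Rn n → ℂ} (hu : IsTest u) : Continuous (hat u) := by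
  rw [← hu.coe_toSchwartz, ← coe_hatS]
  exact SchwartzMap.continuous _

/-- Minkowski's inequality in L². It turns pointwise inequalities between transforms into
inequalities between norms, possibly of different orders. -/
theorem wNorm_le_sum {κ : Type*} [Fintype κ] {s : ℝ} {u : Rn n → ℂ} {t c : κ → ℝ}
    {v : κ → Rn n → ℂ} (hv : ∀ i, IsTest (v i)) (hc : ∀ i, 0 ≤ c i)
    (h : ∀ ξ, (1 + ‖ξ‖ ^ 2) ^ (s / 2) * ‖hat u ξ‖ ≤
      ∑ i, c i * ((1 + ‖ξ‖ ^ 2) ^ (t i / 2) * ‖hat (v i) ξ‖)) :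
    wNorm s u ≤ ∑ i, ENNReal.ofReal (c i) * wNorm (t i) (v i) := by
  have h1 : wNorm s u ≤ eLpNorm (∑ i, fun ξ => c i * ((1 + ‖ξ‖ ^ 2) ^ (t i / 2) *
      ‖hat (v i) ξ‖)) 2 volume := by
    refine eLpNorm_mono_real fun ξ => ?_
    rw [norm_mul, Complex.norm_real, Real.norm_of_nonneg (by positivity), Finset.sum_apply]
    exact h ξ
  refine h1.trans ((eLpNorm_sum_le (fun i _ => ?_) one_le_two).trans
    (Finset.sum_le_sum fun i _ => le_of_eq ?_))
  · exact (continuous_const.mul ((continuous_weight _).mul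
      (continuous_hat (hv i)).norm)).aestronglyMeasurable
  · have e : (fun ξ => c i * ((1 + ‖ξ‖ ^ 2) ^ (t i / 2) * ‖hat (v i) ξ‖)) =
        c i • fun ξ => ((1 + ‖ξ‖ ^ 2) ^ (t i / 2) * ‖hat (v i) ξ‖) := rfl
    rw [e, eLpNorm_const_smul, Real.enorm_of_nonneg (hc i), wNorm]
    congr 1
    refine eLpNorm_congr_norm_ae (ae_of_all _ fun ξ => ?_)
    simp

theorem wNorm_mono {s t : ℝ} (hst : s ≤ t) (u : Rn n → ℂ) : wNorm s u ≤ wNorm t u := by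
  refine eLpNorm_mono fun ξ => ?_
  rw [norm_mul, norm_mul, Complex.norm_real, Complex.norm_real,
    Real.norm_of_nonneg (by positivity), Real.norm_of_nonneg (by positivity)]
  gcongr
  nlinarith [sq_nonneg ‖ξ‖]

theorem sqrt_weight_le (ξ : Rn n) : (1 + ‖ξ‖ ^ 2) ^ (1 / 2 : ℝ) ≤ 1 + ∑ k, |ξ k| := by
  have h0 : ∀ s : Finset (Fin n), 0 ≤ ∑ k ∈ s, |ξ k| :=
    fun s => Finset.sum_nonneg fun k _ => abs_nonneg _
  have h : ∀ s : Finset (Fin n), ∑ k ∈ s, |ξ k| ^ 2 ≤ (∑ k ∈ s, |ξ k|) ^ 2 := fun s =>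
    Finset.sum_sq_le_sq_sum_of_nonneg fun k _ => abs_nonneg _
  rw [← Real.sqrt_eq_rpow, Real.sqrt_le_left (by linarith [h0 Finset.univ]),
    EuclideanSpace.norm_sq_eq]
  have := h Finset.univ
  have := h0 Finset.univ
  simp only [Real.norm_eq_abs]
  nlinarith

theorem abs_coord_le (ξ : Rn n) (k : Fin n) : |ξ k| ≤ (1 + ‖ξ‖ ^ 2) ^ (1 / 2 : ℝ) := by
  rw [← Real.sqrt_eq_rpow]
  refine Real.le_sqrt_of_sq_le ?_
  have := PiLp.norm_apply_le ξ k
  rw [Real.norm_eq_abs] at this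
  have := pow_le_pow_left₀ (abs_nonneg _) this 2
  linarith

theorem norm_hat_pd {u : Rn n → ℂ} (hu : IsTest u) (k : Fin n) (ξ : Rn n) :
    ‖hat (pd k u) ξ‖ = |ξ k| * ‖hat u ξ‖ := by
  have := hat_pd hu.toSchwartz k ξ
  rw [hu.coe_toSchwartz] at this
  rw [this]
  simp

/-- The extra weight (1 + |ξ|²)^{1/2} is at most 1 + ∑ |ξ_k|, and multiplication by ξ_k corresponds
to a derivative. -/
theorem wNorm_succ_le {s : ℝ} {u : Rn n → ℂ} (hu : IsTest u) :
    wNorm (s + 1) u ≤ wNorm s u + ∑ k, wNorm s (pd k u) := by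
  have h := wNorm_le_sum (κ := Option (Fin n)) (s := s + 1) (u := u) (t := fun _ => s)
    (c := fun _ => 1) (v := fun i => i.elim u fun k => pd k u)
    (by rintro (_ | k); exacts [hu, hu.pd k]) (fun _ => zero_le_one) fun ξ => ?_
  · simpa [Fintype.sum_option] using h
  · simp only [one_mul, Fintype.sum_option, Option.elim_none, Option.elim_some, norm_hat_pd hu]
    rw [add_div, Real.rpow_add (by positivity)]
    have h2 := sqrt_weight_le ξ
    calc _ ≤ (1 + ‖ξ‖ ^ 2) ^ (s / 2) * (1 + ∑ k, |ξ k|) * ‖hat u ξ‖ := by gcongr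
      _ = _ := by
        rw [mul_add, mul_one, add_mul, Finset.mul_sum, Finset.sum_mul]
        congr 1
        exact Finset.sum_congr rfl fun k _ => by ring

/-- Plancherel, together with the sup norm times the square root of the measure of the support. -/
theorem wNorm_zero_le {u : Rn n → ℂ} (hu : IsTest u) {T : Set (Rn n)} (hT : MeasurableSet T)
    (hs : ∀ x, x ∉ T → u x = 0) {C : ℝ} (hC : 0 ≤ C) (h : ∀ x, ‖u x‖ ≤ C) {V : ℝ} (hV0 : 0 ≤ V)
    (hV : volume T ≤ ENNReal.ofReal (V ^ 2)) :
    wNorm 0 u ≤ ENNReal.ofReal ((2 * Real.pi) ^ ((n : ℝ) / 2) * C * V) := by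
  have h1 : wNorm 0 u = eLpNorm (hat u) 2 volume := by simp [wNorm]
  have h2 : eLpNorm u 2 volume ≤ ENNReal.ofReal C * ENNReal.ofReal V := by
    calc eLpNorm u 2 volume ≤ eLpNorm (T.indicator fun _ => C) 2 volume := by
          refine eLpNorm_mono_real fun x => ?_
          by_cases hx : x ∈ T
          · simpa [hx] using h x
          · simp [hx, hs x hx]
      _ = ENNReal.ofReal C * volume T ^ (1 / 2 : ℝ) := by
          rw [eLpNorm_indicator_const hT (by simp) (by simp), Real.enorm_of_nonneg hC]
          simp
      _ ≤ _ := by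
          gcongr
          refine (ENNReal.rpow_le_rpow hV (by norm_num)).trans (le_of_eq ?_)
          rw [ENNReal.ofReal_rpow_of_nonneg (by positivity) (by norm_num), ← Real.sqrt_eq_rpow,
            Real.sqrt_sq hV0]
  have h3 := plancherel hu.toSchwartz
  rw [hu.coe_toSchwartz] at h3
  rw [h1, h3, mul_assoc, ENNReal.ofReal_mul (by positivity), ENNReal.ofReal_mul hC]
  gcongr

/-- A bounded family of oscillatory functions with a common phase. -/
structure OscData (K : Set (Rn n)) (δ : ℝ) (lam : α → ℝ) (W : α → Rn n → ℂ) : Prop where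
  compact : IsCompact K
  δ_nonneg : 0 ≤ δ
  δ_lt : δ < 1
  one_le : ∀ a, 1 ≤ lam a
  phase : USmooth K (fun _ => 1) W
  im_nonneg : ∀ a, ∀ x ∈ K, 0 ≤ (W a x).im

namespace OscData

variable {K : Set (Rn n)} {δ : ℝ} {lam : α → ℝ} {W : α → Rn n → ℂ}

theorem isTest (hD : OscData K δ lam W) {μ : α → ℝ} {b : α → Rn n → ℂ} (hb : USmooth K μ b)
    (hs : ∀ a, tsupport (b a) ⊆ K) (a : α) : IsTest (osc (lam a) (W a) (b a)) :=
  isTest_osc hD.compact (hD.phase.smooth a) (hb.smooth a) (hs a)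

/-- A derivative of e^{iλW} b is λ e^{iλW} times i ∂W b + λ^{-1} ∂b. The second term is (λ^δ /
λ)(λ^{-δ} ∂b), which stays in the class since λ^δ ≤ λ. -/
theorem pd_osc (hD : OscData K δ lam W) {b : α → Rn n → ℂ}
    (hb : USmooth K (fun a => lam a ^ δ) b) (k : Fin n) :
    ∃ b' : α → Rn n → ℂ, USmooth K (fun a => lam a ^ δ) b' ∧
      (∀ a, tsupport (b' a) ⊆ tsupport (b a)) ∧
      ∀ a, pd k (osc (lam a) (W a) (b a)) = fun x => (lam a : ℂ) * osc (lam a) (W a) (b' a) x := by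
  have hl0 : ∀ a, 0 < lam a := fun a => one_pos.trans_le (hD.one_le a)
  have hμ : ∀ a, 0 < lam a ^ δ := fun a => Real.rpow_pos_of_pos (hl0 a) _
  have hμ1 : ∀ a, 1 ≤ lam a ^ δ := fun a => Real.one_le_rpow (hD.one_le a) hD.δ_nonneg
  refine ⟨fun a x => Complex.I * (pd k (W a) x * b a x) + ((lam a ^ δ / lam a : ℝ) : ℂ) *
    ((((lam a ^ δ)⁻¹ : ℝ)) • pd k (b a) x), ?_, fun a => ?_, fun a => ?_⟩
  · refine USmooth.add (USmooth.const_mul (USmooth.mul ((hD.phase.pd_one k).mono subset_rfl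
      (fun _ => zero_le_one) hμ1) hb fun a => (hμ a).le) _) (USmooth.mul
      ((USmooth.const (B := 1) fun a => ?_).mono subset_rfl (fun _ => zero_le_one) hμ1)
      (hb.pd hμ k) fun a => (hμ a).le)
    rw [Complex.norm_real, Real.norm_of_nonneg (div_nonneg (hμ a).le (hl0 a).le),
      div_le_one (hl0 a)]
    exact Real.rpow_le_self_of_one_le (hD.one_le a) hD.δ_lt.le
  · refine closure_minimal (fun x hx => ?_) (isClosed_tsupport _)
    contrapose! hx
    have h1 : pd k (b a) x = 0 :=
      image_eq_zero_of_notMem_tsupport fun h => hx (tsupport_pd_subset _ _ h)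
    simp [h1, image_eq_zero_of_notMem_tsupport hx]
  · ext x
    have h1 := pd_mul ((contDiff_cexp_phase (hD.phase.smooth a) (lam a)).differentiable
      (by simp) x) ((hb.smooth a).differentiable (by simp) x) k
    have h2 : (lam a : ℂ) ≠ 0 := by exact_mod_cast (hl0 a).ne'
    have h3 : ((lam a ^ δ : ℝ) : ℂ) ≠ 0 := by exact_mod_cast (hμ a).ne'
    rw [pd_cexp (hD.phase.smooth a)] at h1
    refine h1.trans ?_
    simp only [osc, Complex.real_smul, Complex.ofReal_div, Complex.ofReal_inv]
    field_simp

variable {T : α → Set (Rn n)} {A : α → ℝ}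

/-- The Sobolev estimates of order `s` for all oscillatory functions with the given phase. -/
def SobolevBound (K : Set (Rn n)) (δ : ℝ) (lam : α → ℝ) (W : α → Rn n → ℂ)
    (T : α → Set (Rn n)) (A : α → ℝ) (s : ℝ) : Prop :=
  ∀ b : α → Rn n → ℂ, USmooth K (fun a => lam a ^ δ) b → (∀ a, tsupport (b a) ⊆ T a) →
    ∃ C : ℝ, 0 ≤ C ∧ ∀ a, wNorm s (osc (lam a) (W a) (b a)) ≤
      ENNReal.ofReal (C * A a * lam a ^ s)

theorem sobolevBound_zero (hD : OscData K δ lam W) (hT : ∀ a, T a ⊆ K)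
    (hTm : ∀ a, MeasurableSet (T a)) (hA : ∀ a, 0 ≤ A a)
    (hV : ∀ a, volume (T a) ≤ ENNReal.ofReal (A a ^ 2)) :
    SobolevBound K δ lam W T A 0 := by
  intro b hb hs
  have hsK : ∀ a, tsupport (b a) ⊆ K := fun a => (hs a).trans (hT a)
  obtain ⟨C, hC, h⟩ := hb.norm_le
  refine ⟨(2 * Real.pi) ^ ((n : ℝ) / 2) * C, by positivity, fun a => ?_⟩
  rw [Real.rpow_zero, mul_one]
  have h0 : ∀ x, x ∉ T a → b a x = 0 := fun x hx =>
    image_eq_zero_of_notMem_tsupport fun h => hx (hs a h)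
  refine wNorm_zero_le (hD.isTest hb hsK a) (hTm a) (fun x hx => ?_) hC (fun x => ?_) (hA a) (hV a)
  · simp [osc, h0 x hx]
  · refine (norm_osc_le hD.one_le hD.im_nonneg hsK a x).trans ?_
    by_cases hx : x ∈ T a
    · exact h a x (hT a hx)
    · simpa [h0 x hx] using hC

/-- Raising the order amounts to bounding first derivatives, and these are λ times oscillatory
functions of the same class with no larger support. -/
theorem sobolevBound_succ (hD : OscData K δ lam W) (hT : ∀ a, T a ⊆ K) (hA : ∀ a, 0 ≤ A a)
    {s : ℝ} (h : SobolevBound K δ lam W T A s) : SobolevBound K δ lam W T A (s + 1) := by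
  intro b hb hs
  have hsK : ∀ a, tsupport (b a) ⊆ K := fun a => (hs a).trans (hT a)
  obtain ⟨C, hC, h0⟩ := h b hb hs
  choose b' hb' hbs' hpd using fun k => hD.pd_osc hb k
  choose D hDn hd using fun k => h (b' k) (hb' k) fun a => (hbs' k a).trans (hs a)
  have hDs : 0 ≤ ∑ k, D k := Finset.sum_nonneg fun k _ => hDn k
  refine ⟨C + ∑ k, D k, by positivity, fun a => ?_⟩
  have hl := hD.one_le a
  have hl0 : 0 < lam a := by linarith
  have hA' := hA a
  have hk : ∀ k, wNorm s (pd k (osc (lam a) (W a) (b a))) ≤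
      ENNReal.ofReal (D k * A a * lam a ^ (s + 1)) := fun k => by
    have := wNorm_le_sum (κ := Unit) (s := s) (t := fun _ => s) (c := fun _ => lam a)
      (u := pd k (osc (lam a) (W a) (b a))) (v := fun _ => osc (lam a) (W a) (b' k a))
      (fun _ => hD.isTest (hb' k) (fun a => (hbs' k a).trans (hsK a)) a) (fun _ => hl0.le)
      (fun ξ => by
        rw [hpd k a, hat_const_mul, norm_mul, Complex.norm_real, Real.norm_of_nonneg hl0.le]
        simp only [Finset.univ_unique, Finset.sum_singleton]
        exact le_of_eq (by ring))
    simp only [Finset.univ_unique, Finset.sum_singleton] at this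
    refine this.trans ((mul_le_mul_right (hd k a) _).trans (le_of_eq ?_))
    rw [← ENNReal.ofReal_mul hl0.le, Real.rpow_add hl0, Real.rpow_one]
    congr 1
    ring
  refine (wNorm_succ_le (hD.isTest hb hsK a)).trans ?_
  calc _ ≤ ENNReal.ofReal (C * A a * lam a ^ (s + 1)) +
        ∑ k, ENNReal.ofReal (D k * A a * lam a ^ (s + 1)) := by
        refine add_le_add ((h0 a).trans (ENNReal.ofReal_le_ofReal ?_))
          (Finset.sum_le_sum fun k _ => hk k)
        gcongr
        linarith
    _ = _ := by
        rw [← ENNReal.ofReal_sum_of_nonneg fun k _ => by have := hDn k; positivity,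
          ← ENNReal.ofReal_add (by positivity)
            (Finset.sum_nonneg fun k _ => by have := hDn k; positivity)]
        congr 1
        rw [← Finset.sum_mul, ← Finset.sum_mul]
        ring

/-- In the non-stationary decomposition the divergence has norm of order s at most λ^{-1} times
norms of order s + 1, that is, O(λ^s) relative to A. The remainder is λ^{δ-1} times a function of
the same kind, so iteration makes it as small as required. -/
theorem sobolevBound_pred (hD : OscData K δ lam W) (hT : ∀ a, T a ⊆ K) (hA : ∀ a, 0 ≤ A a)
    {c : ℝ} (hc : 0 < c) (hg : ∀ a, ∀ x ∈ K, c ≤ ‖reGrad (W a) x‖)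
    {s : ℝ} (h : SobolevBound K δ lam W T A (s + 1)) : SobolevBound K δ lam W T A s := by
  have hl0 : ∀ a, 0 < lam a := fun a => one_pos.trans_le (hD.one_le a)
  have hμ1 : ∀ a, 1 ≤ lam a ^ δ := fun a => Real.one_le_rpow (hD.one_le a) hD.δ_nonneg
  -- L counts the decompositions. For L = 0 the estimate is the hypothesis of order s + 1 together
  -- with monotonicity of the norm in the order. All amplitudes are quantified over because the
  -- induction passes from b to B'.
  have key : ∀ (L : ℕ) (b : α → Rn n → ℂ), USmooth K (fun a => lam a ^ δ) b →
      (∀ a, tsupport (b a) ⊆ T a) → ∃ C : ℝ, 0 ≤ C ∧ ∀ a,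
        wNorm s (osc (lam a) (W a) (b a)) ≤
          ENNReal.ofReal (C * A a * (lam a ^ s + lam a ^ (s + 1 - (1 - δ) * L))) := by
    intro L
    induction L with
    | zero =>
      intro b hb hs
      obtain ⟨C, hC, h0⟩ := h b hb hs
      refine ⟨C, hC, fun a => (wNorm_mono (by linarith) _).trans
        ((h0 a).trans (ENNReal.ofReal_le_ofReal ?_))⟩
      have := hA a
      have := hl0 a
      gcongr
      simpa using by positivity
    | succ L ih =>
      intro b hb hs
      obtain ⟨B, B', hB, hB', hBt, hBt', hdec⟩ := nonstationary_decomposition (ε := c ^ 2)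
        (by positivity) hl0 hμ1 hD.phase hb fun a x hx =>
          (pow_le_pow_left₀ hc.le (hg a x (hT a (hs a hx))) 2).trans
            (norm_sq_le_gradSq fun k => reGrad_apply (hD.phase.smooth a) x k)
      obtain ⟨C', hC', h'⟩ := ih B' hB' fun a => (hBt' a).trans (hs a)
      choose D hDn hd using fun k => h (B k) (hB k) fun a => (hBt k a).trans (hs a)
      have hDs : 0 ≤ ∑ k, D k := Finset.sum_nonneg fun k _ => hDn k
      refine ⟨C' + ∑ k, D k, by positivity, fun a => ?_⟩
      have hl := hD.one_le a
      have hl0 := hl0 a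
      have hA' := hA a
      have hsK : tsupport (b a) ⊆ K := (hs a).trans (hT a)
      have ht : ∀ k, IsTest (osc (lam a) (W a) (B k a)) := fun k =>
        hD.isTest (hB k) (fun a => (hBt k a).trans ((hs a).trans (hT a))) a
      have ht' : IsTest (osc (lam a) (W a) (B' a)) :=
        hD.isTest hB' (fun a => (hBt' a).trans ((hs a).trans (hT a))) a
      have h1 := wNorm_le_sum (κ := Option (Fin n)) (s := s) (u := osc (lam a) (W a) (b a))
        (t := fun i => i.elim s fun _ => s + 1)
        (c := fun i => i.elim (lam a ^ δ / lam a) fun _ => (lam a)⁻¹)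
        (v := fun i => i.elim (osc (lam a) (W a) (B' a)) fun k => osc (lam a) (W a) (B k a))
        (by rintro (_ | k); exacts [ht', ht k])
        (by rintro (_ | k) <;> simp only [Option.elim_none, Option.elim_some] <;> positivity)
        fun ξ => ?_
      · simp only [Fintype.sum_option, Option.elim_none, Option.elim_some] at h1
        refine h1.trans ((add_le_add (mul_le_mul_right (h' a) _) (Finset.sum_le_sum fun k _ =>
          mul_le_mul_right (hd k a) _)).trans ?_)
        simp only [← ENNReal.ofReal_mul (inv_nonneg.mpr hl0.le),
          ← ENNReal.ofReal_mul (show 0 ≤ lam a ^ δ / lam a by positivity)]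
        rw [← ENNReal.ofReal_sum_of_nonneg fun k _ => by have := hDn k; positivity,
          ← ENNReal.ofReal_add (by positivity)
            (Finset.sum_nonneg fun k _ => by have := hDn k; positivity)]
        refine ENNReal.ofReal_le_ofReal ?_
        -- The prefactor λ^{δ-1} of the remainder moves the second exponent from L to L + 1.
        have e1 : lam a ^ δ / lam a * (C' * A a * (lam a ^ s + lam a ^ (s + 1 - (1 - δ) * L))) =
            C' * A a * (lam a ^ (s + (δ - 1)) + lam a ^ (s + 1 - (1 - δ) * ((L + 1 : ℕ) : ℝ))) := by
          have : s + 1 - (1 - δ) * ((L + 1 : ℕ) : ℝ) = s + 1 - (1 - δ) * L + (δ - 1) := by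
            push_cast; ring
          rw [this, Real.rpow_add hl0, Real.rpow_add hl0 _ (δ - 1), Real.rpow_sub_one hl0.ne']
          ring
        have e2 : ∑ k, (lam a)⁻¹ * (D k * A a * lam a ^ (s + 1)) =
            (∑ k, D k) * A a * lam a ^ s := by
          rw [Real.rpow_add_one hl0.ne', Finset.sum_mul, Finset.sum_mul]
          refine Finset.sum_congr rfl fun k _ => ?_
          field_simp
        rw [e1, e2]
        have h3 : lam a ^ (s + (δ - 1)) ≤ lam a ^ s :=
          Real.rpow_le_rpow_of_exponent_le hl (by linarith [hD.δ_lt])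
        have h4 : 0 ≤ lam a ^ (s + 1 - (1 - δ) * ((L + 1 : ℕ) : ℝ)) := by positivity
        have h5 : 0 ≤ (∑ k, D k) * A a := by positivity
        have h6 : 0 ≤ C' * A a := by positivity
        nlinarith
      · have e : osc (lam a) (W a) (b a) = fun x => (((lam a)⁻¹ : ℝ) : ℂ) *
            (∑ k, pd k (osc (lam a) (W a) (B k a)) x) + ((lam a ^ δ / lam a : ℝ) : ℂ) *
              osc (lam a) (W a) (B' a) x := by
          ext x
          exact hdec a x
        have e2 : hat (osc (lam a) (W a) (b a)) ξ = (((lam a)⁻¹ : ℝ) : ℂ) *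
            (∑ k, hat (pd k (osc (lam a) (W a) (B k a))) ξ) + ((lam a ^ δ / lam a : ℝ) : ℂ) *
              hat (osc (lam a) (W a) (B' a)) ξ := by
          rw [e, hat_add ((integrable_finsetSum _ fun k _ => ((ht k).pd k).integrable).const_mul _)
            (ht'.integrable.const_mul _), hat_const_mul, hat_const_mul,
            hat_sum _ fun k _ => ((ht k).pd k).integrable]
        simp only [Fintype.sum_option, Option.elim_none, Option.elim_some]
        have e3 : ‖hat (osc (lam a) (W a) (b a)) ξ‖ ≤ (lam a)⁻¹ *
            (∑ k, |ξ k| * ‖hat (osc (lam a) (W a) (B k a)) ξ‖) + lam a ^ δ / lam a *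
              ‖hat (osc (lam a) (W a) (B' a)) ξ‖ := by
          rw [e2]
          refine (norm_add_le _ _).trans (add_le_add ?_ ?_)
          · rw [norm_mul, Complex.norm_real, Real.norm_of_nonneg (by positivity)]
            gcongr
            refine (norm_sum_le _ _).trans (le_of_eq ?_)
            simp only [norm_hat_pd (ht _)]
          · rw [norm_mul, Complex.norm_real, Real.norm_of_nonneg (by positivity)]
        have hw : 0 ≤ (1 + ‖ξ‖ ^ 2) ^ (s / 2) := by positivity
        refine (mul_le_mul_of_nonneg_left e3 hw).trans ?_
        rw [mul_add, add_comm, Finset.mul_sum, Finset.mul_sum]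
        refine add_le_add (le_of_eq (by ring)) (Finset.sum_le_sum fun k _ => ?_)
        rw [add_div, Real.rpow_add (by positivity)]
        have := abs_coord_le ξ k
        calc _ = (lam a)⁻¹ * ((1 + ‖ξ‖ ^ 2) ^ (s / 2) * |ξ k| *
              ‖hat (osc (lam a) (W a) (B k a)) ξ‖) := by ring
          _ ≤ _ := by gcongr
  intro b hb hs
  -- With (1 - δ)L ≥ 1 the second term is no larger than λ^s.
  obtain ⟨L, hL⟩ := exists_nat_ge (1 / (1 - δ))
  rw [div_le_iff₀ (by linarith [hD.δ_lt])] at hL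
  obtain ⟨C, hC, h1⟩ := key L b hb hs
  refine ⟨C * 2, by positivity, fun a => (h1 a).trans (ENNReal.ofReal_le_ofReal ?_)⟩
  have h3 : lam a ^ (s + 1 - (1 - δ) * L) ≤ lam a ^ s :=
    Real.rpow_le_rpow_of_exponent_le (hD.one_le a) (by linarith)
  have h6 : 0 ≤ C * A a := mul_nonneg hC (hA a)
  nlinarith

/-- Order 0 is Plancherel, and the steps of size one reach every integer in both directions. -/
theorem sobolevBound_int (hD : OscData K δ lam W) (hT : ∀ a, T a ⊆ K)
    (hTm : ∀ a, MeasurableSet (T a)) (hA : ∀ a, 0 ≤ A a)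
    (hV : ∀ a, volume (T a) ≤ ENNReal.ofReal (A a ^ 2))
    {c : ℝ} (hc : 0 < c) (hg : ∀ a, ∀ x ∈ K, c ≤ ‖reGrad (W a) x‖) (N : ℤ) :
    SobolevBound K δ lam W T A N := by
  induction N using Int.induction_on with
  | zero => simpa using hD.sobolevBound_zero hT hTm hA hV
  | succ k ih =>
    push_cast at ih ⊢
    exact hD.sobolevBound_succ hT hA ih
  | pred k ih =>
    push_cast at ih ⊢
    refine hD.sobolevBound_pred hT hA hc hg ?_
    convert ih using 1
    ring

end OscData

end SobolevUpper

end OscSum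
end

open MeasureTheory Filter Topology Set
open scoped ContDiff ENNReal

noncomputable section

namespace OscSum

/-! ### Supports and uniform bounds for the given family; proof of the upper bound -/

section OscFamily

variable {ι : Type*} {n M : ℕ}

/-- The assumptions on the phases and the amplitudes of a family of oscillatory sums. -/
structure OscFamily (δ ϱ : ℝ) (w : ι → ℝ → Rn n → ℂ) (φ : ι → ℝ → Fin (M + 1) → Rn n → ℂ)
    (c : ℝ) (i₀ : Fin n) (R : ℝ) : Prop where
  δ_pos : 0 < δ
  δ_lt : δ < 1
  ϱ_pos : 0 < ϱ
  phase_smooth : ∀ s, ∀ lam : ℝ, 1 ≤ lam → ContDiff ℝ ∞ (w s lam)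
  phase_bound : ∀ (i : ℕ) (K : Set (Rn n)), IsCompact K → ∃ B : ℝ, ∀ s, ∀ lam : ℝ, 1 ≤ lam →
      ∀ x ∈ K, ‖iteratedFDeriv ℝ i (w s lam) x‖ ≤ B
  im_nonneg : ∀ s, ∀ lam : ℝ, 1 ≤ lam → ∀ x, 0 ≤ (w s lam x).im
  c_pos : 0 < c
  grad_ge : ∀ s, ∀ lam : ℝ, 1 ≤ lam → ∀ x, c ≤ ‖reGrad (w s lam) x‖
  amp_smooth : ∀ s, ∀ lam : ℝ, 1 ≤ lam → ∀ j, ContDiff ℝ ∞ (φ s lam j)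
  amp_bound : ∀ i : ℕ, ∃ B : ℝ, ∀ s, ∀ lam : ℝ, 1 ≤ lam → ∀ j x,
      ‖iteratedFDeriv ℝ i (φ s lam j) x‖ ≤ B
  amp_support : ∀ s, ∀ lam : ℝ, 1 ≤ lam → ∀ j y, φ s lam j y ≠ 0 →
      (∀ i, i ≠ i₀ → |y i| ≤ R) ∧ |y i₀| ≤ R * lam ^ δ

namespace OscFamily

/-- The parameters `(s, λ)` with `λ ≥ 1`. -/
abbrev Idx (ι : Type*) := ι × {lam : ℝ // 1 ≤ lam}

/-- The total amplitude `∑_j φ_j(λ^δ x) λ^{-jϱ}`. -/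
def amp (δ ϱ : ℝ) (φ : ι → ℝ → Fin (M + 1) → Rn n → ℂ) (a : Idx ι) (x : Rn n) : ℂ :=
  ∑ j : Fin (M + 1), φ a.1 a.2 j ((a.2 : ℝ) ^ δ • x) *
    ((((a.2 : ℝ) ^ (-((j : ℕ) : ℝ) * ϱ) : ℝ)) : ℂ)

/-- The box containing the supports. -/
def box (δ : ℝ) (i₀ : Fin n) (R : ℝ) (lam : ℝ) : Set (Rn n) :=
  {x | ∀ i, |x i| ≤ if i = i₀ then |R| else |R| * lam ^ (-δ)}

/-- A ball containing all the supports. -/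
def ball (n : ℕ) (R : ℝ) : Set (Rn n) := Metric.closedBall 0 (n * |R| + 1)

theorem oscSum_eq (δ ϱ : ℝ) (w : ι → ℝ → Rn n → ℂ) (φ : ι → ℝ → Fin (M + 1) → Rn n → ℂ)
    (a : Idx ι) (x : Rn n) :
    oscSum δ ϱ a.2 (w a.1 a.2) (φ a.1 a.2) x =
      ((((a.2 : ℝ) ^ (((n : ℝ) - 1) * δ / 2) : ℝ)) : ℂ) *
        osc a.2 (w a.1 a.2) (amp δ ϱ φ a) x := by
  rw [oscSum, osc, amp, mul_assoc]

theorem isClosed_box (δ : ℝ) (i₀ : Fin n) (R lam : ℝ) : IsClosed (box δ i₀ R lam) := by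
  simp only [box, ofPred_forall]
  exact isClosed_iInter fun i => isClosed_le (by fun_prop) continuous_const

theorem norm_le_of_mem_box {δ : ℝ} (hδ : 0 ≤ δ) {i₀ : Fin n} {R lam : ℝ} (hlam : 1 ≤ lam)
    {x : Rn n} (hx : x ∈ box δ i₀ R lam) : ‖x‖ ≤ n * |R| := by
  have h : ∀ i, |x i| ≤ |R| := fun i => by
    refine (hx i).trans ?_
    split_ifs
    · exact le_rfl
    · exact mul_le_of_le_one_right (abs_nonneg _)
        (Real.rpow_le_one_of_one_le_of_nonpos hlam (by linarith))
  calc ‖x‖ = ‖∑ i, x i • stdVec i‖ := by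
        congr 1
        ext j
        simp [stdVec, Finset.sum_apply, Pi.single_apply]
    _ ≤ ∑ i, |x i| := by
        refine (norm_sum_le _ _).trans (le_of_eq (Finset.sum_congr rfl fun i _ => ?_))
        rw [norm_smul, norm_stdVec, mul_one, Real.norm_eq_abs]
    _ ≤ ∑ _i : Fin n, |R| := Finset.sum_le_sum fun i _ => h i
    _ = _ := by simp

theorem box_subset_ball {δ : ℝ} (hδ : 0 ≤ δ) {i₀ : Fin n} {R lam : ℝ} (hlam : 1 ≤ lam) :
    box δ i₀ R lam ⊆ ball n R := fun x hx => by
  have := norm_le_of_mem_box hδ hlam hx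
  simp only [ball, mem_closedBall_zero_iff]
  linarith

/-- One side of the box has length O(1) and the other n - 1 have length O(λ^{-δ}). The right-hand
side is written as a square since its root enters the L² norm. -/
theorem volume_box_le (δ : ℝ) (i₀ : Fin n) (R : ℝ) {lam : ℝ} (hlam : 1 ≤ lam) :
    volume (box δ i₀ R lam) ≤
      ENNReal.ofReal ((√((2 * |R|) ^ n) * lam ^ (-(((n : ℝ) - 1) * δ / 2))) ^ 2) := by
  have hl : 0 < lam := by linarith
  set r : Fin n → ℝ := fun i => if i = i₀ then |R| else |R| * lam ^ (-δ) with hr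
  have hr0 : ∀ i, 0 ≤ r i := fun i => by simp only [hr]; split_ifs <;> positivity
  have e : box δ i₀ R lam = (WithLp.ofLp : Rn n → Fin n → ℝ) ⁻¹' (Icc (-r) r) := by
    ext x
    simp only [box, mem_ofPred_eq, mem_preimage, mem_Icc, Pi.le_def, Pi.neg_apply, ← forall_and,
      ← abs_le]
    rfl
  rw [e, (PiLp.volume_preserving_ofLp (Fin n)).measure_preimage measurableSet_Icc.nullMeasurableSet,
    Real.volume_Icc_pi, ← ENNReal.ofReal_prod_of_nonneg fun i _ => by
      have := hr0 i; simp only [Pi.neg_apply]; linarith]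
  refine ENNReal.ofReal_le_ofReal (le_of_eq ?_)
  rw [mul_pow, Real.sq_sqrt (by positivity), ← Real.rpow_natCast (lam ^ _) 2,
    ← Real.rpow_mul hl.le]
  have h1 : ∀ i, r i - (-r) i = 2 * |R| * (if i = i₀ then 1 else lam ^ (-δ)) := fun i => by
    simp only [hr, Pi.neg_apply]; split_ifs <;> ring
  simp_rw [h1]
  rw [Finset.prod_mul_distrib, Finset.prod_const, Finset.card_univ, Fintype.card_fin]
  congr 1
  rw [← Finset.mul_prod_erase _ _ (Finset.mem_univ i₀), if_pos rfl, one_mul,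
    Finset.prod_congr rfl (g := fun _ => lam ^ (-δ)) fun i hi => if_neg (Finset.ne_of_mem_erase hi),
    Finset.prod_const, Finset.card_erase_of_mem (Finset.mem_univ _), Finset.card_univ,
    Fintype.card_fin, ← Real.rpow_natCast, ← Real.rpow_mul hl.le,
    Nat.cast_sub (Nat.one_le_of_lt i₀.pos)]
  congr 1
  push_cast
  ring

variable {δ ϱ : ℝ} {w : ι → ℝ → Rn n → ℂ} {φ : ι → ℝ → Fin (M + 1) → Rn n → ℂ}
  {c : ℝ} {i₀ : Fin n} {R : ℝ}

theorem isCompact_ball (n : ℕ) (R : ℝ) : IsCompact (ball n R) := isCompact_closedBall _ _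

theorem phase_uSmooth (H : OscFamily δ ϱ w φ c i₀ R) {K : Set (Rn n)} (hK : IsCompact K) :
    USmooth K (fun _ => 1) (fun a : Idx ι => w a.1 a.2) := by
  refine ⟨fun a => H.phase_smooth _ _ a.2.2, fun i => ?_⟩
  obtain ⟨B, hB⟩ := H.phase_bound i K hK
  refine ⟨max B 0, le_max_right _ _, fun a x hx => ?_⟩
  simpa using Or.inl (hB a.1 a.2 a.2.2 x hx)

theorem oscData (H : OscFamily δ ϱ w φ c i₀ R) {K : Set (Rn n)} (hK : IsCompact K) :
    OscData K δ (fun a : Idx ι => (a.2 : ℝ)) (fun a => w a.1 a.2) where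
  compact := hK
  δ_nonneg := H.δ_pos.le
  δ_lt := H.δ_lt
  one_le a := a.2.2
  phase := H.phase_uSmooth hK
  im_nonneg a x _ := H.im_nonneg _ _ a.2.2 x

theorem summand_uSmooth (H : OscFamily δ ϱ w φ c i₀ R) (K : Set (Rn n)) (j : Fin (M + 1)) :
    USmooth K (fun a : Idx ι => (a.2 : ℝ) ^ δ)
      (fun a x => φ a.1 a.2 j ((a.2 : ℝ) ^ δ • x)) := by
  have h : USmooth univ (fun _ : Idx ι => 1) (fun a => φ a.1 a.2 j) := by
    refine ⟨fun a => H.amp_smooth _ _ a.2.2 j, fun i => ?_⟩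
    obtain ⟨B, hB⟩ := H.amp_bound i
    refine ⟨max B 0, le_max_right _ _, fun a x _ => ?_⟩
    simpa using Or.inl (hB a.1 a.2 a.2.2 j x)
  have h0 : ∀ a : Idx ι, 0 ≤ (a.2 : ℝ) ^ δ :=
    fun a => Real.rpow_nonneg (zero_le_one.trans a.2.2) _
  exact ⟨(h.rescale (K := K) h0).smooth, (h.rescale h0).bound⟩

theorem amp_uSmooth (H : OscFamily δ ϱ w φ c i₀ R) (K : Set (Rn n)) :
    USmooth K (fun a : Idx ι => (a.2 : ℝ) ^ δ) (amp δ ϱ φ) := by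
  have h1 : ∀ a : Idx ι, 1 ≤ (a.2 : ℝ) ^ δ := fun a => Real.one_le_rpow a.2.2 H.δ_pos.le
  refine USmooth.sum _ fun j _ => ?_
  refine (H.summand_uSmooth K j).mul ((USmooth.const (B := 1) fun a => ?_).mono subset_rfl
    (fun _ => zero_le_one) h1) fun a => zero_le_one.trans (h1 a)
  have ha := zero_le_one.trans a.2.2
  rw [Complex.norm_real, Real.norm_of_nonneg (Real.rpow_nonneg ha _)]
  refine Real.rpow_le_one_of_one_le_of_nonpos a.2.2 ?_
  have := H.ϱ_pos
  have : 0 ≤ ((j : ℕ) : ℝ) * ϱ := by positivity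
  linarith

theorem mem_box_of_ne_zero (H : OscFamily δ ϱ w φ c i₀ R) (a : Idx ι) (j : Fin (M + 1)) {x : Rn n}
    (hx : φ a.1 a.2 j ((a.2 : ℝ) ^ δ • x) ≠ 0) : x ∈ box δ i₀ R a.2 := by
  obtain ⟨h1, h2⟩ := H.amp_support a.1 a.2 a.2.2 j _ hx
  have hl : 0 < (a.2 : ℝ) := one_pos.trans_le a.2.2
  have hp : 0 < (a.2 : ℝ) ^ δ := Real.rpow_pos_of_pos hl _
  simp only [PiLp.smul_apply, smul_eq_mul, abs_mul, abs_of_pos hp] at h1 h2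
  intro i
  split_ifs with hi
  · subst hi
    rw [mul_comm] at h2
    exact (le_of_mul_le_mul_right h2 hp).trans (le_abs_self R)
  · rw [Real.rpow_neg hl.le, ← div_eq_mul_inv, le_div_iff₀ hp, mul_comm]
    exact (h1 i hi).trans (le_abs_self R)

theorem oscSupport_subset_box (H : OscFamily δ ϱ w φ c i₀ R) (a : Idx ι) :
    oscSupport δ a.2 (φ a.1 a.2) ⊆ box δ i₀ R a.2 :=
  iUnion_subset fun j => closure_minimal (fun _ hx => H.mem_box_of_ne_zero a j hx)
    (isClosed_box _ _ _ _)

theorem tsupport_amp_subset (δ ϱ : ℝ) (φ : ι → ℝ → Fin (M + 1) → Rn n → ℂ) (a : Idx ι) :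
    tsupport (amp δ ϱ φ a) ⊆ oscSupport δ a.2 (φ a.1 a.2) := by
  refine closure_minimal (fun x hx => ?_) (isClosed_iUnion_of_finite fun j => isClosed_tsupport _)
  contrapose! hx
  simp only [oscSupport, mem_iUnion, not_exists] at hx
  have : ∀ j, φ a.1 a.2 j ((a.2 : ℝ) ^ δ • x) = 0 := fun j =>
    image_eq_zero_of_notMem_tsupport (f := fun x => φ a.1 a.2 j ((a.2 : ℝ) ^ δ • x)) (hx j)
  simp [amp, this]

theorem tsupport_amp_subset_ball (H : OscFamily δ ϱ w φ c i₀ R) (a : Idx ι) :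
    tsupport (amp δ ϱ φ a) ⊆ ball n R :=
  (tsupport_amp_subset δ ϱ φ a).trans
    ((H.oscSupport_subset_box a).trans (box_subset_ball H.δ_pos.le a.2.2))

theorem sobolevNorm_const_mul (s : ℝ) (r : ℂ) (u : Rn n → ℂ) :
    sobolevNorm s (fun x => r * u x) = ‖r‖ₑ * sobolevNorm s u := by
  have e : (fun ξ : Rn n => (((1 + ‖ξ‖ ^ 2) ^ (s / 2) : ℝ) : ℂ) * hat (fun x => r * u x) ξ) =
      r • fun ξ : Rn n => (((1 + ‖ξ‖ ^ 2) ^ (s / 2) : ℝ) : ℂ) * hat u ξ := by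
    ext ξ
    rw [hat_const_mul]
    simp
    ring
  rw [sobolevNorm, sobolevNorm, e, eLpNorm_const_smul]
  ring

/-- The upper bound for the Sobolev norms. -/
theorem sobolevNorm_le (H : OscFamily δ ϱ w φ c i₀ R) (N : ℤ) :
    ∃ C : ℝ, ∀ s, ∀ lam : ℝ, 1 ≤ lam →
      sobolevNorm (-(N : ℝ)) (oscSum δ ϱ lam (w s lam) (φ s lam)) ≤
        ENNReal.ofReal (C * lam ^ (-N)) := by
  obtain ⟨C, hC, h⟩ := (H.oscData (isCompact_ball n R)).sobolevBound_int
    (T := fun a => box δ i₀ R a.2)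
    (A := fun a => √((2 * |R|) ^ n) * (a.2 : ℝ) ^ (-(((n : ℝ) - 1) * δ / 2)))
    (fun a => box_subset_ball H.δ_pos.le a.2.2) (fun a => (isClosed_box _ _ _ _).measurableSet)
    (fun a => mul_nonneg (Real.sqrt_nonneg _) (Real.rpow_nonneg (zero_le_one.trans a.2.2) _))
    (fun a => volume_box_le δ i₀ R a.2.2) H.c_pos (fun a x _ => H.grad_ge _ _ a.2.2 x) (-N)
    (amp δ ϱ φ) (H.amp_uSmooth _)
    fun a => (tsupport_amp_subset δ ϱ φ a).trans (H.oscSupport_subset_box a)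
  refine ⟨(2 * Real.pi) ^ (-(n : ℝ) / 2) * (C * √((2 * |R|) ^ n)), fun s lam hlam => ?_⟩
  have hl : 0 < lam := by linarith
  set a : Idx ι := (s, ⟨lam, hlam⟩)
  have e : oscSum δ ϱ lam (w s lam) (φ s lam) = fun x =>
      ((lam ^ (((n : ℝ) - 1) * δ / 2) : ℝ) : ℂ) * osc lam (w s lam) (amp δ ϱ φ a) x := by
    ext x
    exact oscSum_eq δ ϱ w φ a x
  have h1 := h a
  rw [e, sobolevNorm_const_mul]
  rw [wNorm] at h1
  push_cast at h1
  calc _ ≤ ENNReal.ofReal (lam ^ (((n : ℝ) - 1) * δ / 2)) *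
        (ENNReal.ofReal ((2 * Real.pi) ^ (-(n : ℝ) / 2)) * ENNReal.ofReal
          (C * (√((2 * |R|) ^ n) * lam ^ (-(((n : ℝ) - 1) * δ / 2))) * lam ^ (-(N : ℝ)))) := by
        rw [sobolevNorm]
        refine mul_le_mul' (le_of_eq ?_) (mul_le_mul_right h1 _)
        rw [← ofReal_norm, Complex.norm_real, Real.norm_of_nonneg (by positivity)]
    _ = _ := by
        rw [← ENNReal.ofReal_mul (by positivity), ← ENNReal.ofReal_mul (by positivity)]
        congr 1
        have h2 : lam ^ (-N) = lam ^ (-(N : ℝ)) := by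
          rw [← Real.rpow_intCast]
          push_cast
          rfl
        -- The normalizing power λ^{(n-1)δ/2} cancels the square root of the volume of the box.
        rw [h2, Real.rpow_neg hl.le (((n : ℝ) - 1) * δ / 2)]
        have : lam ^ (((n : ℝ) - 1) * δ / 2) ≠ 0 := (Real.rpow_pos_of_pos hl _).ne'
        field_simp

end OscFamily

end OscFamily

end OscSum
end

open MeasureTheory Filter Topology Set
open scoped ContDiff ENNReal

noncomputable section

namespace OscSum

/-! ### Decay outside Γ and convergence in 𝓓'_Γ -/

section WaveFront

variable {ι : Type*} {n M : ℕ}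

/-- The product with `⊤` encodes uniformity in s. The threshold may be taken ≥ 1, where the
hypotheses on the family are available. -/
theorem eventually_top_prod_atTop {p : ι × ℝ → Prop} :
    (∀ᶠ a in (⊤ : Filter ι) ×ˢ (atTop : Filter ℝ), p a) ↔
      ∃ L : ℝ, 1 ≤ L ∧ ∀ s, ∀ lam : ℝ, L ≤ lam → p (s, lam) := by
  rw [← principal_univ]
  constructor
  · intro h
    obtain ⟨pa, ha, pb, hb, hp⟩ := eventually_prod_iff.mp h
    rw [eventually_principal] at ha
    obtain ⟨L, hL⟩ := eventually_atTop.mp hb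
    exact ⟨max L 1, le_max_right _ _, fun s lam hlam =>
      hp (ha s (mem_univ s)) (hL lam ((le_max_left _ _).trans hlam))⟩
  · rintro ⟨L, _, h⟩
    exact eventually_prod_iff.mpr ⟨fun _ => True, by simp, fun lam => L ≤ lam,
      eventually_ge_atTop L, fun _ lam hlam => h _ lam hlam⟩

theorem frequently_top_prod_atTop {p : ι × ℝ → Prop} :
    (∃ᶠ a in (⊤ : Filter ι) ×ˢ (atTop : Filter ℝ), p a) ↔
      ∀ L : ℝ, 1 ≤ L → ∃ s, ∃ lam : ℝ, L ≤ lam ∧ p (s, lam) := by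
  rw [Filter.Frequently, eventually_top_prod_atTop]
  push Not
  rfl

theorem IsTest.mul {u v : Rn n → ℂ} (hu : IsTest u) (hv : ContDiff ℝ ∞ v) :
    IsTest (fun x => u x * v x) :=
  ⟨hu.1.mul hv, hu.2.mul_right⟩

theorem IsTest.const_mul {u : Rn n → ℂ} (hu : IsTest u) (r : ℂ) : IsTest (fun x => r * u x) :=
  ⟨contDiff_const.mul hu.1, hu.2.mul_left⟩

theorem IsTest.hat_decay {u : Rn n → ℂ} (hu : IsTest u) (N : ℕ) :
    ∃ C : ℝ, 0 ≤ C ∧ ∀ ξ, ‖hat u ξ‖ ≤ C * ((1 + ‖ξ‖) ^ N)⁻¹ := by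
  have := schwartz_decay (hatS hu.toSchwartz) N
  rwa [coe_hatS, hu.coe_toSchwartz] at this

/-- A test function equal to `1` near a given point. -/
theorem exists_isTest_eq_one (x₀ : Rn n) {r : ℝ} (hr : 0 < r) :
    ∃ χ : Rn n → ℂ, IsTest χ ∧ (∀ x, dist x x₀ ≤ r → χ x = 1) ∧
      tsupport χ ⊆ Metric.closedBall x₀ (2 * r) := by
  let f : ContDiffBump x₀ := ⟨r, 2 * r, hr, by linarith⟩
  refine ⟨fun x => (f x : ℂ), ⟨Complex.ofRealCLM.contDiff.comp f.contDiff,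
    f.hasCompactSupport.comp_left (g := fun t : ℝ => (t : ℂ)) (by simp)⟩, fun x hx => ?_, ?_⟩
  · simp [f.one_of_mem_closedBall hx]
  · refine (closure_mono ?_).trans f.tsupport_eq.subset
    intro x hx hx'
    exact hx (by simp [hx'])

/-- For each fixed λ the oscillatory sum is itself a test function, so the inclusion of wave front
sets in Γ is trivial; the content of 𝓓'_Γ convergence lies in the uniform decay. -/
theorem waveFront_eq_empty {u : Rn n → ℂ} (hu : IsTest u) : waveFront u = ∅ := by
  refine eq_empty_of_forall_notMem fun p hp => hp.2 ?_
  obtain ⟨χ, hχ, h1, _⟩ := exists_isTest_eq_one p.1 one_pos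
  refine ⟨χ, hχ, by simp [h1 p.1 (by simp)], univ, univ_mem, fun m => ?_⟩
  obtain ⟨C, -, h⟩ := (hχ.mul hu.1).hat_decay m
  refine ⟨C, fun η _ t _ => (h _).trans (le_of_eq ?_)⟩
  rw [Real.rpow_neg (by positivity), Real.rpow_natCast]

/-- A smooth function on the line that is `1` for `t ≤ ε / 2` and `0` for `t ≥ ε`. -/
def lowCut (ε t : ℝ) : ℝ := Real.smoothTransition (2 - 2 * t / ε)

theorem contDiff_lowCut (ε : ℝ) : ContDiff ℝ ∞ (lowCut ε) :=
  Real.smoothTransition.contDiff.comp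
    (contDiff_const.sub ((contDiff_const.mul contDiff_id).div_const _))

theorem lowCut_of_le {ε t : ℝ} (hε : 0 < ε) (ht : t ≤ ε / 2) : lowCut ε t = 1 := by
  refine Real.smoothTransition.one_of_one_le ?_
  have : 2 * t / ε ≤ 1 := by rw [div_le_one hε]; linarith
  linarith

theorem lowCut_of_ge {ε t : ℝ} (hε : 0 < ε) (ht : ε ≤ t) : lowCut ε t = 0 := by
  refine Real.smoothTransition.zero_of_nonpos ?_
  have : 2 ≤ 2 * t / ε := by rw [le_div_iff₀ hε]; linarith
  linarith

/-- This handles the region where Im w is bounded away from 0. It follows from y^N / N! ≤ e^y. -/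
theorem exp_neg_mul_le {t : ℝ} (ht : 0 < t) (N : ℕ) :
    ∃ C : ℝ, 0 ≤ C ∧ ∀ lam : ℝ, 1 ≤ lam → Real.exp (-(lam * t)) ≤ C * (lam ^ N)⁻¹ := by
  refine ⟨N.factorial / t ^ N, by positivity, fun lam hlam => ?_⟩
  have hl : 0 < lam := by linarith
  have h := Real.pow_div_factorial_le_exp (lam * t) (by positivity) N
  rw [Real.exp_neg, ← div_eq_mul_inv, div_div, inv_le_comm₀ (Real.exp_pos _) (by positivity),
    inv_div]
  rw [mul_pow] at h
  rwa [mul_comm (t ^ N)]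

namespace OscFamily

variable {δ ϱ : ℝ} {w : ι → ℝ → Rn n → ℂ} {φ : ι → ℝ → Fin (M + 1) → Rn n → ℂ}
  {c : ℝ} {i₀ : Fin n} {R : ℝ}

theorem isTest_oscSum (H : OscFamily δ ϱ w φ c i₀ R) (a : Idx ι) :
    IsTest (oscSum δ ϱ a.2 (w a.1 a.2) (φ a.1 a.2)) := by
  have := ((H.oscData (isCompact_ball n R)).isTest (H.amp_uSmooth _)
    H.tsupport_amp_subset_ball a).const_mul ((((a.2 : ℝ) ^ (((n : ℝ) - 1) * δ / 2) : ℝ)) : ℂ)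
  convert this using 1
  ext x
  exact oscSum_eq δ ϱ w φ a x

theorem exists_reGrad_le (H : OscFamily δ ϱ w φ c i₀ R) {K : Set (Rn n)} (hK : IsCompact K) :
    ∃ B : ℝ, 1 ≤ B ∧ ∀ a : Idx ι, ∀ x ∈ K, ‖reGrad (w a.1 a.2) x‖ ≤ B := by
  obtain ⟨B, hB⟩ := H.phase_bound 1 K hK
  refine ⟨max B 1, le_max_right _ _, fun a x hx => le_max_of_le_left ?_⟩
  have h := hB a.1 a.2 a.2.2 x hx
  have hd : HasFDerivAt (fun y => (w a.1 a.2 y).re)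
      (Complex.reCLM.comp (fderiv ℝ (w a.1 a.2) x)) x :=
    Complex.reCLM.hasFDerivAt.comp x
      ((H.phase_smooth a.1 a.2 a.2.2).differentiable (by simp) x).hasFDerivAt
  rw [reGrad, gradient, LinearIsometryEquiv.norm_map, hd.fderiv]
  refine (ContinuousLinearMap.opNorm_comp_le _ _).trans ?_
  rw [Complex.reCLM_norm, one_mul, ← norm_iteratedFDeriv_zero (𝕜 := ℝ) (f := fderiv ℝ (w a.1 a.2)),
    norm_iteratedFDeriv_fderiv]
  exact h

/-- Away from the cone of the family, the scaled gradients of the phases stay away from the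
frequencies. -/
theorem exists_separation (H : OscFamily δ ϱ w φ c i₀ R) {T V : Set (Rn n)} (hT : IsClosed T)
    (hV : IsClosed V) (hVc : ∀ ξ ∈ V, ∀ t : ℝ, 0 < t → t • ξ ∈ V)
    (hd : Disjoint (oscCone δ w φ) (T ×ˢ V)) :
    ∃ ε : ℝ, 0 < ε ∧ ∃ L : ℝ, 1 ≤ L ∧ ∀ a : Idx ι, L ≤ a.2 →
      ∀ y ∈ oscSupport δ a.2 (φ a.1 a.2) ∩ T, (w a.1 a.2 y).im < ε → ∀ ξ ∈ V,
        ε * (a.2 + ‖ξ‖) ≤ ‖(a.2 : ℝ) • reGrad (w a.1 a.2) y - ξ‖ := by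
  by_contra! hcon
  obtain ⟨B, hB1, hB⟩ := H.exists_reGrad_le (isCompact_ball n R)
  -- Counterexamples are taken for ε = 1 / (k + 2) and λ ≥ k + 2. The shift by 2 gives ε ≤ 1 / 2,
  -- which bounds ξ / λ below.
  have hpos : ∀ k : ℕ, 0 < 1 / ((k : ℝ) + 2) := fun k => by positivity
  choose a ha y hy him ξ hξ hlt using fun k : ℕ => hcon (1 / ((k : ℝ) + 2)) (hpos k)
    ((k : ℝ) + 2) (by linarith [(Nat.cast_nonneg k : (0 : ℝ) ≤ k)])
  have hyb : ∀ k, y k ∈ ball n R := fun k =>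
    box_subset_ball H.δ_pos.le (a k).2.2 (H.oscSupport_subset_box _ (hy k).1)
  obtain ⟨⟨x, g⟩, -, ψ, hψ, hlim⟩ := ((isCompact_ball n R).prod
    (isCompact_closedBall (0 : Rn n) B)).tendsto_subseq
    (x := fun k => (y k, reGrad (w (a k).1 (a k).2) (y k)))
    fun k => ⟨hyb k, by simpa using hB (a k) (y k) (hyb k)⟩
  have hly : Tendsto (fun k => y (ψ k)) atTop (𝓝 x) := (continuous_fst.tendsto _).comp hlim
  have hlg : Tendsto (fun k => reGrad (w (a (ψ k)).1 (a (ψ k)).2) (y (ψ k))) atTop (𝓝 g) :=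
    (continuous_snd.tendsto _).comp hlim
  have hε0 : Tendsto (fun k => 1 / ((ψ k : ℝ) + 2)) atTop (𝓝 0) := by
    refine Tendsto.comp (g := fun k : ℕ => 1 / ((k : ℝ) + 2)) ?_ hψ.tendsto_atTop
    exact tendsto_const_nhds.div_atTop (tendsto_natCast_atTop_atTop.atTop_add tendsto_const_nhds)
  have hxT : x ∈ T := hT.mem_of_tendsto hly (Eventually.of_forall fun k => (hy _).2)
  have hmem : (x, g) ∈ limitSet ((⊤ : Filter ι) ×ˢ (atTop : Filter ℝ))
      (fun a => oscSupport δ a.2 (φ a.1 a.2)) (fun a => w a.1 a.2) := by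
    intro ε hε
    rw [frequently_top_prod_atTop]
    intro L _
    have e1 := (Metric.tendsto_nhds.mp hly) ε hε
    have e2 := (Metric.tendsto_nhds.mp hlg) ε hε
    have e3 := hε0.eventually (gt_mem_nhds hε)
    have e4 : ∀ᶠ k in atTop, L ≤ ((ψ k : ℕ) : ℝ) :=
      (tendsto_natCast_atTop_atTop.comp hψ.tendsto_atTop).eventually_ge_atTop L
    obtain ⟨k, h1, h2, h3, h4⟩ := (e1.and (e2.and (e3.and e4))).exists
    exact ⟨(a (ψ k)).1, (a (ψ k)).2, by linarith [ha (ψ k)], y (ψ k), (hy _).1, h1, h2,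
      (him _).trans h3⟩
  -- The failed inequality, divided by λ, says that |∇ Re w - ξ / λ| < ε(1 + |ξ / λ|). Hence ξ / λ
  -- is bounded by 2B + 1 and has the same limit g as the gradients, and V is a closed cone.
  have hgV : g ∈ V := by
    have hη : Tendsto (fun k => ((a (ψ k)).2 : ℝ)⁻¹ • ξ (ψ k)) atTop (𝓝 g) := by
      have h0 : Tendsto (fun k => reGrad (w (a (ψ k)).1 (a (ψ k)).2) (y (ψ k)) -
          ((a (ψ k)).2 : ℝ)⁻¹ • ξ (ψ k)) atTop (𝓝 0) := by
        refine squeeze_zero_norm (a := fun k => 1 / ((ψ k : ℝ) + 2) * (1 + (2 * B + 1)))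
          (fun k => ?_) (by simpa using hε0.mul_const (1 + (2 * B + 1)))
        set l : ℝ := ((a (ψ k)).2 : ℝ) with hl
        have hl1 : 1 ≤ l := (a (ψ k)).2.2
        have hl0 : 0 < l := by linarith
        set G := reGrad (w (a (ψ k)).1 l) (y (ψ k)) with hG
        have hGB : ‖G‖ ≤ B := hB _ _ (hyb _)
        set e : ℝ := 1 / ((ψ k : ℝ) + 2) with he
        have he0 : 0 < e := hpos _
        have he1 : e ≤ 1 / 2 :=
          one_div_le_one_div_of_le two_pos (by linarith [(Nat.cast_nonneg (ψ k) : (0:ℝ) ≤ _)])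
        have h1 : l • G - ξ (ψ k) = l • (G - l⁻¹ • ξ (ψ k)) := by
          rw [smul_sub, smul_inv_smul₀ hl0.ne']
        have h2 : ‖ξ (ψ k)‖ = l * ‖l⁻¹ • ξ (ψ k)‖ := by
          rw [norm_smul, norm_inv, Real.norm_of_nonneg hl0.le, mul_inv_cancel_left₀ hl0.ne']
        have h3 := hlt (ψ k)
        rw [← hl, ← hG, h1, h2, norm_smul, Real.norm_of_nonneg hl0.le, ← he] at h3
        set η := l⁻¹ • ξ (ψ k)
        have h4 : ‖G - η‖ < e * (1 + ‖η‖) := by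
          refine lt_of_mul_lt_mul_left (h3.trans_le (le_of_eq ?_)) hl0.le
          ring
        have h5 : ‖η‖ ≤ ‖G‖ + ‖G - η‖ := by
          have := norm_sub_norm_le η G
          rw [norm_sub_rev] at this
          linarith
        have h6 : ‖η‖ ≤ 2 * B + 1 := by
          have := norm_nonneg η
          nlinarith
        refine h4.le.trans ?_
        gcongr
      simpa using hlg.sub h0
    refine hV.mem_of_tendsto hη (Eventually.of_forall fun k => hVc _ (hξ _) _ ?_)
    exact inv_pos.mpr (one_pos.trans_le (a (ψ k)).2.2)
  exact hd.notMem_of_mem_left (a := (x, g)) ⟨(x, g), hmem, 1, one_pos, by simp⟩ ⟨hxT, hgV⟩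

theorem cut_amp_uSmooth (H : OscFamily δ ϱ w φ c i₀ R) {χ : Rn n → ℂ} (hχ : ContDiff ℝ ∞ χ) :
    USmooth (ball n R) (fun a : Idx ι => (a.2 : ℝ) ^ δ) (fun a x => χ x * amp δ ϱ φ a x) := by
  have h1 : ∀ a : Idx ι, 1 ≤ (a.2 : ℝ) ^ δ := fun a => Real.one_le_rpow a.2.2 H.δ_pos.le
  exact ((USmooth.fixed hχ (isCompact_ball n R).isBounded).mono subset_rfl
    (fun _ => zero_le_one) h1).mul (H.amp_uSmooth _) fun a => zero_le_one.trans (h1 a)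

theorem tsupport_cut_amp (H : OscFamily δ ϱ w φ c i₀ R) (χ : Rn n → ℂ) (a : Idx ι) :
    tsupport (fun x => χ x * amp δ ϱ φ a x) ⊆ ball n R :=
  (tsupport_mul_subset_right).trans (H.tsupport_amp_subset_ball a)

/-- Rapid decay of the localized Fourier transforms in a cone of frequencies that does not meet
the cone of the family. -/
theorem norm_hat_cut_le (H : OscFamily δ ϱ w φ c i₀ R) {χ : Rn n → ℂ} (hχ : ContDiff ℝ ∞ χ)
    {V : Set (Rn n)} (hV : IsClosed V) (hVc : ∀ ξ ∈ V, ∀ t : ℝ, 0 < t → t • ξ ∈ V)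
    (hd : Disjoint (oscCone δ w φ) (tsupport χ ×ˢ V)) (N : ℕ) :
    ∃ C : ℝ, 0 ≤ C ∧ ∃ L : ℝ, 1 ≤ L ∧ ∀ a : Idx ι, L ≤ a.2 → ∀ ξ ∈ V,
      ‖hat (osc a.2 (w a.1 a.2) (fun x => χ x * amp δ ϱ φ a x)) ξ‖ ≤
        C * (((a.2 : ℝ) + ‖ξ‖) ^ N)⁻¹ := by
  obtain ⟨ε, hε, L, hL, hsep⟩ := H.exists_separation (isClosed_tsupport χ) hV hVc hd
  have hK := isCompact_ball n R
  obtain ⟨B, hB1, hB⟩ := H.exists_reGrad_le hK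
  have hD := H.oscData hK
  have hcut := H.cut_amp_uSmooth hχ
  have h1 : ∀ a : Idx ι, 1 ≤ (a.2 : ℝ) ^ δ := fun a => Real.one_le_rpow a.2.2 H.δ_pos.le
  -- The separation of gradients and frequencies is known only where Im w < ε. This cutoff equals 1
  -- where Im w ≤ ε / 4 and vanishes where Im w ≥ ε / 2.
  set q : Idx ι → Rn n → ℂ := fun a x => ((lowCut (ε / 2) (w a.1 a.2 x).im : ℝ) : ℂ) with hq
  have hqs : USmooth (ball n R) (fun a : Idx ι => (a.2 : ℝ) ^ δ) q :=
    (((hD.phase.clm_comp Complex.imCLM).comp (contDiff_lowCut (ε / 2))).clm_comp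
      Complex.ofRealCLM).mono subset_rfl (fun _ => zero_le_one) h1
  -- the frequencies that are large compared to `λ`
  set β₁ := {p : Idx ι × Rn n // 2 * B * p.1.2 ≤ ‖p.2‖}
  obtain ⟨C₁, hC₁, h₁⟩ := norm_hat_osc_le (α := β₁) hK
    hD.δ_nonneg hD.δ_lt (fun p => hD.one_le p.1.1) (hD.phase.reindex fun p : β₁ => p.1.1)
    (fun p => hD.im_nonneg p.1.1) (hcut.reindex fun p : β₁ => p.1.1)
    (fun p => H.tsupport_cut_amp χ p.1.1) (fun p => p.1.2) (ε := 1 / 4) (by norm_num)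
    (fun p x hx => by
      have hl := p.1.1.2.2
      have h2 := hB p.1.1 x (H.tsupport_cut_amp χ p.1.1 hx)
      -- Here λ|∇ Re w| ≤ λB ≤ |ξ| / 2, and λ ≤ λB as B ≥ 1, so the difference is at least |ξ| / 2 ≥
      -- (λ + |ξ|) / 4.
      have h3 := norm_sub_norm_le p.1.2 ((p.1.1.2 : ℝ) • reGrad (w p.1.1.1 p.1.1.2) x)
      rw [norm_sub_rev, norm_smul, Real.norm_of_nonneg (zero_le_one.trans hl)] at h3
      have h4 := p.2
      have h5 : (p.1.1.2 : ℝ) * ‖reGrad (w p.1.1.1 p.1.1.2) x‖ ≤ p.1.1.2 * B :=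
        mul_le_mul_of_nonneg_left h2 (zero_le_one.trans hl)
      have h6 : (p.1.1.2 : ℝ) * 1 ≤ p.1.1.2 * B :=
        mul_le_mul_of_nonneg_left hB1 (zero_le_one.trans hl)
      linarith) N
  -- the part where `Im w` is small
  set β₂ := {p : Idx ι × Rn n // L ≤ p.1.2 ∧ p.2 ∈ V}
  obtain ⟨C₂, hC₂, h₂⟩ := norm_hat_osc_le (α := β₂) hK
    hD.δ_nonneg hD.δ_lt (fun p => hD.one_le p.1.1) (hD.phase.reindex fun p : β₂ => p.1.1)
    (fun p => hD.im_nonneg p.1.1)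
    (b := fun p x => χ x * amp δ ϱ φ p.1.1 x * q p.1.1 x)
    ((hcut.mul hqs fun a => zero_le_one.trans (h1 a)).reindex fun p : β₂ => p.1.1)
    (fun p => (tsupport_mul_subset_left).trans (H.tsupport_cut_amp χ p.1.1)) (fun p => p.1.2) hε
    (fun p x hx => by
      have hx1 := tsupport_mul_subset_left hx
      refine hsep p.1.1 p.2.1 x ⟨tsupport_amp_subset δ ϱ φ _ (tsupport_mul_subset_right hx1),
        tsupport_mul_subset_left hx1⟩ ?_ p.1.2 p.2.2
      have hx2 := tsupport_mul_subset_right hx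
      have : tsupport (q p.1.1) ⊆ {x | (w p.1.1.1 p.1.1.2 x).im ≤ ε / 2} := by
        refine closure_minimal (fun z hz => ?_) (isClosed_le (Complex.continuous_im.comp
          (H.phase_smooth _ _ p.1.1.2.2).continuous) continuous_const)
        by_contra hz'
        simp only [mem_ofPred_eq, not_le] at hz'
        exact hz (by simp [hq, lowCut_of_ge (half_pos hε) hz'.le])
      have := this hx2
      simp only [mem_ofPred_eq] at this
      linarith) N
  -- the part where `Im w` is not small
  obtain ⟨C₃, hC₃, h₃⟩ := (hcut.add ((hcut.mul hqs fun a => zero_le_one.trans (h1 a)).neg)).norm_le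
  obtain ⟨C₄, hC₄, h₄⟩ := exp_neg_mul_le (t := ε / 4) (by linarith) N
  refine ⟨C₁ + C₂ + C₃ * volume.real (ball n R) * C₄ * (1 + 2 * B) ^ N, by positivity, L, hL,
    fun a ha ξ hξ => ?_⟩
  have hl1 : 1 ≤ (a.2 : ℝ) := a.2.2
  have hl : 0 < (a.2 : ℝ) := one_pos.trans_le a.2.2
  have hn := norm_nonneg ξ
  by_cases hcase : 2 * B * a.2 ≤ ‖ξ‖
  · refine (h₁ ⟨(a, ξ), hcase⟩).trans ?_
    gcongr
    rw [add_assoc]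
    exact le_add_of_nonneg_right (by positivity)
  · push Not at hcase
    have hsplit : osc a.2 (w a.1 a.2) (fun x => χ x * amp δ ϱ φ a x) = fun x =>
        osc a.2 (w a.1 a.2) (fun x => χ x * amp δ ϱ φ a x * q a x) x +
        osc a.2 (w a.1 a.2) (fun x => χ x * amp δ ϱ φ a x +
          -(χ x * amp δ ϱ φ a x * q a x)) x := by
      ext x
      simp only [osc]
      ring
    have ht1 : ∀ a : Idx ι, tsupport (fun x => χ x * amp δ ϱ φ a x * q a x) ⊆ ball n R :=
      fun a => (tsupport_mul_subset_left).trans (H.tsupport_cut_amp χ a)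
    have ht2 : ∀ a : Idx ι, tsupport (fun x => χ x * amp δ ϱ φ a x +
        -(χ x * amp δ ϱ φ a x * q a x)) ⊆ ball n R := fun a => by
      refine (closure_mono fun x hx => ?_).trans (H.tsupport_cut_amp χ a)
      contrapose! hx
      have := Function.notMem_support.mp hx
      simp [this]
    rw [hsplit, hat_add
      (hD.isTest (hcut.mul hqs fun a => zero_le_one.trans (h1 a)) ht1 a).integrable
      (hD.isTest (hcut.add ((hcut.mul hqs fun a => zero_le_one.trans (h1 a)).neg)) ht2
        a).integrable]
    refine (norm_add_le _ _).trans ?_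
    have hb1 := h₂ ⟨(a, ξ), ha, hξ⟩
    have hb2 : ‖hat (osc a.2 (w a.1 a.2) (fun x => χ x * amp δ ϱ φ a x +
        -(χ x * amp δ ϱ φ a x * q a x))) ξ‖ ≤
        Real.exp (-(a.2 * (ε / 4))) * C₃ * volume.real (ball n R) := by
      refine norm_hat_le hK (fun x => ?_) (fun x hx => ?_) ξ
      · by_cases hx : x ∈ ball n R
        · by_cases him : (w a.1 a.2 x).im ≤ ε / 4
          · have : q a x = 1 := by
              simp only [hq]
              rw [lowCut_of_le (half_pos hε) (by linarith)]
              simp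
            simp only [osc, this]
            simp
            positivity
          · push Not at him
            rw [osc, norm_mul]
            refine mul_le_mul ?_ (h₃ a x hx) (norm_nonneg _) (Real.exp_pos _).le
            rw [Complex.norm_exp]
            refine Real.exp_le_exp.mpr ?_
            simp
            exact mul_le_mul_of_nonneg_left him.le hl.le
        · have := image_eq_zero_of_notMem_tsupport fun h => hx (ht2 a h)
          simp only [osc, this]
          simp
          positivity
      · have := image_eq_zero_of_notMem_tsupport fun h => hx (ht2 a h)
        simp only [osc, this]
        simp
    -- In the remaining case |ξ| < 2Bλ, so decay in λ, which is all the exponential provides, is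
    -- also decay in λ + |ξ|.
    have hb3 : ((a.2 : ℝ) ^ N)⁻¹ ≤ (1 + 2 * B) ^ N * (((a.2 : ℝ) + ‖ξ‖) ^ N)⁻¹ := by
      rw [← div_eq_mul_inv, le_div_iff₀ (by positivity), inv_mul_le_iff₀ (by positivity),
        ← mul_pow]
      exact pow_le_pow_left₀ (by positivity) (by linarith) N
    have hb4 : Real.exp (-(a.2 * (ε / 4))) * C₃ * volume.real (ball n R) ≤
        C₃ * volume.real (ball n R) * C₄ * (1 + 2 * B) ^ N * (((a.2 : ℝ) + ‖ξ‖) ^ N)⁻¹ := by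
      calc _ ≤ C₄ * ((1 + 2 * B) ^ N * (((a.2 : ℝ) + ‖ξ‖) ^ N)⁻¹) * C₃ *
            volume.real (ball n R) := by
            gcongr
            refine (h₄ a.2 a.2.2).trans ?_
            gcongr
        _ = _ := by ring
    have hb5 : 0 ≤ C₁ * (((a.2 : ℝ) + ‖ξ‖) ^ N)⁻¹ := by positivity
    calc _ ≤ C₂ * (((a.2 : ℝ) + ‖ξ‖) ^ N)⁻¹ + C₃ * volume.real (ball n R) * C₄ *
          (1 + 2 * B) ^ N * (((a.2 : ℝ) + ‖ξ‖) ^ N)⁻¹ := add_le_add hb1 (hb2.trans hb4)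
      _ ≤ _ := by
          rw [add_mul, add_mul]
          linarith

/-- The factor λ^k and the normalization are absorbed into one integer power, which rapid decay then
beats. -/
theorem scalar_le (k e : ℝ) : ∃ p : ℕ, ∀ lam : ℝ, 1 ≤ lam → lam ^ k * lam ^ e ≤ lam ^ p := by
  obtain ⟨p, hp⟩ := exists_nat_ge (k + e)
  refine ⟨p, fun lam hlam => ?_⟩
  rw [← Real.rpow_add (by linarith), ← Real.rpow_natCast]
  exact Real.rpow_le_rpow_of_exponent_le hlam hp

/-- Convergence to zero in `𝓓'_Γ`. -/
theorem tendstoZeroDGamma (H : OscFamily δ ϱ w φ c i₀ R) (k : ℝ) :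
    TendstoZeroDGamma (oscCone δ w φ) ((⊤ : Filter ι) ×ˢ (atTop : Filter ℝ))
      (fun a x => ((a.2 ^ k : ℝ) : ℂ) * oscSum δ ϱ a.2 (w a.1 a.2) (φ a.1 a.2) x) := by
  obtain ⟨p, hp⟩ := scalar_le k (((n : ℝ) - 1) * δ / 2)
  have hK := isCompact_ball n R
  have hcut : ∀ (χ : Rn n → ℂ) (a : Idx ι) (ξ : Rn n),
      ‖hat (fun x => χ x * ((((a.2 : ℝ) ^ k : ℝ) : ℂ) *
        oscSum δ ϱ a.2 (w a.1 a.2) (φ a.1 a.2) x)) ξ‖ ≤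
      (a.2 : ℝ) ^ p * ‖hat (osc a.2 (w a.1 a.2) (fun x => χ x * amp δ ϱ φ a x)) ξ‖ := by
    intro χ a ξ
    have hl : 0 < (a.2 : ℝ) := one_pos.trans_le a.2.2
    have e : (fun x => χ x * ((((a.2 : ℝ) ^ k : ℝ) : ℂ) *
        oscSum δ ϱ a.2 (w a.1 a.2) (φ a.1 a.2) x)) = fun x =>
        (((a.2 : ℝ) ^ k * (a.2 : ℝ) ^ (((n : ℝ) - 1) * δ / 2) : ℝ) : ℂ) *
          osc a.2 (w a.1 a.2) (fun x => χ x * amp δ ϱ φ a x) x := by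
      ext x
      rw [oscSum_eq]
      simp only [osc]
      push_cast
      ring
    rw [e, hat_const_mul, norm_mul, Complex.norm_real, Real.norm_of_nonneg (by positivity)]
    gcongr
    exact hp _ a.2.2
  refine ⟨?_, fun ψ hψ => ?_, fun χ V hχ hV hVc hd m ε hε => ?_⟩
  · refine eventually_top_prod_atTop.mpr ⟨1, le_rfl, fun s lam hlam => ?_⟩
    have ht := (H.isTest_oscSum (s, ⟨lam, hlam⟩)).const_mul ((lam ^ k : ℝ) : ℂ)
    refine ⟨ht.integrable.locallyIntegrable, ?_⟩
    rw [waveFront_eq_empty ht]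
    exact empty_subset _
  -- The integral against ψ is the transform of ψu at the frequency 0, where the polynomial bound is
  -- λ^{-(p+1)}.
  · obtain ⟨C, hC, h⟩ := norm_hat_osc_le_poly hK H.δ_pos.le H.δ_lt
      (H.oscData hK).one_le (H.oscData hK).phase (H.oscData hK).im_nonneg
      (H.cut_amp_uSmooth hψ.1) (H.tsupport_cut_amp ψ) H.c_pos
      (fun a x _ => H.grad_ge _ _ a.2.2 x) (p + 1)
    rw [Metric.tendsto_nhds]
    intro ε hε
    refine eventually_top_prod_atTop.mpr ⟨max 1 ((C + 1) / ε), le_max_left _ _,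
      fun s lam hlam => ?_⟩
    have hlam1 : 1 ≤ lam := (le_max_left _ _).trans hlam
    have hl : 0 < lam := by linarith
    have h1 := (hcut ψ (s, ⟨lam, hlam1⟩) 0).trans
      (mul_le_mul_of_nonneg_left (h (s, ⟨lam, hlam1⟩) 0) (by positivity))
    have e : hat (fun x => ψ x * (((lam ^ k : ℝ) : ℂ) * oscSum δ ϱ lam (w s lam) (φ s lam) x)) 0 =
        ∫ x, ((lam ^ k : ℝ) : ℂ) * oscSum δ ϱ lam (w s lam) (φ s lam) x * ψ x := by
      simp only [hat, inner_zero_right]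
      congr 1
      ext x
      simp
      ring
    rw [dist_zero_right, ← e]
    refine h1.trans_lt ?_
    simp only [norm_zero, add_zero, one_pow, mul_one]
    have h2 : lam ^ p * (C * (lam ^ (p + 1))⁻¹) = C / lam := by
      rw [pow_succ]; field_simp
    rw [h2, div_lt_iff₀ hl]
    have h3 := (le_max_right _ _).trans hlam
    rw [div_le_iff₀ hε] at h3
    linarith
  -- m powers pay for |ξ|^m, p for the powers of λ in front, and one is left for convergence to 0.
  · obtain ⟨C, hC, L, hL, h⟩ := H.norm_hat_cut_le hχ.1 hV hVc hd (m + p + 1)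
    refine eventually_top_prod_atTop.mpr ⟨max L (C / ε), hL.trans (le_max_left _ _),
      fun s lam hlam ξ hξ => ?_⟩
    have hlamL : L ≤ lam := (le_max_left _ _).trans hlam
    have hlam1 : 1 ≤ lam := hL.trans hlamL
    have hl : 0 < lam := by linarith
    have hn := norm_nonneg ξ
    have h1 := (hcut χ (s, ⟨lam, hlam1⟩) ξ).trans
      (mul_le_mul_of_nonneg_left (h (s, ⟨lam, hlam1⟩) hlamL ξ hξ) (by positivity))
    refine (mul_le_mul_of_nonneg_left h1 (by positivity)).trans ?_
    have h2 : ‖ξ‖ ^ m ≤ (lam + ‖ξ‖) ^ m := pow_le_pow_left₀ hn (by linarith) m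
    have h3 : lam ^ p ≤ (lam + ‖ξ‖) ^ p := pow_le_pow_left₀ hl.le (by linarith) p
    calc ‖ξ‖ ^ m * (lam ^ p * (C * ((lam + ‖ξ‖) ^ (m + p + 1))⁻¹))
        ≤ (lam + ‖ξ‖) ^ m * ((lam + ‖ξ‖) ^ p * (C * ((lam + ‖ξ‖) ^ (m + p + 1))⁻¹)) := by gcongr
      _ = C / (lam + ‖ξ‖) := by rw [pow_succ, pow_add]; field_simp
      _ ≤ C / lam := by gcongr; linarith
      _ ≤ ε := by
          rw [div_le_iff₀ hl]
          have h3 := (le_max_right _ _).trans hlam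
          rw [div_le_iff₀ hε] at h3
          linarith

end OscFamily

end WaveFront

end OscSum
end

open MeasureTheory Filter Topology Set
open scoped ContDiff ENNReal

noncomputable section

namespace OscSum

/-! ### Lower bounds by wave packets -/

section SobolevLower

variable {ι : Type*} {n M : ℕ}

/-- Pairing the Fourier transform of `u` with a wave packet at frequency `λη` and position `x₀`. -/
theorem integral_hat_mul_packet {u g : Rn n → ℂ} (hu : IsTest u) (hg : IsTest g) (x₀ η : Rn n)
    {lam : ℝ} (hlam : 0 < lam) :
    ∫ ξ, hat u ξ * (Complex.exp (Complex.I * ((inner ℝ x₀ ξ : ℝ) : ℂ)) * g (lam⁻¹ • ξ - η)) =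
      ∫ y, u (x₀ + lam⁻¹ • y) *
        (Complex.exp (-Complex.I * ((inner ℝ y η : ℝ) : ℂ)) * hat g y) := by
  set h : Rn n → ℂ := fun ξ =>
    Complex.exp (Complex.I * ((inner ℝ x₀ ξ : ℝ) : ℂ)) * g (lam⁻¹ • ξ - η) with hh
  have hgi : Integrable (fun ξ => g (lam⁻¹ • ξ - η)) := by
    have := hg.integrable.comp_sub_right η
    exact this.comp_smul (inv_ne_zero hlam.ne')
  have hhi : Integrable h := by
    refine hgi.bdd_mul (c := 1) (Continuous.aestronglyMeasurable (by fun_prop))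
      (ae_of_all _ fun ξ => ?_)
    rw [Complex.norm_exp]
    simp
  have hprod : Integrable (fun p : Rn n × Rn n =>
      Complex.exp (-Complex.I * ((inner ℝ p.2 p.1 : ℝ) : ℂ)) * (h p.1 * u p.2))
      (volume.prod volume) := by
    refine (hhi.mul_prod hu.integrable).bdd_mul (c := 1)
      (Continuous.aestronglyMeasurable (by fun_prop)) (ae_of_all _ fun p => ?_)
    rw [Complex.norm_exp]
    simp
  -- The transform of the packet follows from the substitution ξ = λ(ζ + η). Its factor λ^n is
  -- removed at the end by y = λ(x - x₀).
  have hinner : ∀ x, ∫ ξ, Complex.exp (-Complex.I * ((inner ℝ x ξ : ℝ) : ℂ)) * h ξ =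
      ((lam ^ n : ℝ) : ℂ) * (Complex.exp (-Complex.I * ((inner ℝ (lam • (x - x₀)) η : ℝ) : ℂ)) *
        hat g (lam • (x - x₀))) := by
    intro x
    set F : Rn n → ℂ := fun ζ =>
      Complex.exp (-Complex.I * ((inner ℝ (lam • (x - x₀)) (ζ + η) : ℝ) : ℂ)) * g ζ with hF
    have e : (fun ξ => Complex.exp (-Complex.I * ((inner ℝ x ξ : ℝ) : ℂ)) * h ξ) =
        fun ξ => (fun ζ => F (ζ - η)) (lam⁻¹ • ξ) := by
      ext ξ
      simp only [hh, hF, sub_add_cancel]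
      rw [← mul_assoc, ← Complex.exp_add, inner_smul_left, inner_smul_right, inner_sub_left]
      congr 2
      have : (lam : ℂ) ≠ 0 := by exact_mod_cast hlam.ne'
      simp
      field_simp
      ring
    rw [e, Measure.integral_comp_smul volume (fun ζ => F (ζ - η)), integral_sub_right_eq_self, finrank_euclideanSpace,
      Fintype.card_fin, inv_pow, inv_inv, abs_of_nonneg (by positivity), Complex.real_smul, hat]
    congr 1
    rw [← integral_const_mul]
    refine integral_congr_ae (ae_of_all _ fun ζ => ?_)
    simp only [hF]
    rw [inner_add_right, real_inner_comm ζ, ← mul_assoc, ← Complex.exp_add]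
    congr 2
    push_cast
    ring
  have h1 : ∫ ξ, hat u ξ * h ξ = ∫ ξ, ∫ x, Complex.exp (-Complex.I * ((inner ℝ x ξ : ℝ) : ℂ)) *
      (h ξ * u x) := by
    congr 1
    ext ξ
    rw [hat, mul_comm, ← integral_const_mul]
    congr 1
    ext x
    ring
  have h2 : (fun x => ∫ ξ, Complex.exp (-Complex.I * ((inner ℝ x ξ : ℝ) : ℂ)) * (h ξ * u x)) =
      fun x => ((lam ^ n : ℝ) : ℂ) * (fun y => u (x₀ + lam⁻¹ • y) *
        (Complex.exp (-Complex.I * ((inner ℝ y η : ℝ) : ℂ)) * hat g y)) (lam • (x - x₀)) := by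
    ext x
    have : ∀ ξ, Complex.exp (-Complex.I * ((inner ℝ x ξ : ℝ) : ℂ)) * (h ξ * u x) =
      u x * (Complex.exp (-Complex.I * ((inner ℝ x ξ : ℝ) : ℂ)) * h ξ) := fun ξ => by ring
    simp_rw [this]
    rw [integral_const_mul, hinner, inv_smul_smul₀ hlam.ne', add_sub_cancel]
    ring
  rw [h1, integral_integral_swap hprod, h2, integral_const_mul,
    integral_sub_right_eq_self (fun x => (fun y => u (x₀ + lam⁻¹ • y) *
        (Complex.exp (-Complex.I * ((inner ℝ y η : ℝ) : ℂ)) * hat g y)) (lam • x)) x₀,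
    Measure.integral_comp_smul volume (fun y => u (x₀ + lam⁻¹ • y) *
        (Complex.exp (-Complex.I * ((inner ℝ y η : ℝ) : ℂ)) * hat g y)),
    finrank_euclideanSpace, Fintype.card_fin, Complex.real_smul, abs_of_nonneg (by positivity), ← mul_assoc, ← Complex.ofReal_mul,
    mul_inv_cancel₀ (by positivity)]
  simp

theorem exists_rpow_ge {t₁ t₂ : ℝ} (h₁ : 0 < t₁) (p : ℝ) :
    ∃ d : ℝ, 0 < d ∧ ∀ t, t₁ ≤ t → t ≤ t₂ → d ≤ t ^ p := by
  by_cases h₂ : t₁ ≤ t₂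
  · refine ⟨min (t₁ ^ p) (t₂ ^ p), lt_min (Real.rpow_pos_of_pos h₁ _)
      (Real.rpow_pos_of_pos (h₁.trans_le h₂) _), fun t ht1 ht2 => ?_⟩
    rcases le_total 0 p with hp | hp
    · exact (min_le_left _ _).trans (Real.rpow_le_rpow h₁.le ht1 hp)
    · exact (min_le_right _ _).trans
        (Real.rpow_le_rpow_of_nonpos (h₁.trans_le ht1) ht2 hp)
  · exact ⟨1, one_pos, fun t ht1 ht2 => absurd (ht1.trans ht2) h₂⟩

/-- A lower bound for a Sobolev norm by the mean of the Fourier transform against a function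
concentrated on frequencies of size `λ`. -/
theorem wNorm_ge (n : ℕ) {c B : ℝ} (hc : 0 < c) (s : ℝ) :
    ∃ d : ℝ, 0 < d ∧ ∀ (u h : Rn n → ℂ) (η : Rn n) (lam m : ℝ), IsTest u → 1 ≤ lam → c ≤ ‖η‖ →
      ‖η‖ ≤ B → (∀ ξ, ‖h ξ‖ ≤ 1) → (∀ ξ, h ξ ≠ 0 → ‖ξ - lam • η‖ ≤ c / 2 * lam) → 0 ≤ m →
      m ≤ ‖∫ ξ, hat u ξ * h ξ‖ →
      ENNReal.ofReal (d * m * lam ^ (s - n / 2)) ≤ wNorm s u := by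
  obtain ⟨d, hd, hdt⟩ := exists_rpow_ge (t₁ := (c / 2) ^ 2) (t₂ := 1 + (B + c / 2) ^ 2)
    (by positivity) (s / 2)
  set v₁ : ℝ := volume.real (Metric.ball (0 : Rn n) 1) with hv₁
  have hv₁0 : 0 < v₁ := ENNReal.toReal_pos (Metric.measure_ball_pos _ _ one_pos).ne'
    measure_ball_lt_top.ne
  set v : ℝ := √((c / 2) ^ n * v₁) with hv
  have hv0 : 0 < v := Real.sqrt_pos.mpr (by positivity)
  refine ⟨d / v, by positivity, fun u h η lam m hu hlam hη1 hη2 h1 hsup hm0 hm => ?_⟩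
  have hl : 0 < lam := by linarith
  -- Cauchy-Schwarz on this ball costs the square root of its volume, a constant times λ^{n/2},
  -- which explains the exponent s - n / 2.
  set S := Metric.closedBall (lam • η) (c / 2 * lam) with hS
  have hSm : MeasurableSet S := measurableSet_closedBall
  have hvolS : volume S ^ (1 / 2 : ℝ) = ENNReal.ofReal (v * lam ^ ((n : ℝ) / 2)) := by
    rw [hS, Measure.addHaar_closedBall _ _ (by positivity), finrank_euclideanSpace,
      Fintype.card_fin, ← ENNReal.ofReal_toReal (measure_ball_lt_top (x := (0 : Rn n))).ne,
      ← ENNReal.ofReal_mul (by positivity),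
      ENNReal.ofReal_rpow_of_nonneg (by positivity) (by norm_num)]
    congr 1
    have e : (c / 2 * lam) ^ n * (volume (Metric.ball (0 : Rn n) 1)).toReal =
        ((c / 2) ^ n * v₁) * lam ^ n := by
      rw [mul_pow, hv₁, Measure.real]; ring
    rw [e, Real.mul_rpow (by positivity) (by positivity), hv, Real.sqrt_eq_rpow,
      ← Real.rpow_natCast lam n, ← Real.rpow_mul hl.le]
    congr 2
    ring
  have hI : ENNReal.ofReal m ≤ eLpNorm (hat u) 2 (volume.restrict S) *
      ENNReal.ofReal (v * lam ^ ((n : ℝ) / 2)) := by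
    calc ENNReal.ofReal m ≤ ‖∫ ξ, hat u ξ * h ξ‖ₑ := by
          rw [← ofReal_norm]; exact ENNReal.ofReal_le_ofReal hm
      _ = ‖∫ ξ in S, hat u ξ * h ξ‖ₑ := by
          rw [setIntegral_eq_integral_of_forall_compl_eq_zero]
          intro ξ hξ
          by_contra h0
          exact hξ (by simpa [hS, dist_eq_norm] using hsup ξ (right_ne_zero_of_mul h0))
      _ ≤ ∫⁻ ξ in S, ‖hat u ξ * h ξ‖ₑ := enorm_integral_le_lintegral_enorm _
      _ ≤ ∫⁻ ξ in S, ‖hat u ξ‖ₑ := by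
          refine lintegral_mono fun ξ => ?_
          rw [enorm_mul]
          refine mul_le_of_le_one_right' ?_
          rw [← ofReal_norm]
          exact ENNReal.ofReal_le_one.mpr (h1 ξ)
      _ = eLpNorm (hat u) 1 (volume.restrict S) := eLpNorm_one_eq_lintegral_enorm.symm
      _ ≤ _ := by
          have := eLpNorm_le_eLpNorm_mul_rpow_measure_univ (μ := volume.restrict S) (p := 1)
            (q := 2) one_le_two (f := hat u) (continuous_hat hu).aestronglyMeasurable
          refine this.trans (le_of_eq ?_)
          rw [Measure.restrict_apply_univ, ← hvolS]
          norm_num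
  have hW : ENNReal.ofReal (d * lam ^ s) * eLpNorm (hat u) 2 (volume.restrict S) ≤ wNorm s u := by
    have hpos : 0 ≤ d * lam ^ s := by positivity
    rw [← Real.enorm_of_nonneg hpos, ← eLpNorm_const_smul, wNorm]
    refine le_trans ?_ (eLpNorm_restrict_le _ _ _ S)
    refine eLpNorm_mono_ae ((ae_restrict_iff' hSm).mpr (ae_of_all _ fun ξ hξ => ?_))
    rw [Pi.smul_apply, norm_smul, Real.norm_of_nonneg hpos, norm_mul, Complex.norm_real,
      Real.norm_of_nonneg (by positivity)]
    gcongr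
    have hξ' : ‖ξ - lam • η‖ ≤ c / 2 * lam := by simpa [hS, dist_eq_norm] using hξ
    have hη : ‖lam • η‖ = lam * ‖η‖ := by rw [norm_smul, Real.norm_of_nonneg hl.le]
    have h2 := norm_sub_norm_le ξ (lam • η)
    have h3 := norm_sub_norm_le (lam • η) ξ
    rw [norm_sub_rev] at h3
    have h4 : c / 2 * lam ≤ ‖ξ‖ := by nlinarith
    have h5 : ‖ξ‖ ≤ (B + c / 2) * lam := by nlinarith
    have e : 1 + ‖ξ‖ ^ 2 = lam ^ 2 * ((1 + ‖ξ‖ ^ 2) / lam ^ 2) := by field_simp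
    rw [e, Real.mul_rpow (by positivity) (by positivity), ← Real.rpow_natCast lam 2,
      ← Real.rpow_mul hl.le, mul_comm]
    have e2 : ((2 : ℕ) : ℝ) * (s / 2) = s := by push_cast; ring
    rw [e2]
    gcongr
    rw [Real.rpow_natCast]
    refine hdt _ ?_ ?_
    · rw [le_div_iff₀ (by positivity)]
      have := pow_le_pow_left₀ (by positivity) h4 2
      nlinarith
    · rw [div_le_iff₀ (by positivity)]
      have := pow_le_pow_left₀ (norm_nonneg _) h5 2
      nlinarith [one_le_pow₀ hlam (n := 2)]
  have hfin : 0 < v * lam ^ ((n : ℝ) / 2) := by positivity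
  have e : d / v * m * lam ^ (s - n / 2) = d * lam ^ s * m / (v * lam ^ ((n : ℝ) / 2)) := by
    rw [Real.rpow_sub hl]
    field_simp
  rw [e, ENNReal.ofReal_div_of_pos hfin, ENNReal.div_le_iff (by simpa using hfin) (by simp),
    ENNReal.ofReal_mul (by positivity)]
  calc _ ≤ ENNReal.ofReal (d * lam ^ s) * (eLpNorm (hat u) 2 (volume.restrict S) *
        ENNReal.ofReal (v * lam ^ ((n : ℝ) / 2))) := by gcongr
    _ ≤ _ := by rw [← mul_assoc]; gcongr

/-- The derivative of exp has modulus at most 1 on the closed left half-plane, which is convex. The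
condition Im w ≥ 0 places all exponents there. -/
theorem norm_exp_sub_exp_le {z z' : ℂ} (hz : z.re ≤ 0) (hz' : z'.re ≤ 0) :
    ‖Complex.exp z - Complex.exp z'‖ ≤ ‖z - z'‖ := by
  have := (convex_halfSpace_re_le 0).norm_image_sub_le_of_norm_deriv_le (𝕜 := ℂ)
    (f := Complex.exp) (C := 1) (fun x _ => Complex.differentiableAt_exp)
    (fun x hx => by
      rw [Complex.deriv_exp, Complex.norm_exp, Real.exp_le_one_iff]; exact hx) hz' hz
  simpa using this

/-- The first order Taylor expansion, uniformly in a family. -/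
theorem USmooth.taylor {α : Type*} {K : Set (Rn n)} (hK : Convex ℝ K) {W : α → Rn n → ℂ}
    (hW : USmooth K (fun _ => 1) W) :
    ∃ B : ℝ, 0 ≤ B ∧ ∀ a, ∀ x ∈ K, ∀ y ∈ K,
      ‖W a y - W a x - _root_.fderiv ℝ (W a) x (y - x)‖ ≤ B * ‖y - x‖ ^ 2 := by
  obtain ⟨B, hB, h⟩ := hW.bound 2
  refine ⟨B, hB, fun a x hx y hy => ?_⟩
  have hd2 : ContDiff ℝ ∞ (_root_.fderiv ℝ (W a)) := (hW.smooth a).fderiv_right (by simp)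
  have h2 : ∀ z ∈ K, ‖_root_.fderiv ℝ (_root_.fderiv ℝ (W a)) z‖ ≤ B := fun z hz => by
    have := h a z hz
    rw [one_pow, mul_one] at this
    rwa [← norm_iteratedFDeriv_zero (𝕜 := ℝ) (f := _root_.fderiv ℝ (_root_.fderiv ℝ (W a))),
      norm_iteratedFDeriv_fderiv, norm_iteratedFDeriv_fderiv]
  have hseg : segment ℝ x y ⊆ K := hK.segment_subset hx hy
  have h1 : ∀ z ∈ segment ℝ x y, ‖_root_.fderiv ℝ (W a) z - _root_.fderiv ℝ (W a) x‖ ≤ B * ‖y - x‖ := by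
    intro z hz
    refine (hK.norm_image_sub_le_of_norm_fderiv_le (𝕜 := ℝ)
      (fun p _ => hd2.differentiable (by simp) p) h2 hx (hseg hz)).trans ?_
    gcongr
    obtain ⟨t, ⟨ht0, ht1⟩, rfl⟩ := (segment_eq_image' ℝ x y ▸ hz)
    rw [add_sub_cancel_left, norm_smul, Real.norm_of_nonneg ht0]
    exact mul_le_of_le_one_left (norm_nonneg _) ht1
  have := (convex_segment x y).norm_image_sub_le_of_norm_fderiv_le' (𝕜 := ℝ) (f := W a)
    (fun p _ => (hW.smooth a).differentiable (by simp) p) h1 (left_mem_segment ℝ x y)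
    (right_mem_segment ℝ x y)
  refine this.trans (le_of_eq (by ring))

theorem USmooth.lipschitz {α : Type*} {K : Set (Rn n)} (hK : Convex ℝ K) {μ : α → ℝ}
    {b : α → Rn n → ℂ} (hb : USmooth K μ b) :
    ∃ B : ℝ, 0 ≤ B ∧ ∀ a, ∀ x ∈ K, ∀ y ∈ K, ‖b a y - b a x‖ ≤ B * μ a * ‖y - x‖ := by
  obtain ⟨B, hB, h⟩ := hb.bound 1
  refine ⟨B, hB, fun a x hx y hy => ?_⟩
  refine hK.norm_image_sub_le_of_norm_fderiv_le (𝕜 := ℝ)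
      (fun p _ => (hb.smooth a).differentiable (by simp) p) (fun z hz => ?_) hx hy
  have := h a z hz
  rw [pow_one] at this
  rwa [← norm_iteratedFDeriv_zero (𝕜 := ℝ) (f := _root_.fderiv ℝ (b a)), norm_iteratedFDeriv_fderiv]

/-- At a zero of a nonnegative imaginary part the differential is real. -/
theorem fderiv_eq_inner_reGrad {w : Rn n → ℂ} (hw : ContDiff ℝ ∞ w) (him : ∀ x, 0 ≤ (w x).im)
    {x : Rn n} (hx : (w x).im = 0) (v : Rn n) :
    fderiv ℝ w x v = ((inner ℝ v (reGrad w x) : ℝ) : ℂ) := by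
  have hd := (hw.differentiable (by simp) x).hasFDerivAt
  have h1 : HasFDerivAt (fun y => (w y).re) (Complex.reCLM.comp (fderiv ℝ w x)) x :=
    Complex.reCLM.hasFDerivAt.comp x hd
  have h2 : HasFDerivAt (fun y => (w y).im) (Complex.imCLM.comp (fderiv ℝ w x)) x :=
    Complex.imCLM.hasFDerivAt.comp x hd
  have h3 : IsLocalMin (fun y => (w y).im) x :=
    Eventually.of_forall fun y => hx.trans_le (him y)
  have h4 := h3.hasFDerivAt_eq_zero h2
  apply Complex.ext
  · rw [Complex.ofReal_re, real_inner_comm, reGrad, gradient,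
      InnerProductSpace.toDual_symm_apply, h1.fderiv]
    rfl
  · rw [Complex.ofReal_im]
    exact DFunLike.congr_fun h4 v

namespace OscFamily

variable {δ ϱ : ℝ} {w : ι → ℝ → Rn n → ℂ} {φ : ι → ℝ → Fin (M + 1) → Rn n → ℂ}
  {c : ℝ} {i₀ : Fin n} {R : ℝ}

/-- On the scale `1 / λ` around a real point, the oscillatory function is a plane wave. -/
theorem norm_osc_sub_planeWave_le (H : OscFamily δ ϱ w φ c i₀ R) :
    ∃ C : ℝ, 0 ≤ C ∧ ∀ (a : Idx ι) (x₀ : Rn n), ‖x₀‖ ≤ n * |R| → (w a.1 a.2 x₀).im = 0 →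
      ∀ y, ‖osc a.2 (w a.1 a.2) (amp δ ϱ φ a) (x₀ + (a.2 : ℝ)⁻¹ • y) *
          Complex.exp (-Complex.I * ((inner ℝ y (reGrad (w a.1 a.2) x₀) : ℝ) : ℂ)) -
        osc a.2 (w a.1 a.2) (amp δ ϱ φ a) x₀‖ ≤ C * (a.2 : ℝ) ^ (δ - 1) * (1 + ‖y‖) ^ 2 := by
  have hK := isCompact_ball n R
  have hD := H.oscData hK
  have hconv : Convex ℝ (ball n R) := convex_closedBall _ _
  obtain ⟨B₁, hB₁, h₁⟩ := hD.phase.taylor hconv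
  obtain ⟨B₂, hB₂, h₂⟩ := (H.amp_uSmooth (ball n R)).lipschitz hconv
  obtain ⟨B₃, hB₃, h₃⟩ := (H.amp_uSmooth (ball n R)).norm_le
  have hall : ∀ a x, ‖osc (a.2 : ℝ) (w a.1 a.2) (amp δ ϱ φ a) x‖ ≤ B₃ := fun a x => by
    refine (norm_osc_le hD.one_le hD.im_nonneg H.tsupport_amp_subset_ball a x).trans ?_
    by_cases hx : x ∈ ball n R
    · exact h₃ a x hx
    · rw [image_eq_zero_of_notMem_tsupport fun h => hx (H.tsupport_amp_subset_ball a h)]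
      simpa using hB₃
  refine ⟨B₂ + B₁ * B₃ + 2 * B₃, by positivity, fun a x₀ hx₀ him y => ?_⟩
  have hl1 : 1 ≤ (a.2 : ℝ) := a.2.2
  set l : ℝ := (a.2 : ℝ) with hl
  have hl0 : 0 < l := by linarith
  set η := reGrad (w a.1 l) x₀ with hη
  have hE : ∀ t : ℝ, ‖Complex.exp (-Complex.I * (t : ℂ))‖ = 1 := fun t => by
    rw [Complex.norm_exp]; simp
  have hy := norm_nonneg y
  have hinv : l⁻¹ ≤ l ^ (δ - 1) := by
    rw [← Real.rpow_neg_one]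
    exact Real.rpow_le_rpow_of_exponent_le hl1 (by linarith [H.δ_pos])
  have hpos : 0 ≤ l ^ (δ - 1) := by positivity
  -- For |y| ≤ λ the point x₀ + y / λ is within distance 1 of x₀ and Taylor's formula applies. For
  -- larger y the growth of (1 + |y|)² makes the trivial bound sufficient.
  by_cases hyl : ‖y‖ ≤ l
  · set x := x₀ + l⁻¹ • y with hx
    have hxx : x - x₀ = l⁻¹ • y := by simp [hx]
    have hnx : ‖x - x₀‖ = l⁻¹ * ‖y‖ := by
      rw [hxx, norm_smul, norm_inv, Real.norm_of_nonneg hl0.le]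
    have hx0K : x₀ ∈ ball n R := by
      simp only [ball, mem_closedBall_zero_iff]
      linarith
    -- The summand 1 in the radius of `ball` leaves the room needed here.
    have hxK : x ∈ ball n R := by
      simp only [ball, mem_closedBall_zero_iff]
      have h1 : ‖x - x₀‖ ≤ 1 := by rw [hnx, inv_mul_le_iff₀ hl0]; linarith
      have h2 := norm_sub_norm_le x x₀
      linarith
    have hT := h₁ a x₀ hx0K x hxK
    rw [fderiv_eq_inner_reGrad (H.phase_smooth _ _ a.2.2) (H.im_nonneg _ _ a.2.2) him] at hT
    have hLp := h₂ a x₀ hx0K x hxK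
    set z : ℂ := Complex.I * (l : ℂ) * w a.1 l x + -Complex.I * ((inner ℝ y η : ℝ) : ℂ) with hz
    set z' : ℂ := Complex.I * (l : ℂ) * w a.1 l x₀ with hz'
    have hzre : z.re ≤ 0 := by
      have := mul_nonneg hl0.le (H.im_nonneg a.1 a.2 a.2.2 x)
      simp [hz]
      exact this
    have hzre' : z'.re ≤ 0 := by simp [hz', him]
    -- The plane wave removes the linear term exactly, because the differential at x₀ is real. The
    -- quadratic error is λ · O(|y / λ|²).
    have hzz : ‖z - z'‖ ≤ B₁ * l⁻¹ * ‖y‖ ^ 2 := by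
      have e : z - z' = Complex.I * (l : ℂ) * (w a.1 l x - w a.1 l x₀ -
          ((inner ℝ (x - x₀) η : ℝ) : ℂ)) := by
        rw [hxx, inner_smul_left]
        simp only [hz, hz']
        have : (l : ℂ) ≠ 0 := by exact_mod_cast hl0.ne'
        simp
        field_simp
        ring
      rw [e, norm_mul, norm_mul, Complex.norm_I, one_mul, Complex.norm_real,
        Real.norm_of_nonneg hl0.le]
      refine (mul_le_mul_of_nonneg_left hT hl0.le).trans (le_of_eq ?_)
      rw [hnx]
      field_simp
    have e : osc l (w a.1 l) (amp δ ϱ φ a) x * Complex.exp (-Complex.I * ((inner ℝ y η : ℝ) : ℂ)) -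
        osc l (w a.1 l) (amp δ ϱ φ a) x₀ = Complex.exp z * (amp δ ϱ φ a x - amp δ ϱ φ a x₀) +
          (Complex.exp z - Complex.exp z') * amp δ ϱ φ a x₀ := by
      simp only [osc, hz, hz', Complex.exp_add]
      ring
    rw [e]
    have hez : ‖Complex.exp z‖ ≤ 1 := by rw [Complex.norm_exp]; exact Real.exp_le_one_iff.mpr hzre
    have hb1 : ‖Complex.exp z * (amp δ ϱ φ a x - amp δ ϱ φ a x₀)‖ ≤
        B₂ * l ^ (δ - 1) * ‖y‖ := by
      rw [norm_mul]
      refine (mul_le_of_le_one_left (norm_nonneg _) hez).trans (hLp.trans (le_of_eq ?_))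
      rw [hnx, Real.rpow_sub_one hl0.ne', ← hl]
      field_simp
    have hb2 : ‖(Complex.exp z - Complex.exp z') * amp δ ϱ φ a x₀‖ ≤
        B₁ * l ^ (δ - 1) * ‖y‖ ^ 2 * B₃ := by
      rw [norm_mul]
      refine mul_le_mul ((norm_exp_sub_exp_le hzre hzre').trans (hzz.trans ?_)) (h₃ a x₀ hx0K)
        (norm_nonneg _) (by positivity)
      gcongr
    refine (norm_add_le _ _).trans ((add_le_add hb1 hb2).trans ?_)
    have h5 : ‖y‖ ≤ (1 + ‖y‖) ^ 2 := by nlinarith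
    have h6 : ‖y‖ ^ 2 ≤ (1 + ‖y‖) ^ 2 := by nlinarith
    calc _ ≤ B₂ * l ^ (δ - 1) * (1 + ‖y‖) ^ 2 + B₁ * l ^ (δ - 1) * (1 + ‖y‖) ^ 2 * B₃ := by
          gcongr
      _ ≤ _ := by
          have : 0 ≤ 2 * B₃ * l ^ (δ - 1) * (1 + ‖y‖) ^ 2 := by positivity
          linarith
  · push Not at hyl
    -- δ > 0 gives λ^{δ-1} ≥ λ^{-1}, and (1 + |y|)² ≥ λ since |y| > λ ≥ 1.
    have h4 : 1 ≤ l ^ (δ - 1) * (1 + ‖y‖) ^ 2 := by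
      calc (1 : ℝ) = l⁻¹ * l := (inv_mul_cancel₀ hl0.ne').symm
        _ ≤ l ^ (δ - 1) * (1 + ‖y‖) ^ 2 := by
            gcongr
            nlinarith
    refine (norm_sub_le _ _).trans ?_
    rw [norm_mul, hE, mul_one]
    have h5 := hall a (x₀ + l⁻¹ • y)
    have h6 := hall a x₀
    have h7 : 0 ≤ B₂ + B₁ * B₃ := by positivity
    rw [mul_assoc]
    nlinarith

/-- The leading amplitude dominates. -/
theorem norm_amp_ge (H : OscFamily δ ϱ w φ c i₀ R) :
    ∃ C : ℝ, 0 ≤ C ∧ ∀ (a : Idx ι) (x : Rn n),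
      ‖φ a.1 a.2 0 ((a.2 : ℝ) ^ δ • x)‖ - C * (a.2 : ℝ) ^ (-ϱ) ≤ ‖amp δ ϱ φ a x‖ := by
  obtain ⟨B, hB⟩ := H.amp_bound 0
  refine ⟨M * max B 0, by positivity, fun a x => ?_⟩
  have hl1 : 1 ≤ (a.2 : ℝ) := a.2.2
  have hl0 : 0 < (a.2 : ℝ) := by linarith
  rw [amp, Fin.sum_univ_succ]
  simp only [Fin.val_zero, Nat.cast_zero, neg_zero, zero_mul, Real.rpow_zero, Complex.ofReal_one,
    mul_one]
  have hrest : ‖∑ j : Fin M, φ a.1 a.2 j.succ ((a.2 : ℝ) ^ δ • x) *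
      ((((a.2 : ℝ) ^ (-((j.succ : ℕ) : ℝ) * ϱ) : ℝ)) : ℂ)‖ ≤
      M * max B 0 * (a.2 : ℝ) ^ (-ϱ) := by
    refine (norm_sum_le _ _).trans ?_
    calc _ ≤ ∑ _j : Fin M, max B 0 * (a.2 : ℝ) ^ (-ϱ) := by
          refine Finset.sum_le_sum fun j _ => ?_
          rw [norm_mul, Complex.norm_real, Real.norm_of_nonneg (by positivity)]
          have h1 := hB a.1 a.2 a.2.2 j.succ ((a.2 : ℝ) ^ δ • x)
          rw [norm_iteratedFDeriv_zero] at h1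
          refine mul_le_mul (h1.trans (le_max_left _ _))
            (Real.rpow_le_rpow_of_exponent_le hl1 ?_) (by positivity) (le_max_right _ _)
          have := H.ϱ_pos
          have : (0 : ℝ) ≤ (j : ℕ) * ϱ := by positivity
          rw [Fin.val_succ]
          push_cast
          linarith
      _ = _ := by simp; ring
  have := norm_sub_norm_le (φ a.1 a.2 0 ((a.2 : ℝ) ^ δ • x)) (-∑ j : Fin M,
    φ a.1 a.2 j.succ ((a.2 : ℝ) ^ δ • x) *
      ((((a.2 : ℝ) ^ (-((j.succ : ℕ) : ℝ) * ϱ) : ℝ)) : ℂ))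
  rw [norm_neg, sub_neg_eq_add] at this
  linarith

/-- The lower bound for the Sobolev norms. -/
theorem sobolevNorm_ge (H : OscFamily δ ϱ w φ c i₀ R) (κ : ℝ) (x₀ : ι → Rn n) (hκ : 0 < κ)
    (hx₀ : ∀ s, ∀ lam : ℝ, 1 ≤ lam →
      κ ≤ ‖φ s lam 0 (lam ^ δ • x₀ s)‖ ∧ (w s lam (x₀ s)).im = 0) :
    ∃ lam₀ : ℝ, 1 ≤ lam₀ ∧ ∀ N : ℤ, ∃ c' : ℝ, 0 < c' ∧ ∀ s, ∀ lam : ℝ, lam₀ ≤ lam →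
      ENNReal.ofReal (c' * lam ^ (-(N : ℝ) - (n : ℝ) / 2 + ((n : ℝ) - 1) * δ / 2)) ≤
        sobolevNorm (-(N : ℝ)) (oscSum δ ϱ lam (w s lam) (φ s lam)) := by
  have hK := isCompact_ball n R
  have hD := H.oscData hK
  have hc := H.c_pos
  obtain ⟨B, -, hB⟩ := H.exists_reGrad_le hK
  obtain ⟨C₁, hC₁, h₁⟩ := H.norm_osc_sub_planeWave_le
  obtain ⟨C₂, hC₂, h₂⟩ := H.norm_amp_ge
  -- The outer radius c / 2, compared with |η| ≥ c, keeps the frequencies of the packet at distance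
  -- at least cλ / 2 from 0.
  let f : ContDiffBump (0 : Rn n) := ⟨c / 4, c / 2, by linarith, by linarith⟩
  set g : Rn n → ℂ := fun x => (f x : ℂ) with hg
  have hgt : IsTest g := ⟨Complex.ofRealCLM.contDiff.comp f.contDiff,
    f.hasCompactSupport.comp_left (g := fun t : ℝ => (t : ℂ)) (by simp)⟩
  have hg0 : g 0 = 1 := by
    simp [hg, f.one_of_mem_closedBall (Metric.mem_closedBall_self f.rIn_pos.le)]
  have hint := integral_hat hgt.toSchwartz
  rw [hgt.coe_toSchwartz, hg0, mul_one] at hint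
  have hGi : Integrable (hat g) := by
    rw [← hgt.coe_toSchwartz, ← coe_hatS]; exact SchwartzMap.integrable _
  have hGd : Integrable (fun y => (1 + ‖y‖) ^ 2 * ‖hat g y‖) := by
    have h := fun k => (hatS hgt.toSchwartz).integrable_pow_mul volume k
    rw [coe_hatS, hgt.coe_toSchwartz] at h
    refine (((h 0).add ((h 1).const_mul 2)).add (h 2)).congr (ae_of_all _ fun y => ?_)
    simp
    ring
  set J : ℝ := ∫ y, (1 + ‖y‖) ^ 2 * ‖hat g y‖ with hJ
  have hJ0 : 0 ≤ J := integral_nonneg fun y => by positivity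
  set P : ℝ := (2 * Real.pi) ^ n with hP
  have hP0 : 0 < P := by positivity
  -- the pairing with the wave packet is bounded from below
  have hlim : Tendsto (fun lam : ℝ => (κ - C₂ * lam ^ (-ϱ)) * P - C₁ * lam ^ (δ - 1) * J) atTop
      (𝓝 ((κ - C₂ * 0) * P - C₁ * 0 * J)) := by
    refine ((tendsto_const_nhds.sub ((tendsto_rpow_neg_atTop H.ϱ_pos).const_mul _)).mul_const
      _).sub (Tendsto.mul_const _ (Tendsto.const_mul _ ?_))
    have := tendsto_rpow_neg_atTop (y := 1 - δ) (by linarith [H.δ_lt])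
    simpa using this
  have hev := hlim.eventually (lt_mem_nhds (show κ * P / 2 < _ by nlinarith [mul_pos hκ hP0]))
  obtain ⟨L, hL⟩ := eventually_atTop.mp hev
  -- The bound on the pairing does not involve N, so the threshold can be fixed before N is chosen.
  refine ⟨max L 1, le_max_right _ _, fun N => ?_⟩
  obtain ⟨d, hd, hdw⟩ := wNorm_ge n (B := B) hc (-(N : ℝ))
  refine ⟨(2 * Real.pi) ^ (-(n : ℝ) / 2) * (d * (κ * P / 2)), by positivity,
    fun s lam hlam => ?_⟩
  have hlam1 : 1 ≤ lam := (le_max_right _ _).trans hlam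
  have hl : 0 < lam := by linarith
  set a : Idx ι := (s, ⟨lam, hlam1⟩) with ha
  obtain ⟨hκa, him⟩ := hx₀ s lam hlam1
  have hxbox : x₀ s ∈ box δ i₀ R lam := H.mem_box_of_ne_zero a 0 (x := x₀ s) (by
    intro h0
    rw [h0, norm_zero] at hκa
    linarith)
  have hxn := norm_le_of_mem_box H.δ_pos.le hlam1 hxbox
  have hxK : x₀ s ∈ ball n R := box_subset_ball H.δ_pos.le hlam1 hxbox
  set η := reGrad (w s lam) (x₀ s) with hη
  set u := osc lam (w s lam) (amp δ ϱ φ a) with hu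
  have hut : IsTest u := hD.isTest (H.amp_uSmooth _) H.tsupport_amp_subset_ball a
  set h : Rn n → ℂ := fun ξ =>
    Complex.exp (Complex.I * ((inner ℝ (x₀ s) ξ : ℝ) : ℂ)) * g (lam⁻¹ • ξ - η) with hh
  -- On the scale 1 / λ the pairing is u(x₀) ∫ ĝ = (2π)^n u(x₀) up to an error. The modulus of u(x₀)
  -- is that of the amplitude, since Im w = 0 there.
  have hm : κ * P / 2 ≤ ‖∫ ξ, hat u ξ * h ξ‖ := by
    rw [integral_hat_mul_packet hut hgt (x₀ s) η hl]
    have h3 : ∀ y, ‖u (x₀ s + lam⁻¹ • y) * (Complex.exp (-Complex.I * ((inner ℝ y η : ℝ) : ℂ)) *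
        hat g y) - u (x₀ s) * hat g y‖ ≤ C₁ * lam ^ (δ - 1) * ((1 + ‖y‖) ^ 2 * ‖hat g y‖) := by
      intro y
      have := h₁ a (x₀ s) hxn him y
      have e : u (x₀ s + lam⁻¹ • y) * (Complex.exp (-Complex.I * ((inner ℝ y η : ℝ) : ℂ)) *
          hat g y) - u (x₀ s) * hat g y = (u (x₀ s + lam⁻¹ • y) *
            Complex.exp (-Complex.I * ((inner ℝ y η : ℝ) : ℂ)) - u (x₀ s)) * hat g y := by ring
      rw [e, norm_mul, ← mul_assoc]
      exact mul_le_mul_of_nonneg_right this (norm_nonneg _)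
    have hi2 : Integrable (fun y => u (x₀ s) * hat g y) := hGi.const_mul _
    have hi3 : Integrable (fun y => u (x₀ s + lam⁻¹ • y) *
        (Complex.exp (-Complex.I * ((inner ℝ y η : ℝ) : ℂ)) * hat g y) - u (x₀ s) * hat g y) := by
      refine (hGd.const_mul (C₁ * lam ^ (δ - 1))).mono' ?_ (ae_of_all _ h3)
      have hc1 : Continuous u := hut.1.continuous
      have hc2 : Continuous (hat g) := continuous_hat hgt
      exact Continuous.aestronglyMeasurable (by fun_prop)
    have h4 : ‖∫ y, (u (x₀ s + lam⁻¹ • y) * (Complex.exp (-Complex.I *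
        ((inner ℝ y η : ℝ) : ℂ)) * hat g y) - u (x₀ s) * hat g y)‖ ≤ C₁ * lam ^ (δ - 1) * J := by
      rw [hJ, ← integral_const_mul]
      exact norm_integral_le_of_norm_le (hGd.const_mul _) (ae_of_all _ h3)
    have h5 : ∫ y, u (x₀ s + lam⁻¹ • y) *
        (Complex.exp (-Complex.I * ((inner ℝ y η : ℝ) : ℂ)) * hat g y) =
        (∫ y, (u (x₀ s + lam⁻¹ • y) * (Complex.exp (-Complex.I * ((inner ℝ y η : ℝ) : ℂ)) *
          hat g y) - u (x₀ s) * hat g y)) + u (x₀ s) * (P : ℂ) := by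
      rw [← hint, ← integral_const_mul, ← integral_add hi3 hi2]
      simp
    have h6 : ‖u (x₀ s) * (P : ℂ)‖ = ‖amp δ ϱ φ a (x₀ s)‖ * P := by
      rw [norm_mul, Complex.norm_real, Real.norm_of_nonneg hP0.le, hu, osc, norm_mul,
        Complex.norm_exp]
      simp [him]
    have h7 := h₂ a (x₀ s)
    have h8 := hL lam ((le_max_left _ _).trans hlam)
    rw [h5]
    have h9 := norm_sub_norm_le (u (x₀ s) * (P : ℂ)) (-∫ y, (u (x₀ s + lam⁻¹ • y) *
      (Complex.exp (-Complex.I * ((inner ℝ y η : ℝ) : ℂ)) * hat g y) - u (x₀ s) * hat g y))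
    rw [norm_neg, sub_neg_eq_add, h6, add_comm (u (x₀ s) * (P : ℂ))] at h9
    have h10 : (κ - C₂ * lam ^ (-ϱ)) * P ≤ ‖amp δ ϱ φ a (x₀ s)‖ * P := by
      refine mul_le_mul_of_nonneg_right ?_ hP0.le
      exact (sub_le_sub_right hκa _).trans h7
    linarith
  have hw := hdw u h η lam (κ * P / 2) hut hlam1 (H.grad_ge s lam hlam1 _) (hB a _ hxK)
    (fun ξ => by
      rw [hh, norm_mul, Complex.norm_exp]
      simp only [hg, Complex.norm_real, Real.norm_of_nonneg f.nonneg]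
      simpa using f.le_one)
    (fun ξ hξ => by
      have h0 : f (lam⁻¹ • ξ - η) ≠ 0 := fun h0 => hξ (by simp [hh, hg, h0])
      have h1 : lam⁻¹ • ξ - η ∈ Metric.ball (0 : Rn n) (c / 2) := f.support_eq ▸ h0
      rw [mem_ball_zero_iff] at h1
      have e : ξ - lam • η = lam • (lam⁻¹ • ξ - η) := by rw [smul_sub, smul_inv_smul₀ hl.ne']
      rw [e, norm_smul, Real.norm_of_nonneg hl.le, mul_comm]
      gcongr) (by positivity) hm
  have e : oscSum δ ϱ lam (w s lam) (φ s lam) = fun x =>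
      ((lam ^ (((n : ℝ) - 1) * δ / 2) : ℝ) : ℂ) * u x := by
    ext x
    exact oscSum_eq δ ϱ w φ a x
  rw [e, sobolevNorm_const_mul, ← ofReal_norm, Complex.norm_real,
    Real.norm_of_nonneg (by positivity), sobolevNorm]
  rw [wNorm] at hw
  refine le_trans (le_of_eq ?_) (mul_le_mul_right (mul_le_mul_right hw _) _)
  rw [← ENNReal.ofReal_mul (by positivity), ← ENNReal.ofReal_mul (by positivity)]
  congr 1
  rw [Real.rpow_add hl]
  ring

end OscFamily

end SobolevLower

end OscSum
end

open MeasureTheory Filter Topology Set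
open scoped ContDiff ENNReal

noncomputable section

namespace OscSum

/-! ### Closedness of Γ and its description for a fixed phase -/

section Cone

variable {ι : Type*} {n M : ℕ}

theorem isClosed_limitSet {α : Type*} (l : Filter α) (S : α → Set (Rn n)) (w : α → Rn n → ℂ) :
    IsClosed (limitSet l S w) := by
  refine isClosed_of_closure_subset fun p hp ε hε => ?_
  obtain ⟨q, hq, hpq⟩ := Metric.mem_closure_iff.mp hp (ε / 2) (half_pos hε)
  rw [Prod.dist_eq, max_lt_iff] at hpq
  refine (hq (ε / 2) (half_pos hε)).mono fun a ⟨y, hy, h1, h2, h3⟩ => ⟨y, hy, ?_, ?_, by linarith⟩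
  · have := dist_triangle y q.1 p.1
    rw [dist_comm q.1] at this
    linarith [hpq.1]
  · have := dist_triangle (reGrad (w a) y) q.2 p.2
    rw [dist_comm q.2] at this
    linarith [hpq.2]

/-- A closed conic neighbourhood of a direction. -/
def coneNhd (θ : Rn n) (r : ℝ) : Set (Rn n) := {ξ | ‖ξ - ‖ξ‖ • θ‖ ≤ r * ‖ξ‖}

theorem isClosed_coneNhd (θ : Rn n) (r : ℝ) : IsClosed (coneNhd θ r) :=
  isClosed_le (by fun_prop) (by fun_prop)

theorem smul_mem_coneNhd {θ : Rn n} {r : ℝ} {ξ : Rn n} (hξ : ξ ∈ coneNhd θ r) {t : ℝ} (ht : 0 < t) :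
    t • ξ ∈ coneNhd θ r := by
  simp only [coneNhd, mem_ofPred_eq] at hξ ⊢
  rw [norm_smul, Real.norm_of_nonneg ht.le, mul_smul, ← smul_sub, norm_smul,
    Real.norm_of_nonneg ht.le]
  calc _ ≤ t * (r * ‖ξ‖) := by gcongr
    _ = _ := by ring

namespace OscFamily

variable {δ ϱ : ℝ} {w : ι → ℝ → Rn n → ℂ} {φ : ι → ℝ → Fin (M + 1) → Rn n → ℂ}
  {c : ℝ} {i₀ : Fin n} {R : ℝ}

/-- The bounds on gradients over the supports pass to limit points. The lower one keeps limits away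
from the zero section, so generating a cone loses no closedness outside it. -/
theorem norm_snd_mem_limitSet (H : OscFamily δ ϱ w φ c i₀ R) :
    ∃ B : ℝ, ∀ p ∈ limitSet ((⊤ : Filter ι) ×ˢ (atTop : Filter ℝ))
      (fun a => oscSupport δ a.2 (φ a.1 a.2)) (fun a => w a.1 a.2), c ≤ ‖p.2‖ ∧ ‖p.2‖ ≤ B := by
  obtain ⟨B, -, hB⟩ := H.exists_reGrad_le (isCompact_ball n R)
  refine ⟨B, fun p hp => ⟨le_of_forall_pos_le_add fun ε hε => ?_,
    le_of_forall_pos_le_add fun ε hε => ?_⟩⟩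
  all_goals
    obtain ⟨s, lam, hlam, y, hy, -, h2, -⟩ := frequently_top_prod_atTop.mp (hp ε hε) 1 le_rfl
    rw [dist_eq_norm] at h2
  · have h3 := H.grad_ge s lam hlam y
    have h4 := norm_sub_norm_le (reGrad (w s lam) y) p.2
    simp only at h2
    linarith
  · have h3 := hB (s, ⟨lam, hlam⟩) y (box_subset_ball H.δ_pos.le hlam
      (H.oscSupport_subset_box (s, ⟨lam, hlam⟩) hy))
    have h4 := norm_sub_norm_le p.2 (reGrad (w s lam) y)
    rw [norm_sub_rev] at h4
    simp only at h2 h3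
    linarith

/-- The complement of the cone of the family is conically open. -/
theorem exists_coneNhd_disjoint (H : OscFamily δ ϱ w φ c i₀ R) {x₀ θ : Rn n}
    (hp : (x₀, θ) ∉ oscCone δ w φ) :
    ∃ r : ℝ, 0 < r ∧ Disjoint (oscCone δ w φ) (Metric.closedBall x₀ r ×ˢ coneNhd θ r) := by
  by_contra! hcon
  obtain ⟨B, hB⟩ := H.norm_snd_mem_limitSet
  have hpos : ∀ k : ℕ, 0 < 1 / ((k : ℝ) + 1) := fun k => by positivity
  have hex : ∀ k : ℕ, ∃ q ∈ limitSet ((⊤ : Filter ι) ×ˢ (atTop : Filter ℝ))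
      (fun a => oscSupport δ a.2 (φ a.1 a.2)) (fun a => w a.1 a.2),
      dist q.1 x₀ ≤ 1 / ((k : ℝ) + 1) ∧ q.2 ∈ coneNhd θ (1 / ((k : ℝ) + 1)) := by
    intro k
    obtain ⟨p, ⟨q, hq, t, ht, rfl⟩, h1, h2⟩ := not_disjoint_iff.mp (hcon _ (hpos k))
    refine ⟨q, hq, h1, ?_⟩
    have := smul_mem_coneNhd h2 (inv_pos.mpr ht)
    rwa [inv_smul_smul₀ ht.ne'] at this
  choose q hq hq1 hq2 using hex
  have hnorm : ∀ k, ‖(q k).2‖ ∈ Icc c B := fun k => hB _ (hq k)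
  -- Only the lengths need a convergent subsequence, since the covectors are asymptotic to their
  -- length times θ. The limit (x₀, τθ) lies in the closed limit set and τ ≥ c > 0, so rescaling
  -- puts (x₀, θ) into the cone.
  obtain ⟨τ, hτ, ψ, hψ, hlim⟩ := isCompact_Icc.tendsto_subseq hnorm
  have hε0 : Tendsto (fun k => 1 / ((ψ k : ℝ) + 1)) atTop (𝓝 0) :=
    tendsto_one_div_add_atTop_nhds_zero_nat.comp hψ.tendsto_atTop
  have hl1 : Tendsto (fun k => (q (ψ k)).1) atTop (𝓝 x₀) :=
    tendsto_iff_dist_tendsto_zero.mpr (squeeze_zero (fun _ => dist_nonneg) (fun k => hq1 _) hε0)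
  have hl2 : Tendsto (fun k => (q (ψ k)).2) atTop (𝓝 (τ • θ)) := by
    have h0 : Tendsto (fun k => (q (ψ k)).2 - ‖(q (ψ k)).2‖ • θ) atTop (𝓝 0) := by
      refine squeeze_zero_norm (a := fun k => 1 / ((ψ k : ℝ) + 1) * B) (fun k => ?_)
        (by simpa using hε0.mul_const B)
      refine (hq2 (ψ k)).trans ?_
      have := (hnorm (ψ k)).2
      gcongr
    have := h0.add (hlim.smul_const θ)
    simpa using this
  have hmem := (isClosed_limitSet ((⊤ : Filter ι) ×ˢ (atTop : Filter ℝ))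
      (fun a => oscSupport δ a.2 (φ a.1 a.2)) (fun a => w a.1 a.2)).mem_of_tendsto
    (hl1.prodMk_nhds hl2) (Eventually.of_forall fun k => hq _)
  have hτ0 : 0 < τ := H.c_pos.trans_le hτ.1
  exact hp ⟨_, hmem, τ⁻¹, inv_pos.mpr hτ0, by simp [inv_smul_smul₀ hτ0.ne']⟩

/-- The cone of a family with fixed phase and decreasing supports. -/
theorem oscCone_eq (w₀ : Rn n → ℂ) (hw₀ : ∀ s, ∀ lam : ℝ, 1 ≤ lam → w s lam = w₀)
    (H : OscFamily δ ϱ w φ c i₀ R)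
    (hdec : ∀ s, ∀ lam mu : ℝ, 1 ≤ lam → lam ≤ mu →
        oscSupport δ mu (φ s mu) ⊆ oscSupport δ lam (φ s lam)) :
    oscCone δ w φ = coneGen
      {p | p.1 ∈ (⋂ (lam : ℝ) (_ : 1 ≤ lam), closure (⋃ s, oscSupport δ lam (φ s lam))) ∧
          (w₀ p.1).im = 0 ∧ p.2 = reGrad w₀ p.1} := by
  -- An index is needed to transfer smoothness and Im ≥ 0 to w₀. Without one, both cones are empty.
  rcases isEmpty_or_nonempty ι with hι | ⟨⟨s₀⟩⟩
  · rw [oscCone, coneGen, coneGen]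
    congr 1
    ext p
    have h1 : ∀ q, q ∉ limitSet ((⊤ : Filter ι) ×ˢ (atTop : Filter ℝ))
      (fun a => oscSupport δ a.2 (φ a.1 a.2)) (fun a => w a.1 a.2) := fun q hq => by
      obtain ⟨s, -⟩ := frequently_top_prod_atTop.mp (hq 1 one_pos) 1 le_rfl
      exact hι.elim s
    constructor
    · rintro ⟨q, hq, -⟩
      exact absurd hq (h1 q)
    · rintro ⟨q, hq, -⟩
      have := mem_iInter₂.mp hq.1 1 le_rfl
      simp at this
  have hs : ContDiff ℝ ∞ w₀ := hw₀ s₀ 1 le_rfl ▸ H.phase_smooth s₀ 1 le_rfl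
  have him0 : ∀ x, 0 ≤ (w₀ x).im := fun x => by
    have := H.im_nonneg s₀ 1 le_rfl x
    rwa [hw₀ s₀ 1 le_rfl] at this
  have hcg := continuous_reGrad hs
  have hci : Continuous fun x => (w₀ x).im := Complex.continuous_im.comp hs.continuous
  rw [oscCone]
  congr 1
  ext p
  constructor
  · intro hp
    -- A point found at some λ ≥ L also lies in the support at L, as the supports decrease.
    have happ : ∀ ε > 0, ∀ L : ℝ, 1 ≤ L → ∃ s, ∃ y ∈ oscSupport δ L (φ s L), dist y p.1 < ε ∧
        dist (reGrad w₀ y) p.2 < ε ∧ (w₀ y).im < ε := by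
      intro ε hε L hL
      obtain ⟨s, lam, hlam, y, hy, h1, h2, h3⟩ := frequently_top_prod_atTop.mp (hp ε hε) L hL
      simp only [hw₀ s lam (hL.trans hlam)] at h2 h3
      exact ⟨s, y, hdec s L lam hL hlam hy, h1, h2, h3⟩
    have hseq : ∀ k : ℕ, ∃ y : Rn n, dist y p.1 < 1 / ((k : ℝ) + 1) ∧
        dist (reGrad w₀ y) p.2 < 1 / ((k : ℝ) + 1) ∧ (w₀ y).im < 1 / ((k : ℝ) + 1) := fun k => by
      obtain ⟨s, y, -, h⟩ := happ (1 / ((k : ℝ) + 1)) (by positivity) 1 le_rfl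
      exact ⟨y, h⟩
    choose y h1 h2 h3 using hseq
    have h0 := tendsto_one_div_add_atTop_nhds_zero_nat (𝕜 := ℝ)
    have hy : Tendsto y atTop (𝓝 p.1) := tendsto_iff_dist_tendsto_zero.mpr
      (squeeze_zero (fun _ => dist_nonneg) (fun k => (h1 k).le) h0)
    have hg : Tendsto (fun k => reGrad w₀ (y k)) atTop (𝓝 p.2) := tendsto_iff_dist_tendsto_zero.mpr
      (squeeze_zero (fun _ => dist_nonneg) (fun k => (h2 k).le) h0)
    refine ⟨mem_iInter₂.mpr fun L hL => Metric.mem_closure_iff.mpr fun ε hε => ?_, ?_, ?_⟩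
    · obtain ⟨s, y, hy, h, -⟩ := happ ε hε L hL
      exact ⟨y, mem_iUnion.mpr ⟨s, hy⟩, by rwa [dist_comm]⟩
    · exact le_antisymm (le_of_tendsto_of_tendsto' ((hci.tendsto _).comp hy) h0
        fun k => (h3 k).le) (him0 _)
    · exact tendsto_nhds_unique hg ((hcg.tendsto _).comp hy)
  · rintro ⟨h1, h2, h3⟩ ε hε
    rw [frequently_top_prod_atTop]
    intro L hL
    have e1 : ∀ᶠ y in 𝓝 p.1, dist y p.1 < ε := Metric.ball_mem_nhds _ hε
    have e2 : ∀ᶠ y in 𝓝 p.1, dist (reGrad w₀ y) p.2 < ε := by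
      rw [h3]
      exact (hcg.tendsto p.1).eventually (Metric.ball_mem_nhds _ hε)
    have e3 : ∀ᶠ y in 𝓝 p.1, (w₀ y).im < ε :=
      (hci.tendsto p.1).eventually (gt_mem_nhds (h2 ▸ hε))
    obtain ⟨y, ⟨ha, hb, hc⟩, hy⟩ := mem_closure_iff_nhds.mp (mem_iInter₂.mp h1 L hL) _
      (e1.and (e2.and e3))
    obtain ⟨s, hs'⟩ := mem_iUnion.mp hy
    -- Points of Σ are approximated by the supports at every λ, so λ = L itself serves; continuity
    -- of ∇ Re w₀ and Im w₀ does the rest.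
    refine ⟨s, L, le_rfl, y, hs', ha, ?_, ?_⟩
    · simpa only [hw₀ s L hL] using hb
    · simpa only [hw₀ s L hL] using hc

end OscFamily

end Cone

end OscSum
end

open MeasureTheory Filter Topology Set
open scoped ContDiff ENNReal

noncomputable section

namespace OscSum

/-! ### Symbol estimates in terms of partial derivatives -/

section Symbols

variable {n : ℕ}

/-- The partial derivative in the `k`-th position variable. -/
def dx (k : Fin n) (f : Rn n × Rn n → ℂ) (p : Rn n × Rn n) : ℂ := fderiv ℝ f p (stdVec k, 0)

/-- The partial derivative in the `k`-th momentum variable. -/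
def dξ (k : Fin n) (f : Rn n × Rn n → ℂ) (p : Rn n × Rn n) : ℂ := fderiv ℝ f p (0, stdVec k)

variable {f g : Rn n × Rn n → ℂ}

theorem contDiff_dx (hf : ContDiff ℝ ∞ f) (k : Fin n) : ContDiff ℝ ∞ (dx k f) :=
  (hf.fderiv_right (by simp)).clm_apply contDiff_const

theorem contDiff_dξ (hf : ContDiff ℝ ∞ f) (k : Fin n) : ContDiff ℝ ∞ (dξ k f) :=
  (hf.fderiv_right (by simp)).clm_apply contDiff_const

theorem fderiv_fderiv_apply_comm {E : Type*} [NormedAddCommGroup E] [NormedSpace ℝ E] {f : E → ℂ}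
    (hf : ContDiff ℝ ∞ f) (p v w : E) :
    fderiv ℝ (fun q => fderiv ℝ f q v) p w = fderiv ℝ (fun q => fderiv ℝ f q w) p v := by
  have hd : DifferentiableAt ℝ (fderiv ℝ f) p :=
    ((hf.fderiv_right (m := ∞) (by simp)).differentiable (by simp)) p
  rw [fderiv_clm_apply hd (differentiableAt_const _), fderiv_clm_apply hd (differentiableAt_const _)]
  have := (hf.contDiffAt (x := p)).isSymmSndFDerivAt (by
    simp only [minSmoothness_of_isRCLikeNormedField]
    exact ENat.LEInfty.out)
  simpa using this.eq w v

theorem dξ_dx (hf : ContDiff ℝ ∞ f) (j k : Fin n) : dξ j (dx k f) = dx k (dξ j f) :=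
  funext fun p => fderiv_fderiv_apply_comm hf p _ _

theorem dx_add (hf : ContDiff ℝ ∞ f) (hg : ContDiff ℝ ∞ g) (k : Fin n) :
    dx k (fun p => f p + g p) = fun p => dx k f p + dx k g p := by
  funext p
  simp only [dx]
  rw [fderiv_fun_add (hf.differentiable (by simp) p) (hg.differentiable (by simp) p)]
  rfl

theorem dξ_add (hf : ContDiff ℝ ∞ f) (hg : ContDiff ℝ ∞ g) (k : Fin n) :
    dξ k (fun p => f p + g p) = fun p => dξ k f p + dξ k g p := by
  funext p
  simp only [dξ]
  rw [fderiv_fun_add (hf.differentiable (by simp) p) (hg.differentiable (by simp) p)]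
  rfl

theorem dx_const_mul (c : ℂ) (hf : ContDiff ℝ ∞ f) (k : Fin n) :
    dx k (fun p => c * f p) = fun p => c * dx k f p := by
  funext p
  simp only [dx]
  rw [fderiv_const_mul (hf.differentiable (by simp) p)]
  rfl

theorem dξ_const_mul (c : ℂ) (hf : ContDiff ℝ ∞ f) (k : Fin n) :
    dξ k (fun p => c * f p) = fun p => c * dξ k f p := by
  funext p
  simp only [dξ]
  rw [fderiv_const_mul (hf.differentiable (by simp) p)]
  rfl

theorem hasFDerivAt_coord_snd (k : Fin n) (p : Rn n × Rn n) :
    HasFDerivAt (fun q : Rn n × Rn n => ((q.2 k : ℝ) : ℂ))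
      (Complex.ofRealCLM ∘L (EuclideanSpace.proj k : Rn n →L[ℝ] ℝ) ∘L
        ContinuousLinearMap.snd ℝ (Rn n) (Rn n)) p :=
  (Complex.ofRealCLM ∘L (EuclideanSpace.proj k : Rn n →L[ℝ] ℝ) ∘L
        ContinuousLinearMap.snd ℝ (Rn n) (Rn n)).hasFDerivAt

theorem contDiff_coord_snd (k : Fin n) :
    ContDiff ℝ ∞ (fun q : Rn n × Rn n => ((q.2 k : ℝ) : ℂ)) :=
  (Complex.ofRealCLM ∘L (EuclideanSpace.proj k : Rn n →L[ℝ] ℝ) ∘L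
        ContinuousLinearMap.snd ℝ (Rn n) (Rn n)).contDiff

theorem dx_coord_mul (hf : ContDiff ℝ ∞ f) (j k : Fin n) :
    dx j (fun p => ((p.2 k : ℝ) : ℂ) * f p) = fun p => ((p.2 k : ℝ) : ℂ) * dx j f p := by
  funext p
  simp only [dx]
  rw [((hasFDerivAt_coord_snd k p).fun_mul (hf.differentiable (by simp) p).hasFDerivAt).fderiv]
  simp

theorem dξ_coord_mul (hf : ContDiff ℝ ∞ f) (j k : Fin n) :
    dξ j (fun p => ((p.2 k : ℝ) : ℂ) * f p) =
      fun p => ((p.2 k : ℝ) : ℂ) * dξ j f p + ((stdVec j k : ℝ) : ℂ) * f p := by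
  funext p
  simp only [dξ]
  rw [((hasFDerivAt_coord_snd k p).fun_mul (hf.differentiable (by simp) p).hasFDerivAt).fderiv]
  simp [mul_comm]

/-- Symbol estimates of order `m` on `Ω`, for derivatives of order at most `l`. -/
def SymbolBound (Ω : Set (Rn n × Rn n)) : ℕ → ℝ → (Rn n × Rn n → ℂ) → Prop
  | 0, m, f => ∃ C : ℝ, ∀ p ∈ Ω, ‖f p‖ ≤ C * (1 + ‖p.2‖) ^ m
  | l + 1, m, f => (∃ C : ℝ, ∀ p ∈ Ω, ‖f p‖ ≤ C * (1 + ‖p.2‖) ^ m) ∧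
      (∀ k, SymbolBound Ω l m (dx k f)) ∧ ∀ k, SymbolBound Ω l (m - 1) (dξ k f)

namespace SymbolBound

variable {Ω Ω' : Set (Rn n × Rn n)} {l : ℕ} {m m' : ℝ}

theorem add (hf : ContDiff ℝ ∞ f) (hg : ContDiff ℝ ∞ g) (h : SymbolBound Ω l m f)
    (h' : SymbolBound Ω l m g) : SymbolBound Ω l m (fun p => f p + g p) := by
  have key : ∀ {f g : Rn n × Rn n → ℂ} {m : ℝ},
      (∃ C : ℝ, ∀ p ∈ Ω, ‖f p‖ ≤ C * (1 + ‖p.2‖) ^ m) →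
      (∃ C : ℝ, ∀ p ∈ Ω, ‖g p‖ ≤ C * (1 + ‖p.2‖) ^ m) →
      ∃ C : ℝ, ∀ p ∈ Ω, ‖f p + g p‖ ≤ C * (1 + ‖p.2‖) ^ m := by
    rintro f g m ⟨C, hC⟩ ⟨D, hD⟩
    refine ⟨C + D, fun p hp => (norm_add_le _ _).trans ?_⟩
    rw [add_mul]
    exact add_le_add (hC p hp) (hD p hp)
  induction l generalizing m f g with
  | zero => exact key h h'
  | succ l ih =>
    refine ⟨key h.1 h'.1, fun k => ?_, fun k => ?_⟩
    · rw [dx_add hf hg]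
      exact ih (contDiff_dx hf k) (contDiff_dx hg k) (h.2.1 k) (h'.2.1 k)
    · rw [dξ_add hf hg]
      exact ih (contDiff_dξ hf k) (contDiff_dξ hg k) (h.2.2 k) (h'.2.2 k)

theorem const_mul (c : ℂ) (hf : ContDiff ℝ ∞ f) (h : SymbolBound Ω l m f) :
    SymbolBound Ω l m (fun p => c * f p) := by
  have key : ∀ {f : Rn n × Rn n → ℂ} {m : ℝ},
      (∃ C : ℝ, ∀ p ∈ Ω, ‖f p‖ ≤ C * (1 + ‖p.2‖) ^ m) →
      ∃ C : ℝ, ∀ p ∈ Ω, ‖c * f p‖ ≤ C * (1 + ‖p.2‖) ^ m := by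
    rintro f m ⟨C, hC⟩
    refine ⟨‖c‖ * C, fun p hp => ?_⟩
    rw [norm_mul, mul_assoc]
    exact mul_le_mul_of_nonneg_left (hC p hp) (norm_nonneg _)
  induction l generalizing m f with
  | zero => exact key h
  | succ l ih =>
    refine ⟨key h.1, fun k => ?_, fun k => ?_⟩
    · rw [dx_const_mul c hf]
      exact ih (contDiff_dx hf k) (h.2.1 k)
    · rw [dξ_const_mul c hf]
      exact ih (contDiff_dξ hf k) (h.2.2 k)

theorem mono_order (hm : m ≤ m') (h : SymbolBound Ω l m f) : SymbolBound Ω l m' f := by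
  have key : ∀ {f : Rn n × Rn n → ℂ} {m m' : ℝ}, m ≤ m' →
      (∃ C : ℝ, ∀ p ∈ Ω, ‖f p‖ ≤ C * (1 + ‖p.2‖) ^ m) →
      ∃ C : ℝ, ∀ p ∈ Ω, ‖f p‖ ≤ C * (1 + ‖p.2‖) ^ m' := by
    rintro f m m' hm ⟨C, hC⟩
    refine ⟨|C|, fun p hp => (hC p hp).trans ?_⟩
    have h1 : (1 : ℝ) ≤ 1 + ‖p.2‖ := by linarith [norm_nonneg p.2]
    gcongr
    exact le_abs_self C
  induction l generalizing m m' f with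
  | zero => exact key hm h
  | succ l ih =>
    exact ⟨key hm h.1, fun k => ih hm (h.2.1 k), fun k => ih (by linarith) (h.2.2 k)⟩

theorem pred (h : SymbolBound Ω (l + 1) m f) : SymbolBound Ω l m f := by
  induction l generalizing m f with
  | zero => exact h.1
  | succ l ih => exact ⟨h.1, fun k => ih (h.2.1 k), fun k => ih (h.2.2 k)⟩

theorem coord_mul (hf : ContDiff ℝ ∞ f) (k : Fin n) (h : SymbolBound Ω l m f) :
    SymbolBound Ω l (m + 1) (fun p => ((p.2 k : ℝ) : ℂ) * f p) := by
  have key : ∀ {f : Rn n × Rn n → ℂ} {m : ℝ},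
      (∃ C : ℝ, ∀ p ∈ Ω, ‖f p‖ ≤ C * (1 + ‖p.2‖) ^ m) →
      ∃ C : ℝ, ∀ p ∈ Ω, ‖((p.2 k : ℝ) : ℂ) * f p‖ ≤ C * (1 + ‖p.2‖) ^ (m + 1) := by
    rintro f m ⟨C, hC⟩
    refine ⟨C, fun p hp => ?_⟩
    have h1 : (0 : ℝ) < 1 + ‖p.2‖ := by linarith [norm_nonneg p.2]
    have h2 : ‖((p.2 k : ℝ) : ℂ)‖ ≤ 1 + ‖p.2‖ := by
      rw [Complex.norm_real]
      exact (PiLp.norm_apply_le p.2 k).trans (by linarith)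
    rw [Real.rpow_add_one h1.ne', norm_mul, mul_comm, ← mul_assoc]
    exact mul_le_mul (hC p hp) h2 (norm_nonneg _) ((norm_nonneg _).trans (hC p hp))
  induction l generalizing m f with
  | zero => exact key h
  | succ l ih =>
    refine ⟨key h.1, fun j => ?_, fun j => ?_⟩
    · rw [dx_coord_mul hf]
      exact ih (contDiff_dx hf j) (h.2.1 j)
    -- The derivative of the coordinate leaves a multiple of f, whose order m is (m + 1) - 1 as
    -- required.
    · rw [dξ_coord_mul hf]
      refine add ((contDiff_coord_snd k).mul (contDiff_dξ hf j)) (contDiff_const.mul hf) ?_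
        (const_mul _ hf ?_)
      · have := ih (contDiff_dξ hf j) (h.2.2 j)
        rwa [show m - 1 + 1 = m + 1 - 1 by ring] at this
      · rw [show m + 1 - 1 = m by ring]
        exact h.pred

theorem mono_set (hΩ : Ω ⊆ Ω') (h : SymbolBound Ω' l m f) : SymbolBound Ω l m f := by
  induction l generalizing m f with
  | zero => exact h.imp fun C hC p hp => hC p (hΩ hp)
  | succ l ih =>
    exact ⟨h.1.imp fun C hC p hp => hC p (hΩ hp), fun k => ih (h.2.1 k), fun k => ih (h.2.2 k)⟩

end SymbolBound

/-- Iterated partial derivatives in the position variables. -/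
def dxs (α : List (Fin n)) (f : Rn n × Rn n → ℂ) : Rn n × Rn n → ℂ := α.foldr dx f

/-- Iterated partial derivatives in the momentum variables. -/
def dξs (β : List (Fin n)) (f : Rn n × Rn n → ℂ) : Rn n × Rn n → ℂ := β.foldr dξ f

theorem contDiff_dxs (hf : ContDiff ℝ ∞ f) (α : List (Fin n)) : ContDiff ℝ ∞ (dxs α f) := by
  induction α with
  | nil => exact hf
  | cons k α ih => exact contDiff_dx ih k

theorem contDiff_dξs (hf : ContDiff ℝ ∞ f) (β : List (Fin n)) : ContDiff ℝ ∞ (dξs β f) := by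
  induction β with
  | nil => exact hf
  | cons k β ih => exact contDiff_dξ ih k

theorem dξ_dxs (hf : ContDiff ℝ ∞ f) (j : Fin n) (α : List (Fin n)) :
    dξ j (dxs α f) = dxs α (dξ j f) := by
  induction α with
  | nil => rfl
  | cons k α ih =>
    change dξ j (dx k (dxs α f)) = dx k (dxs α (dξ j f))
    rw [dξ_dx (contDiff_dxs hf α), ih]

/-- `SymbolBound` mixes the two kinds of derivatives in any order. Partial derivatives commute, so
momentum derivatives can always be moved inside. -/
theorem symbolBound_of_dxs_dξs {Ω : Set (Rn n × Rn n)} {m : ℝ} (hf : ContDiff ℝ ∞ f)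
    (h : ∀ α β : List (Fin n), ∃ C : ℝ, ∀ p ∈ Ω,
      ‖dxs α (dξs β f) p‖ ≤ C * (1 + ‖p.2‖) ^ (m - β.length)) (l : ℕ) (α β : List (Fin n)) :
    SymbolBound Ω l (m - β.length) (dxs α (dξs β f)) := by
  induction l generalizing α β with
  | zero => exact h α β
  | succ l ih =>
    refine ⟨h α β, fun k => ih (k :: α) β, fun k => ?_⟩
    rw [dξ_dxs (contDiff_dξs hf β)]
    have := ih α (k :: β)
    rw [List.length_cons, Nat.cast_add, Nat.cast_one, ← sub_sub] at this
    exact this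

theorem contDiff_iteratedFDeriv_snd {a : Rn n → Rn n → ℂ}
    (ha : ContDiff ℝ ∞ fun p : Rn n × Rn n => a p.1 p.2) (j : ℕ) :
    ContDiff ℝ ∞ fun p : Rn n × Rn n => iteratedFDeriv ℝ j (a p.1) p.2 := by
  induction j with
  | zero =>
    simp only [iteratedFDeriv_zero_eq_comp, Function.comp_def]
    exact (continuousMultilinearCurryFin0 ℝ (Rn n) ℂ).symm.contDiff.comp ha
  | succ j ih =>
    simp only [iteratedFDeriv_succ_eq_comp_left, Function.comp_def]
    refine ContDiff.comp (g := (continuousMultilinearCurryLeftEquiv ℝ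
      (fun _ : Fin (j + 1) => Rn n) ℂ).symm) (LinearIsometryEquiv.contDiff _) ?_
    refine ContDiff.fderiv (f := fun p : Rn n × Rn n => iteratedFDeriv ℝ j (a p.1))
      (n := ∞) (m := ∞) ?_ contDiff_snd (by simp)
    exact ih.comp ((contDiff_fst.comp contDiff_fst).prodMk contDiff_snd)

/-- Iterated partial derivatives evaluate the full derivative on basis vectors, so its operator norm
controls them. -/
theorem exists_iteratedFDeriv_apply_dξs {a : Rn n → Rn n → ℂ}
    (ha : ContDiff ℝ ∞ fun p : Rn n × Rn n => a p.1 p.2) (β : List (Fin n)) :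
    ∃ v : Fin β.length → Rn n, (∀ i, ‖v i‖ ≤ 1) ∧
      ∀ p, dξs β (fun p => a p.1 p.2) p = iteratedFDeriv ℝ β.length (a p.1) p.2 v := by
  induction β with
  | nil => exact ⟨Fin.elim0, fun i => i.elim0, fun p => by simp [dξs]⟩
  | cons k β ih =>
    obtain ⟨v, hv, h⟩ := ih
    refine ⟨Fin.cons (stdVec k) v, fun i => ?_, fun p => ?_⟩
    · refine Fin.cases ?_ (fun i => ?_) i
      · simp [norm_stdVec]
      · simpa using hv i
    · change dξ k (dξs β fun p => a p.1 p.2) p =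
        iteratedFDeriv ℝ (β.length + 1) (a p.1) p.2 (Fin.cons (stdVec k) v)
      rw [iteratedFDeriv_succ_apply_left]
      simp only [Fin.cons_zero, Fin.tail_cons]
      have hd : DifferentiableAt ℝ (iteratedFDeriv ℝ β.length (a p.1)) p.2 :=
        ((contDiff_iteratedFDeriv_snd ha β.length).comp
          (contDiff_prodMk_right (n := ∞) (𝕜 := ℝ) p.1)).differentiable (by simp) p.2
      have h1 : DifferentiableAt ℝ (dξs β fun p => a p.1 p.2) p :=
        (contDiff_dξs ha β).differentiable (by simp) p
      have h2 : HasFDerivAt (fun ξ => dξs β (fun p => a p.1 p.2) (p.1, ξ))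
          ((fderiv ℝ (dξs β fun p => a p.1 p.2) p) ∘L ContinuousLinearMap.inr ℝ (Rn n) (Rn n))
          p.2 := HasFDerivAt.comp (g := dξs β fun p => a p.1 p.2) p.2 h1.hasFDerivAt
            (hasFDerivAt_prodMk_right p.1 p.2)
      have h3 : HasFDerivAt (fun ξ => dξs β (fun p => a p.1 p.2) (p.1, ξ))
          ((ContinuousMultilinearMap.apply ℝ (fun _ : Fin β.length => Rn n) ℂ v) ∘L
            fderiv ℝ (iteratedFDeriv ℝ β.length (a p.1)) p.2) p.2 := by
        simp only [h]
        exact (ContinuousMultilinearMap.apply ℝ (fun _ : Fin β.length => Rn n) ℂ v).hasFDerivAt.comp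
          p.2 hd.hasFDerivAt
      have h4 := h2.unique h3
      have h5 := DFunLike.congr_fun h4 (stdVec k)
      simpa [dξ] using h5

theorem exists_iteratedFDeriv_apply_dxs {f : Rn n × Rn n → ℂ} (hf : ContDiff ℝ ∞ f)
    (α : List (Fin n)) :
    ∃ v : Fin α.length → Rn n, (∀ i, ‖v i‖ ≤ 1) ∧
      ∀ p : Rn n × Rn n, dxs α f p = iteratedFDeriv ℝ α.length (fun y => f (y, p.2)) p.1 v := by
  induction α with
  | nil => exact ⟨Fin.elim0, fun i => i.elim0, fun p => by simp [dxs]⟩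
  | cons k α ih =>
    obtain ⟨v, hv, h⟩ := ih
    refine ⟨Fin.cons (stdVec k) v, fun i => ?_, fun p => ?_⟩
    · refine Fin.cases ?_ (fun i => ?_) i
      · simp [norm_stdVec]
      · simpa using hv i
    · change dx k (dxs α f) p =
        iteratedFDeriv ℝ (α.length + 1) (fun y => f (y, p.2)) p.1 (Fin.cons (stdVec k) v)
      rw [iteratedFDeriv_succ_apply_left]
      simp only [Fin.cons_zero, Fin.tail_cons]
      have hd : DifferentiableAt ℝ (iteratedFDeriv ℝ α.length fun y => f (y, p.2)) p.1 :=
        ((hf.comp (contDiff_prodMk_left p.2)).iteratedFDeriv_right (m := ∞)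
          (by exact_mod_cast le_top)).differentiable (by simp) p.1
      have h1 : DifferentiableAt ℝ (dxs α f) p :=
        (contDiff_dxs hf α).differentiable (by simp) p
      have h2 : HasFDerivAt (fun y => dxs α f (y, p.2))
          ((fderiv ℝ (dxs α f) p) ∘L ContinuousLinearMap.inl ℝ (Rn n) (Rn n))
          p.1 := HasFDerivAt.comp (g := dxs α f) p.1 h1.hasFDerivAt
            (hasFDerivAt_prodMk_left p.1 p.2)
      have h3 : HasFDerivAt (fun y => dxs α f (y, p.2))
          ((ContinuousMultilinearMap.apply ℝ (fun _ : Fin α.length => Rn n) ℂ v) ∘L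
            fderiv ℝ (iteratedFDeriv ℝ α.length fun y => f (y, p.2)) p.1) p.1 := by
        simp only [h]
        exact (ContinuousMultilinearMap.apply ℝ (fun _ : Fin α.length => Rn n) ℂ v).hasFDerivAt.comp
          p.1 hd.hasFDerivAt
      have h4 := h2.unique h3
      have h5 := DFunLike.congr_fun h4 (stdVec k)
      simpa [dx] using h5

theorem norm_apply_le_of_norm_le_one {j : ℕ}
    (T : ContinuousMultilinearMap ℝ (fun _ : Fin j => Rn n) ℂ)
    {v : Fin j → Rn n} (hv : ∀ i, ‖v i‖ ≤ 1) : ‖T v‖ ≤ ‖T‖ := by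
  refine (T.le_opNorm v).trans (mul_le_of_le_one_right (norm_nonneg _) ?_)
  exact Finset.prod_le_one (fun i _ => norm_nonneg _) fun i _ => hv i

theorem norm_dxs_dξs_le {a : Rn n → Rn n → ℂ}
    (ha : ContDiff ℝ ∞ fun p : Rn n × Rn n => a p.1 p.2) (α β : List (Fin n)) (x ξ : Rn n) :
    ‖dxs α (dξs β fun p => a p.1 p.2) (x, ξ)‖ ≤ mixedDerivNorm a α.length β.length x ξ := by
  obtain ⟨v, hv, h⟩ := exists_iteratedFDeriv_apply_dξs ha β
  obtain ⟨v', hv', h'⟩ := exists_iteratedFDeriv_apply_dxs (contDiff_dξs ha β) α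
  rw [h']
  refine (norm_apply_le_of_norm_le_one _ hv').trans ?_
  simp only [h]
  set L := ContinuousMultilinearMap.apply ℝ (fun _ : Fin β.length => Rn n) ℂ v
  have hL : ‖L‖ ≤ 1 := ContinuousLinearMap.opNorm_le_bound _ zero_le_one fun T => by
    rw [one_mul]
    exact norm_apply_le_of_norm_le_one T hv
  have hG : ContDiff ℝ ∞ fun y => iteratedFDeriv ℝ β.length (a y) ξ :=
    (contDiff_iteratedFDeriv_snd ha β.length).comp (contDiff_prodMk_left ξ)
  have := L.norm_iteratedFDeriv_comp_left (x := x) hG.contDiffAt (n := α.length)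
    (by exact mod_cast le_top)
  refine this.trans (mul_le_of_le_one_left (norm_nonneg _) hL)

/-- This passes from multilinear derivatives to the recursive form of the estimates, which is the
one stable under differentiation and multiplication by ξ_k. -/
theorem symbolBound_of_mixedDerivNorm {a : Rn n → Rn n → ℂ} {m : ℝ} {Ω : Set (Rn n × Rn n)}
    (ha : ContDiff ℝ ∞ fun p : Rn n × Rn n => a p.1 p.2)
    (h : ∀ i j : ℕ, ∃ C : ℝ, ∀ p ∈ Ω,
      mixedDerivNorm a i j p.1 p.2 ≤ C * (1 + ‖p.2‖) ^ (m - (j : ℝ))) (l : ℕ) :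
    SymbolBound Ω l m fun p => a p.1 p.2 := by
  have := symbolBound_of_dxs_dξs ha (m := m) (Ω := Ω) (fun α β => ?_) l [] []
  · simpa [dxs, dξs] using this
  · obtain ⟨C, hC⟩ := h α.length β.length
    exact ⟨C, fun p hp => (norm_dxs_dξs_le ha α β p.1 p.2).trans (hC p hp)⟩

/-- The conic set over `U` with directions in `V`. -/
def conicSet (U V : Set (Rn n)) : Set (Rn n × Rn n) :=
  {q | q.1 ∈ U ∧ ∃ η ∈ V, ∃ t : ℝ, 0 < t ∧ q.2 = t • η}

/-- A symbol of some order whose restriction to a conic neighbourhood of any point outside `W` has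
order `-∞`. -/
structure SymbolAt (W : Set (Rn n × Rn n)) (b : Rn n × Rn n → ℂ) : Prop where
  smooth : ContDiff ℝ ∞ b
  order : ∃ m : ℝ, ∀ K, IsCompact K → ∀ l, SymbolBound (K ×ˢ univ) l m b
  rapid : ∀ p : Rn n × Rn n, p.2 ≠ 0 → p ∉ W → ∃ U ∈ 𝓝 p.1, ∃ V ∈ 𝓝 p.2,
    ∀ (l : ℕ) (m : ℝ), SymbolBound (conicSet U V) l m b

theorem PseudoDiffOp.symbolAt (A : PseudoDiffOp n) :
    SymbolAt A.waveFront fun p => A.symbol p.1 p.2 where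
  smooth := A.isSymbol.1
  order := ⟨A.order, fun K hK l => symbolBound_of_mixedDerivNorm A.isSymbol.1 (fun i j =>
    (A.isSymbol.2 i j K hK).imp fun C hC p hp => hC p.1 hp.1 p.2) l⟩
  rapid p hp0 hp := by
    have : ∃ U ∈ 𝓝 p.1, ∃ V ∈ 𝓝 p.2, ∀ i j m : ℕ, ∃ C : ℝ, ∀ x ∈ U, ∀ η ∈ V, ∀ t : ℝ, 0 < t →
        mixedDerivNorm A.symbol i j x (t • η) ≤ C * (1 + ‖t • η‖) ^ (-(m : ℝ)) := by
      by_contra h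
      exact hp ⟨hp0, h⟩
    obtain ⟨U, hU, V, hV, h⟩ := this
    refine ⟨U, hU, V, hV, fun l m => symbolBound_of_mixedDerivNorm A.isSymbol.1 (fun i j => ?_) l⟩
    obtain ⟨N, hN⟩ := exists_nat_ge (-(m - j))
    obtain ⟨C, hC⟩ := h i j N
    refine ⟨|C|, ?_⟩
    rintro ⟨x, ξ⟩ ⟨hx, η, hη, t, ht, rfl⟩
    refine (hC x hx η hη t ht).trans ?_
    have h1 : (1 : ℝ) ≤ 1 + ‖t • η‖ := by linarith [norm_nonneg (t • η)]
    refine mul_le_mul (le_abs_self C) (Real.rpow_le_rpow_of_exponent_le h1 (by linarith))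
      (by positivity) (abs_nonneg C)

/-- The symbol of `∂ₖ ∘ b(x, D)`. -/
def symbolDeriv (k : Fin n) (b : Rn n × Rn n → ℂ) (p : Rn n × Rn n) : ℂ :=
  Complex.I * (((p.2 k : ℝ) : ℂ) * b p) + dx k b p

/-- Multiplication by ξ_k raises a finite order by one, and order -∞ does not notice it. Derivatives
of the operator are therefore covered by estimates in the sup norm alone. -/
theorem SymbolAt.symbolDeriv {W : Set (Rn n × Rn n)} {b : Rn n × Rn n → ℂ} (h : SymbolAt W b)
    (k : Fin n) : SymbolAt W (symbolDeriv k b) where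
  smooth := (contDiff_const.mul ((contDiff_coord_snd k).mul h.smooth)).add (contDiff_dx h.smooth k)
  order := by
    obtain ⟨m, hm⟩ := h.order
    refine ⟨m + 1, fun K hK l => ?_⟩
    exact (((hm K hK l).coord_mul h.smooth k).const_mul Complex.I
      ((contDiff_coord_snd k).mul h.smooth)).add
      (contDiff_const.mul ((contDiff_coord_snd k).mul h.smooth)) (contDiff_dx h.smooth k)
      (((hm K hK (l + 1)).2.1 k).mono_order (by linarith))
  rapid p hp0 hp := by
    obtain ⟨U, hU, V, hV, H⟩ := h.rapid p hp0 hp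
    refine ⟨U, hU, V, hV, fun l m => ?_⟩
    have h1 := (H l (m - 1)).coord_mul h.smooth k
    rw [sub_add_cancel] at h1
    exact (h1.const_mul Complex.I ((contDiff_coord_snd k).mul h.smooth)).add
      (contDiff_const.mul ((contDiff_coord_snd k).mul h.smooth)) (contDiff_dx h.smooth k)
      ((H (l + 1) m).2.1 k)

end Symbols

end OscSum

end

open MeasureTheory Filter Topology Set
open scoped ContDiff ENNReal

noncomputable section

namespace OscSum

/-! ### Smoothness in x and differentiation under the integral sign -/

section ParametricIntegrals

variable {n : ℕ}

/-- The linear map taking `z` to the covector `z dx_k`. -/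
def coordCovector (k : Fin n) : ℂ →L[ℝ] Rn n →L[ℝ] ℂ :=
  ContinuousLinearMap.smulRightL ℝ (Rn n) ℂ (EuclideanSpace.proj k)

theorem sum_coord_smul_stdVec (v : Rn n) : ∑ k, v k • stdVec k = v := by
  ext j
  simp [stdVec, Pi.single_apply]

theorem sum_coordCovector (L : Rn n →L[ℝ] ℂ) : ∑ k, coordCovector k (L (stdVec k)) = L := by
  ext v
  conv_rhs => rw [← sum_coord_smul_stdVec v, map_sum]
  simp [coordCovector]

theorem norm_coordCovector_apply_le (k : Fin n) (z : ℂ) : ‖coordCovector k z‖ ≤ ‖z‖ := by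
  refine ContinuousLinearMap.opNorm_le_bound _ (norm_nonneg _) fun v => ?_
  change ‖v k • z‖ ≤ ‖z‖ * ‖v‖
  rw [norm_smul, mul_comm]
  exact mul_le_mul_of_nonneg_left (PiLp.norm_apply_le v k) (norm_nonneg _)

theorem norm_iteratedFDeriv_coordCovector_le {f : Rn n → ℂ} (hf : ContDiff ℝ ∞ f) (k : Fin n)
    (i : ℕ) (x : Rn n) :
    ‖iteratedFDeriv ℝ i (fun x => coordCovector k (f x)) x‖ ≤ ‖iteratedFDeriv ℝ i f x‖ := by
  refine ((coordCovector k).norm_iteratedFDeriv_comp_left hf.contDiffAt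
    (by exact_mod_cast le_top)).trans (mul_le_of_le_one_left (norm_nonneg _) ?_)
  refine ContinuousLinearMap.opNorm_le_bound _ zero_le_one fun z => ?_
  rw [one_mul]
  exact norm_coordCovector_apply_le k z

theorem fderiv_eq_sum_pd (f : Rn n → ℂ) :
    fderiv ℝ f = fun x => ∑ k, coordCovector k (pd k f x) :=
  funext fun _ => (sum_coordCovector _).symm

/-- Convergence to `0` in `C^∞` follows from locally uniform convergence for a class of families
that is closed under partial derivatives. -/
theorem tendstoZeroSmooth_of_pd_closed {α : Type*} {l : Filter α} (B : Set (α → Rn n → ℂ))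
    (hsm : ∀ f ∈ B, ∀ᶠ a in l, ContDiff ℝ ∞ (f a))
    (hpd : ∀ f ∈ B, ∀ k, ∃ g ∈ B, ∀ᶠ a in l, pd k (f a) = g a)
    (hb : ∀ f ∈ B, ∀ K, IsCompact K → ∀ ε : ℝ, 0 < ε → ∀ᶠ a in l, ∀ x ∈ K, ‖f a x‖ ≤ ε)
    {f : α → Rn n → ℂ} (hf : f ∈ B) : TendstoZeroSmooth l f := by
  refine ⟨hsm f hf, fun i K hK => ?_⟩
  induction i generalizing f with
  | zero => simpa only [norm_iteratedFDeriv_zero] using hb f hf K hK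
  | succ i ih =>
    intro ε hε
    choose g hgB hg using hpd f hf
    have hD0 : (0 : ℝ) < n + 1 := by positivity
    have h1 : ∀ᶠ a in l, ∀ k, ContDiff ℝ ∞ (g k a) ∧ pd k (f a) = g k a ∧
        ∀ x ∈ K, ‖iteratedFDeriv ℝ i (g k a) x‖ ≤ ε / (n + 1) :=
      eventually_all.2 fun k => (hsm _ (hgB k)).and ((hg k).and (ih (hgB k) _ (by positivity)))
    filter_upwards [h1] with a ha x hx
    rw [← norm_iteratedFDeriv_fderiv, fderiv_eq_sum_pd]
    have h2 : ∀ k, ContDiff ℝ ∞ fun x => coordCovector k (g k a x) := fun k =>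
      (coordCovector k).contDiff.comp (ha k).1
    simp only [fun k => (ha k).2.1]
    rw [iteratedFDeriv_fun_sum_apply fun k _ => ((h2 k).of_le (by exact_mod_cast le_top)).contDiffAt]
    refine (norm_sum_le _ _).trans ?_
    calc ∑ k, ‖iteratedFDeriv ℝ i (fun x => coordCovector k (g k a x)) x‖
        ≤ ∑ _k : Fin n, ε / (n + 1) := Finset.sum_le_sum fun k _ =>
          (norm_iteratedFDeriv_coordCovector_le (ha k).1 k i x).trans ((ha k).2.2 x hx)
      _ = n / (n + 1) * ε := by
          rw [Finset.sum_const, Finset.card_univ, Fintype.card_fin, nsmul_eq_mul]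
          ring
      _ ≤ 1 * ε := by
          refine mul_le_mul_of_nonneg_right ?_ hε.le
          rw [div_le_one hD0]
          linarith
      _ = ε := one_mul ε

/-- `Φ(x, ·)` is dominated by an integrable function, locally uniformly in `x`. -/
def LocallyDominated (Φ : Rn n × Rn n → ℂ) : Prop :=
  ∀ x₀ : Rn n, ∃ g : Rn n → ℝ, Integrable g ∧
    ∀ x ∈ Metric.closedBall x₀ 1, ∀ ξ, ‖Φ (x, ξ)‖ ≤ g ξ

theorem LocallyDominated.integrable {Φ : Rn n × Rn n → ℂ} (h : LocallyDominated Φ)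
    (hΦ : Continuous Φ) (x : Rn n) : Integrable fun ξ => Φ (x, ξ) := by
  obtain ⟨g, hg, hb⟩ := h x
  exact hg.mono' (hΦ.comp (by fun_prop)).aestronglyMeasurable
    (Eventually.of_forall fun ξ => hb x (by simp) ξ)

theorem hasFDerivAt_section {Φ : Rn n × Rn n → ℂ} (hs : ContDiff ℝ ∞ Φ) (x ξ : Rn n) :
    HasFDerivAt (fun y => Φ (y, ξ)) (∑ k, coordCovector k (dx k Φ (x, ξ))) x := by
  have h1 : HasFDerivAt (fun y => Φ (y, ξ))
      ((fderiv ℝ Φ (x, ξ)) ∘L ContinuousLinearMap.inl ℝ (Rn n) (Rn n)) x :=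
    HasFDerivAt.comp (g := Φ) x (hs.differentiable (by simp) (x, ξ)).hasFDerivAt
      (hasFDerivAt_prodMk_left x ξ)
  rw [← sum_coordCovector ((fderiv ℝ Φ (x, ξ)) ∘L ContinuousLinearMap.inl ℝ (Rn n) (Rn n))] at h1
  exact h1

theorem integrable_coordCovector {f : Rn n → ℂ} (hf : Integrable f) (k : Fin n) :
    Integrable fun ξ => coordCovector k (f ξ) :=
  (coordCovector k).integrable_comp hf

theorem integral_sum_coordCovector {f : Fin n → Rn n → ℂ} (hf : ∀ k, Integrable (f k)) :
    ∫ ξ, ∑ k, coordCovector k (f k ξ) = ∑ k, coordCovector k (∫ ξ, f k ξ) := by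
  rw [integral_finsetSum _ fun k _ => integrable_coordCovector (hf k) k]
  exact Finset.sum_congr rfl fun k _ => (coordCovector k).integral_comp_comm (hf k)

theorem hasFDerivAt_parametric_integral {Φ : Rn n × Rn n → ℂ} (hs : ContDiff ℝ ∞ Φ)
    (hd : LocallyDominated Φ) (hdx : ∀ k, LocallyDominated (dx k Φ)) (x₀ : Rn n) :
    HasFDerivAt (fun x => ∫ ξ, Φ (x, ξ)) (∑ k, coordCovector k (∫ ξ, dx k Φ (x₀, ξ))) x₀ := by
  choose g hg hgb using fun k => hdx k x₀
  have hi : ∀ k, Integrable fun ξ => dx k Φ (x₀, ξ) := fun k =>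
    (hdx k).integrable (contDiff_dx hs k).continuous x₀
  rw [← integral_sum_coordCovector hi]
  have h1 : ∀ x, AEStronglyMeasurable (fun ξ => Φ (x, ξ)) volume := fun x =>
    (hs.continuous.comp (Continuous.prodMk_right x)).aestronglyMeasurable
  have h2 : AEStronglyMeasurable (fun ξ => ∑ k, coordCovector k (dx k Φ (x₀, ξ))) volume := by
    refine Continuous.aestronglyMeasurable ?_
    exact continuous_finsetSum _ fun k _ => (coordCovector k).continuous.comp
      ((contDiff_dx hs k).continuous.comp (Continuous.prodMk_right x₀))
  have h3 : ∀ ξ, ∀ x ∈ Metric.closedBall x₀ 1,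
      ‖∑ k, coordCovector k (dx k Φ (x, ξ))‖ ≤ ∑ k, g k ξ := fun ξ x hx =>
    (norm_sum_le _ _).trans (Finset.sum_le_sum fun k _ =>
      (norm_coordCovector_apply_le k _).trans (hgb k x hx ξ))
  have h4 : Integrable (fun ξ => ∑ k, g k ξ) := integrable_finsetSum _ fun k _ => hg k
  exact hasFDerivAt_integral_of_dominated_of_fderiv_le (μ := volume) (𝕜 := ℝ)
    (F' := fun x ξ => ∑ k, coordCovector k (dx k Φ (x, ξ)))
    (Metric.closedBall_mem_nhds x₀ one_pos)
    (Eventually.of_forall h1) (hd.integrable hs.continuous x₀) h2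
    (Eventually.of_forall h3) h4
    (Eventually.of_forall fun ξ x _ => hasFDerivAt_section hs x ξ)

/-- Integrals over the second variable of functions in a class that is closed under derivatives in
the first variable and consists of locally dominated functions are smooth. -/
theorem contDiff_parametric_integral (F : Set (Rn n × Rn n → ℂ)) (hs : ∀ Φ ∈ F, ContDiff ℝ ∞ Φ)
    (hd : ∀ Φ ∈ F, LocallyDominated Φ) (hdx : ∀ Φ ∈ F, ∀ k, dx k Φ ∈ F) {Φ : Rn n × Rn n → ℂ}
    (hΦ : Φ ∈ F) : ContDiff ℝ ∞ fun x => ∫ ξ, Φ (x, ξ) := by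
  rw [contDiff_infty]
  intro i
  have hfd : ∀ Φ ∈ F, ∀ x₀, HasFDerivAt (fun x => ∫ ξ, Φ (x, ξ))
      (∑ k, coordCovector k (∫ ξ, dx k Φ (x₀, ξ))) x₀ := fun Φ hΦ =>
    hasFDerivAt_parametric_integral (hs Φ hΦ) (hd Φ hΦ) fun k => hd _ (hdx Φ hΦ k)
  induction i generalizing Φ with
  | zero =>
    simp only [Nat.cast_zero, contDiff_zero]
    exact Differentiable.continuous (𝕜 := ℝ) fun x => (hfd Φ hΦ x).differentiableAt
  | succ i ih =>
    rw [Nat.cast_succ, contDiff_succ_iff_fderiv]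
    refine ⟨fun x => (hfd Φ hΦ x).differentiableAt, by simp, ?_⟩
    rw [funext fun x => (hfd Φ hΦ x).fderiv]
    exact ContDiff.sum fun k _ => (coordCovector k).contDiff.comp (ih (hdx Φ hΦ k))

theorem pd_parametric_integral {Φ : Rn n × Rn n → ℂ} (hs : ContDiff ℝ ∞ Φ)
    (hd : LocallyDominated Φ) (hdx : ∀ k, LocallyDominated (dx k Φ)) (k : Fin n) (x : Rn n) :
    pd k (fun x => ∫ ξ, Φ (x, ξ)) x = ∫ ξ, dx k Φ (x, ξ) := by
  rw [pd, (hasFDerivAt_parametric_integral hs hd hdx x).fderiv]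
  simp [coordCovector, stdVec]

/-- The integrand of a pseudodifferential operator with symbol `b`, applied to `u`. -/
def symbolIntegrand (b : Rn n × Rn n → ℂ) (u : Rn n → ℂ) (p : Rn n × Rn n) : ℂ :=
  Complex.exp (Complex.I * ((inner ℝ p.1 p.2 : ℝ) : ℂ)) * b p * hat u p.2

theorem contDiff_hat {u : Rn n → ℂ} (hu : IsTest u) : ContDiff ℝ ∞ (hat u) := by
  have := (hatS hu.toSchwartz).smooth'
  have h2 := coe_hatS hu.toSchwartz
  rw [hu.coe_toSchwartz] at h2
  rw [← h2]
  exact this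

theorem contDiff_plane_wave :
    ContDiff ℝ ∞ fun p : Rn n × Rn n => Complex.exp (Complex.I * ((inner ℝ p.1 p.2 : ℝ) : ℂ)) :=
  Complex.contDiff_exp.comp (contDiff_const.mul
    (Complex.ofRealCLM.contDiff.comp (contDiff_fst.inner ℝ contDiff_snd)))

theorem contDiff_symbolIntegrand {b : Rn n × Rn n → ℂ} (hb : ContDiff ℝ ∞ b) {u : Rn n → ℂ}
    (hu : IsTest u) : ContDiff ℝ ∞ (symbolIntegrand b u) :=
  (contDiff_plane_wave.mul hb).mul ((contDiff_hat hu).comp contDiff_snd)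

theorem dx_symbolIntegrand {b : Rn n × Rn n → ℂ} (hb : ContDiff ℝ ∞ b) {u : Rn n → ℂ}
    (hu : IsTest u) (k : Fin n) :
    dx k (symbolIntegrand b u) = symbolIntegrand (symbolDeriv k b) u := by
  funext p
  have h0 : HasFDerivAt (fun p : Rn n × Rn n => Complex.I * ((inner ℝ p.1 p.2 : ℝ) : ℂ))
      (Complex.I • (Complex.ofRealCLM ∘L ((fderivInnerCLM ℝ (p.1, p.2)) ∘L
        ((ContinuousLinearMap.fst ℝ (Rn n) (Rn n)).prod
          (ContinuousLinearMap.snd ℝ (Rn n) (Rn n)))))) p :=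
    (Complex.ofRealCLM.hasFDerivAt.comp p (hasFDerivAt_fst.inner ℝ hasFDerivAt_snd)).const_mul _
  have h1 := h0.cexp
  have h2 := (hb.differentiable (by simp) p).hasFDerivAt
  have h3 : HasFDerivAt (fun p : Rn n × Rn n => hat u p.2) _ p :=
    HasFDerivAt.comp (g := hat u) p ((contDiff_hat hu).differentiable (by simp) p.2).hasFDerivAt
      hasFDerivAt_snd
  have h4 := (h1.fun_mul h2).fun_mul h3
  have h5 : HasFDerivAt (symbolIntegrand b u) _ p := h4
  rw [dx, h5.fderiv]
  have h6 : inner ℝ (stdVec k) p.2 = p.2 k := by rw [real_inner_comm, inner_stdVec]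
  simp only [symbolIntegrand, symbolDeriv, dx]
  simp [fderivInnerCLM_apply, h6]
  ring

theorem locallyDominated_symbolIntegrand {b : Rn n × Rn n → ℂ} {m : ℝ}
    (hb : ∀ K, IsCompact K → SymbolBound (K ×ˢ univ) 0 m b) {u : Rn n → ℂ}
    (hu : IsTest u) : LocallyDominated (symbolIntegrand b u) := by
  intro x₀
  obtain ⟨C, hC⟩ := hb _ (isCompact_closedBall x₀ 1)
  -- Strictness gives N - m > n, so growth of order m against decay of order N leaves an integrable
  -- majorant.
  obtain ⟨N, hN⟩ := exists_nat_gt (m + n)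
  obtain ⟨D, hD0, hD⟩ := hu.hat_decay N
  refine ⟨fun ξ => (|C| * D) * (1 + ‖ξ‖) ^ (-((N : ℝ) - m)), ?_, fun x hx ξ => ?_⟩
  · refine (integrable_one_add_norm (E := Rn n) ?_).const_mul _
    rw [finrank_euclideanSpace_fin]
    linarith
  · have h1 : (0 : ℝ) < 1 + ‖ξ‖ := by positivity
    rw [symbolIntegrand, norm_mul, norm_mul]
    have h2 : ‖Complex.exp (Complex.I * ((inner ℝ x ξ : ℝ) : ℂ))‖ = 1 := by
      rw [mul_comm]
      exact Complex.norm_exp_ofReal_mul_I _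
    have h3 : (1 + ‖ξ‖) ^ (-((N : ℝ) - m)) = (1 + ‖ξ‖) ^ m * ((1 + ‖ξ‖) ^ N)⁻¹ := by
      rw [← Real.rpow_natCast, ← Real.rpow_neg h1.le, ← Real.rpow_add h1]
      congr 1
      ring
    rw [h2, one_mul]
    dsimp only
    rw [h3]
    have h4 : ‖b (x, ξ)‖ ≤ |C| * (1 + ‖ξ‖) ^ m :=
      (hC (x, ξ) ⟨hx, mem_univ _⟩).trans
        (mul_le_mul_of_nonneg_right (le_abs_self C) (by positivity))
    calc ‖b (x, ξ)‖ * ‖hat u ξ‖ ≤ (|C| * (1 + ‖ξ‖) ^ m) * (D * ((1 + ‖ξ‖) ^ N)⁻¹) :=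
          mul_le_mul h4 (hD ξ) (norm_nonneg _) (by positivity)
      _ = _ := by ring

namespace SymbolAt

variable {W : Set (Rn n × Rn n)} {b : Rn n × Rn n → ℂ} {u : Rn n → ℂ}

theorem locallyDominated (hb : SymbolAt W b) (hu : IsTest u) :
    LocallyDominated (symbolIntegrand b u) := by
  obtain ⟨m, hm⟩ := hb.order
  exact locallyDominated_symbolIntegrand (fun K hK => hm K hK 0) hu

/-- The integrands whose symbol is in the class are closed under x-derivatives, because ∂_k acts on
the symbol through `symbolDeriv`. -/
theorem contDiff_integral (hb : SymbolAt W b) (hu : IsTest u) :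
    ContDiff ℝ ∞ fun x => ∫ ξ, symbolIntegrand b u (x, ξ) := by
  refine contDiff_parametric_integral {Φ | ∃ b, SymbolAt W b ∧ Φ = symbolIntegrand b u} ?_ ?_ ?_
    ⟨b, hb, rfl⟩
  · rintro _ ⟨b, hb, rfl⟩
    exact contDiff_symbolIntegrand hb.smooth hu
  · rintro _ ⟨b, hb, rfl⟩
    exact hb.locallyDominated hu
  · rintro _ ⟨b, hb, rfl⟩ k
    exact ⟨_, hb.symbolDeriv k, dx_symbolIntegrand hb.smooth hu k⟩

theorem pd_integral (hb : SymbolAt W b) (hu : IsTest u) (k : Fin n) (x : Rn n) :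
    pd k (fun x => ∫ ξ, symbolIntegrand b u (x, ξ)) x =
      ∫ ξ, symbolIntegrand (OscSum.symbolDeriv k b) u (x, ξ) := by
  rw [pd_parametric_integral (contDiff_symbolIntegrand hb.smooth hu) (hb.locallyDominated hu)
    (fun k => ?_), dx_symbolIntegrand hb.smooth hu]
  rw [dx_symbolIntegrand hb.smooth hu]
  exact (hb.symbolDeriv k).locallyDominated hu

end SymbolAt

theorem dx_kernel_mul {κ : Rn n × Rn n → ℂ} (hκ : ContDiff ℝ ∞ κ) {u : Rn n → ℂ}
    (hu : IsTest u) (k : Fin n) :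
    dx k (fun p => κ p * u p.2) = fun p => dx k κ p * u p.2 := by
  funext p
  have h3 : HasFDerivAt (fun p : Rn n × Rn n => u p.2) _ p :=
    HasFDerivAt.comp (g := u) p (hu.1.differentiable (by simp) p.2).hasFDerivAt hasFDerivAt_snd
  rw [dx, ((hκ.differentiable (by simp) p).hasFDerivAt.fun_mul h3).fderiv]
  simp [dx, mul_comm]

theorem locallyDominated_kernel_mul {κ : Rn n × Rn n → ℂ} (hκ : Continuous κ) {u : Rn n → ℂ}
    (hu : IsTest u) : LocallyDominated fun p => κ p * u p.2 := by
  intro x₀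
  obtain ⟨C, hC⟩ := ((isCompact_closedBall x₀ 1).prod hu.2).exists_bound_of_continuousOn
    hκ.continuousOn
  refine ⟨fun y => C * ‖u y‖, hu.integrable.norm.const_mul C, fun x hx y => ?_⟩
  by_cases hy : y ∈ tsupport u
  · simpa only [norm_mul] using mul_le_mul_of_nonneg_right (hC (x, y) ⟨hx, hy⟩) (norm_nonneg _)
  · simp [image_eq_zero_of_notMem_tsupport hy]

theorem contDiff_kernel_integral {κ : Rn n × Rn n → ℂ} (hκ : ContDiff ℝ ∞ κ) {u : Rn n → ℂ}
    (hu : IsTest u) : ContDiff ℝ ∞ fun x => ∫ y, κ (x, y) * u y := by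
  refine contDiff_parametric_integral {Φ | ∃ κ, ContDiff ℝ ∞ κ ∧ Φ = fun p => κ p * u p.2} ?_ ?_ ?_
    ⟨κ, hκ, rfl⟩
  · rintro _ ⟨κ, hκ, rfl⟩
    exact hκ.mul (hu.1.comp contDiff_snd)
  · rintro _ ⟨κ, hκ, rfl⟩
    exact locallyDominated_kernel_mul hκ.continuous hu
  · rintro _ ⟨κ, hκ, rfl⟩ k
    exact ⟨_, contDiff_dx hκ k, dx_kernel_mul hκ hu k⟩

theorem pd_kernel_integral {κ : Rn n × Rn n → ℂ} (hκ : ContDiff ℝ ∞ κ) {u : Rn n → ℂ}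
    (hu : IsTest u) (k : Fin n) (x : Rn n) :
    pd k (fun x => ∫ y, κ (x, y) * u y) x = ∫ y, dx k κ (x, y) * u y := by
  have := pd_parametric_integral (Φ := fun p => κ p * u p.2) (hκ.mul (hu.1.comp contDiff_snd))
    (locallyDominated_kernel_mul hκ.continuous hu) (fun k => ?_) k x
  · simpa only [dx_kernel_mul hκ hu] using this
  · have := locallyDominated_kernel_mul (contDiff_dx hκ k).continuous hu
    rwa [← dx_kernel_mul hκ hu] at this

end ParametricIntegrals

end OscSum

end

open MeasureTheory Filter Topology Set
open scoped ContDiff ENNReal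

noncomputable section

namespace OscSum

/-! ### Rapid decay away from the support of the amplitude -/

section OffDiagonal

variable {n : ℕ}

theorem norm_symbolIntegrand (b : Rn n × Rn n → ℂ) (u : Rn n → ℂ) (x ξ : Rn n) :
    ‖symbolIntegrand b u (x, ξ)‖ = ‖b (x, ξ)‖ * ‖hat u ξ‖ := by
  have h2 : ‖Complex.exp (Complex.I * ((inner ℝ x ξ : ℝ) : ℂ))‖ = 1 := by
    rw [mul_comm]
    exact Complex.norm_exp_ofReal_mul_I _
  rw [symbolIntegrand, norm_mul, norm_mul, h2, one_mul]

/-- The weight (1 + |ξ|)^{-(n+1)} is integrable, so a pointwise bound with it integrates to a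
multiple of μ. -/
theorem norm_integral_symbolIntegrand_le {α : Type*} {p : α → Rn n → Prop}
    {b : Rn n × Rn n → ℂ} {u : α → Rn n → ℂ} {μ : α → ℝ} (hμ : ∀ a, 0 ≤ μ a)
    (h : ∃ C : ℝ, ∀ a x, p a x → ∀ ξ, ‖b (x, ξ)‖ * ‖hat (u a) ξ‖ ≤
      C * μ a * (1 + ‖ξ‖) ^ (-((n : ℝ) + 1))) :
    ∃ C : ℝ, 0 ≤ C ∧ ∀ a x, p a x → ‖∫ ξ, symbolIntegrand b (u a) (x, ξ)‖ ≤ C * μ a := by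
  obtain ⟨C, hC⟩ := h
  set J : ℝ := ∫ ξ : Rn n, (1 + ‖ξ‖) ^ (-((n : ℝ) + 1)) with hJ
  have hJ0 : 0 ≤ J := integral_nonneg fun ξ => by positivity
  refine ⟨|C| * J, by positivity, fun a x hx => ?_⟩
  have hint : Integrable fun ξ : Rn n => (1 + ‖ξ‖) ^ (-((n : ℝ) + 1)) :=
    integrable_one_add_norm (by rw [finrank_euclideanSpace_fin]; linarith)
  refine (norm_integral_le_of_norm_le (hint.const_mul (|C| * μ a))
    (Eventually.of_forall fun ξ => ?_)).trans (le_of_eq ?_)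
  · rw [norm_symbolIntegrand]
    refine (hC a x hx ξ).trans ?_
    have := hμ a
    gcongr
    exact le_abs_self C
  · rw [integral_const_mul, ← hJ]
    ring

/-- The order of the symbol estimates is `m`, locally uniformly in the position variable. -/
def HasOrder (m : ℝ) (f : Rn n × Rn n → ℂ) : Prop :=
  ContDiff ℝ ∞ f ∧ ∀ K, IsCompact K → ∀ l, SymbolBound (K ×ˢ univ) l m f

theorem HasOrder.dξ {m : ℝ} {f : Rn n × Rn n → ℂ} (hf : HasOrder m f) (k : Fin n) :
    HasOrder (m - 1) (dξ k f) :=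
  ⟨contDiff_dξ hf.1 k, fun K hK l => (hf.2 K hK (l + 1)).2.2 k⟩

theorem HasOrder.integrable {m : ℝ} {f : Rn n × Rn n → ℂ} (hf : HasOrder m f) {u : Rn n → ℂ}
    (hu : IsTest u) (x : Rn n) : Integrable fun ξ => symbolIntegrand f u (x, ξ) :=
  (locallyDominated_symbolIntegrand (fun K hK => hf.2 K hK 0) hu).integrable
    (contDiff_symbolIntegrand hf.1 hu).continuous x

theorem isTest_coord_mul {u : Rn n → ℂ} (hu : IsTest u) (x : Rn n) (k : Fin n) :
    IsTest fun y => (((x - y) k : ℝ) : ℂ) * u y := by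
  refine ⟨ContDiff.mul ?_ hu.1, hu.2.mul_left⟩
  exact (Complex.ofRealCLM ∘L (EuclideanSpace.proj k : Rn n →L[ℝ] ℝ)).contDiff.comp
    (contDiff_const.sub contDiff_id)

theorem hat_coord_mul {u : Rn n → ℂ} (hu : IsTest u) (x : Rn n) (k : Fin n) (ξ : Rn n) :
    hat (fun y => (((x - y) k : ℝ) : ℂ) * u y) ξ =
      ((x k : ℝ) : ℂ) * hat u ξ - Complex.I * pd k (hat u) ξ := by
  have h0 := pd_hat hu.toSchwartz k ξ
  rw [hu.coe_toSchwartz] at h0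
  have hyu : IsTest fun y => ((y k : ℝ) : ℂ) * u y :=
    ⟨((Complex.ofRealCLM ∘L (EuclideanSpace.proj k : Rn n →L[ℝ] ℝ)).contDiff).mul hu.1,
      hu.2.mul_left⟩
  have h1 : (fun y => (((x - y) k : ℝ) : ℂ) * u y) =
      fun y => ((x k : ℝ) : ℂ) * u y + (-1) * (((y k : ℝ) : ℂ) * u y) := by
    funext y
    simp
    ring
  have h2 : (fun y => -Complex.I * ((y k : ℝ) : ℂ) * u y) =
      fun y => -Complex.I * (((y k : ℝ) : ℂ) * u y) := by
    funext y
    ring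
  rw [h2, hat_const_mul] at h0
  rw [h1, hat_add (hu.integrable.const_mul _) (hyu.integrable.const_mul _), hat_const_mul,
    hat_const_mul, h0]
  linear_combination (-hat (fun y => ((y k : ℝ) : ℂ) * u y) ξ) * Complex.I_sq

theorem fderiv_snd_stdVec {f : Rn n × Rn n → ℂ} (hf : ContDiff ℝ ∞ f) (x ξ : Rn n) (k : Fin n) :
    fderiv ℝ (fun η => f (x, η)) ξ (stdVec k) = dξ k f (x, ξ) := by
  have h1 : HasFDerivAt (fun η => f (x, η))
      ((fderiv ℝ f (x, ξ)) ∘L ContinuousLinearMap.inr ℝ (Rn n) (Rn n)) ξ :=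
    HasFDerivAt.comp (g := f) ξ (hf.differentiable (by simp) (x, ξ)).hasFDerivAt
      (hasFDerivAt_prodMk_right x ξ)
  rw [h1.fderiv]
  rfl

/-- Integration by parts in the momentum variable trades a factor `x_k - y_k` in the amplitude for
a derivative of the symbol. -/
theorem integral_symbolIntegrand_coord_mul {m : ℝ} {f : Rn n × Rn n → ℂ} (hf : HasOrder m f)
    {u : Rn n → ℂ} (hu : IsTest u) (x : Rn n) (k : Fin n) :
    ∫ ξ, symbolIntegrand f (fun y => (((x - y) k : ℝ) : ℂ) * u y) (x, ξ) =
      Complex.I * ∫ ξ, symbolIntegrand (dξ k f) u (x, ξ) := by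
  set e : Rn n → ℂ := fun ξ => Complex.exp (Complex.I * ((inner ℝ x ξ : ℝ) : ℂ)) with he
  have hes : ContDiff ℝ ∞ e := contDiff_plane_wave.comp (contDiff_prodMk_right x)
  have hpe : ∀ ξ, pd k e ξ = Complex.I * ((x k : ℝ) : ℂ) * e ξ := by
    intro ξ
    have h0 : HasFDerivAt (fun η : Rn n => Complex.I * ((inner ℝ x η : ℝ) : ℂ))
        (Complex.I • (Complex.ofRealCLM ∘L (innerSL ℝ x))) ξ :=
      (Complex.ofRealCLM ∘L (innerSL ℝ x)).hasFDerivAt.const_mul _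
    rw [pd, h0.cexp.fderiv]
    simp [he, inner_stdVec]
    ring
  have hgs : ContDiff ℝ ∞ fun ξ => e ξ * hat u ξ := hes.mul (contDiff_hat hu)
  have hfs : ContDiff ℝ ∞ fun ξ => f (x, ξ) := hf.1.comp (contDiff_prodMk_right x)
  -- The derivative produces the factor i x_k from the plane wave and -i y_k under the transform,
  -- and together they give i(x - y)_k.
  have hg' : ∀ ξ, fderiv ℝ (fun ξ => e ξ * hat u ξ) ξ (stdVec k) =
      Complex.I * (e ξ * hat (fun y => (((x - y) k : ℝ) : ℂ) * u y) ξ) := by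
    intro ξ
    have := pd_mul (hes.differentiable (by simp) ξ)
      ((contDiff_hat hu).differentiable (by simp) ξ) k
    rw [pd] at this
    rw [this, hpe, hat_coord_mul hu]
    linear_combination (e ξ * pd k (hat u) ξ) * Complex.I_sq
  have i1 : (fun ξ => fderiv ℝ (fun η => f (x, η)) ξ (stdVec k) * (e ξ * hat u ξ)) =
      fun ξ => symbolIntegrand (dξ k f) u (x, ξ) := by
    funext ξ
    rw [fderiv_snd_stdVec hf.1]
    simp only [symbolIntegrand, he]
    ring
  have i2 : (fun ξ => f (x, ξ) * fderiv ℝ (fun ξ => e ξ * hat u ξ) ξ (stdVec k)) =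
      fun ξ => Complex.I * symbolIntegrand f (fun y => (((x - y) k : ℝ) : ℂ) * u y) (x, ξ) := by
    funext ξ
    rw [hg']
    simp only [symbolIntegrand, he]
    ring
  have i3 : (fun ξ => f (x, ξ) * (e ξ * hat u ξ)) = fun ξ => symbolIntegrand f u (x, ξ) := by
    funext ξ
    simp only [symbolIntegrand, he]
    ring
  have key := integral_mul_fderiv_eq_neg_fderiv_mul_of_integrable (μ := volume)
    (f := fun η => f (x, η)) (g := fun ξ => e ξ * hat u ξ) (v := stdVec k)
    (by rw [i1]; exact (hf.dξ k).integrable hu x)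
    (by rw [i2]; exact (hf.integrable (isTest_coord_mul hu x k) x).const_mul _)
    (by rw [i3]; exact hf.integrable hu x)
    (fun ξ _ => hfs.differentiable (by simp) ξ) (fun ξ _ => hgs.differentiable (by simp) ξ)
  rw [i1, i2, integral_const_mul] at key
  linear_combination (-Complex.I) * key +
    (∫ ξ, symbolIntegrand f (fun y => (((x - y) k : ℝ) : ℂ) * u y) (x, ξ)) * Complex.I_sq

/-- A smooth extension of `z ↦ z_k / |z|²` from the set where `|z| ≥ r`. -/
def coordQuotient (r : ℝ) (k : Fin n) (z : Rn n) : ℂ := ((z k * invCut (r ^ 2) (‖z‖ ^ 2) : ℝ) : ℂ)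

theorem contDiff_coordQuotient {r : ℝ} (hr : 0 < r) (k : Fin n) :
    ContDiff ℝ ∞ (coordQuotient r k : Rn n → ℂ) := by
  refine Complex.ofRealCLM.contDiff.comp (ContDiff.mul ?_ ?_)
  · exact (EuclideanSpace.proj k : Rn n →L[ℝ] ℝ).contDiff
  · exact (contDiff_invCut (by positivity)).comp (contDiff_norm_sq ℝ)

theorem sum_coord_mul_coordQuotient {r : ℝ} (hr : 0 < r) {z : Rn n} (hz : r ≤ ‖z‖) :
    ∑ k, ((z k : ℝ) : ℂ) * coordQuotient r k z = 1 := by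
  have h1 : r ^ 2 ≤ ‖z‖ ^ 2 := by gcongr
  have h2 : (‖z‖ ^ 2 : ℝ) ≠ 0 := by
    have : 0 < r ^ 2 := by positivity
    linarith
  simp only [coordQuotient, invCut_of_le (by positivity : 0 < r ^ 2) h1, ← Complex.ofReal_mul,
    ← Complex.ofReal_sum]
  rw [← Complex.ofReal_one, Complex.ofReal_inj]
  have h3 : ∑ k, z k * (z k * (‖z‖ ^ 2)⁻¹) = (∑ k, z k ^ 2) * (‖z‖ ^ 2)⁻¹ := by
    rw [Finset.sum_mul]
    exact Finset.sum_congr rfl fun k _ => by ring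
  rw [h3, ← EuclideanSpace.real_norm_sq_eq, mul_inv_cancel₀ h2]

variable {β : Type*} {K : Set (Rn n)} {δ c : ℝ} {lam : β → ℝ} {W : β → Rn n → ℂ}

/-- A pseudodifferential operator applied to an oscillatory function is rapidly decreasing away
from the support of the amplitude. -/
theorem norm_integral_symbolIntegrand_le_of_separated (hD : OscData K δ lam W) (hc : 0 < c)
    (hg : ∀ a, ∀ x ∈ K, c ≤ ‖reGrad (W a) x‖) {Kx : Set (Rn n)} (hKx : IsCompact Kx)
    {x : β → Rn n} (hx : ∀ a, x a ∈ Kx) {r : ℝ} (hr : 0 < r) (N : ℕ) {m : ℝ}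
    {f : Rn n × Rn n → ℂ} (hf : HasOrder m f) {v : β → Rn n → ℂ}
    (hv : USmooth K (fun a => lam a ^ δ) v) (hs : ∀ a, tsupport (v a) ⊆ K)
    (hsep : ∀ a, ∀ y ∈ tsupport (v a), r ≤ ‖x a - y‖) :
    ∃ C : ℝ, 0 ≤ C ∧ ∀ a, ‖∫ ξ, symbolIntegrand f (osc (lam a) (W a) (v a)) (x a, ξ)‖ ≤
      C * (lam a ^ N)⁻¹ := by
  -- j integrations by parts bring the order down to at most -(N + n + 1). This pays for the growth
  -- (1 + |ξ|)^N in the bound on the transform and leaves the integrable weight.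
  obtain ⟨j, hj⟩ := exists_nat_ge (m + (N + n + 1))
  replace hj : m ≤ j - (N + n + 1) := by linarith
  induction j generalizing m f v with
  | zero =>
    obtain ⟨D, hD0, hDb⟩ := norm_hat_osc_le_poly hD.compact hD.δ_nonneg hD.δ_lt hD.one_le hD.phase
      hD.im_nonneg hv hs hc hg N
    obtain ⟨C, hC⟩ := hf.2 Kx hKx 0
    have hbd : ∃ C : ℝ, ∀ a y, y = x a → ∀ ξ, ‖f (y, ξ)‖ * ‖hat (osc (lam a) (W a) (v a)) ξ‖ ≤
        C * (lam a ^ N)⁻¹ * (1 + ‖ξ‖) ^ (-((n : ℝ) + 1)) := by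
      refine ⟨|C| * D, ?_⟩
      rintro a _ rfl ξ
      have h1 : (1 : ℝ) ≤ 1 + ‖ξ‖ := by linarith [norm_nonneg ξ]
      have h0 : (0 : ℝ) < 1 + ‖ξ‖ := by linarith
      have hl : 0 ≤ (lam a ^ N)⁻¹ := inv_nonneg.2 (pow_nonneg (zero_le_one.trans (hD.one_le a)) N)
      have h2 : ‖f (x a, ξ)‖ ≤ |C| * (1 + ‖ξ‖) ^ (-(N + n + 1 : ℝ)) := by
        refine (hC (x a, ξ) ⟨hx a, mem_univ _⟩).trans ?_
        refine mul_le_mul (le_abs_self C) (Real.rpow_le_rpow_of_exponent_le h1 ?_)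
          (by positivity) (abs_nonneg C)
        simpa using hj
      calc ‖f (x a, ξ)‖ * ‖hat (osc (lam a) (W a) (v a)) ξ‖
          ≤ (|C| * (1 + ‖ξ‖) ^ (-(N + n + 1 : ℝ))) * (D * (lam a ^ N)⁻¹ * (1 + ‖ξ‖) ^ N) :=
            mul_le_mul h2 (hDb a ξ) (norm_nonneg _) (by positivity)
        _ = |C| * D * (lam a ^ N)⁻¹ * ((1 + ‖ξ‖) ^ (-(N + n + 1 : ℝ)) * (1 + ‖ξ‖) ^ N) := by ring
        _ = _ := by
            rw [← Real.rpow_natCast (1 + ‖ξ‖) N, ← Real.rpow_add h0]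
            congr 2
            ring
    obtain ⟨E, hE0, hE⟩ := norm_integral_symbolIntegrand_le
      (fun a => inv_nonneg.2 (pow_nonneg (zero_le_one.trans (hD.one_le a)) N)) hbd
    exact ⟨E, hE0, fun a => hE a (x a) rfl⟩
  | succ j ih =>
    -- On the support of v, where |x - y| ≥ r, this writes v as ∑ (x - y)_k v'_k. Each factor (x -
    -- y)_k is then exchanged for a ξ-derivative of the symbol.
    set v' : Fin n → β → Rn n → ℂ := fun k a y => coordQuotient r k (x a - y) * v a y with hv'
    have hsub : USmooth K (fun _ => 1) fun a y => x a - y := by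
      obtain ⟨B, hB⟩ := hKx.isBounded.exists_norm_le
      have := (USmooth.const (K := K) (fun a => hB _ (hx a))).add
        (USmooth.fixed (α := β) (contDiff_neg (𝕜 := ℝ) (F := Rn n) (n := ∞))
          hD.compact.isBounded)
      simpa only [sub_eq_add_neg] using this
    have h1 : ∀ a, 1 ≤ lam a ^ δ := fun a => Real.one_le_rpow (hD.one_le a) hD.δ_nonneg
    have hvk : ∀ k, USmooth K (fun a => lam a ^ δ) (v' k) := fun k =>
      ((hsub.comp (contDiff_coordQuotient hr k)).mono subset_rfl (fun _ => zero_le_one) h1).mul hv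
        fun a => zero_le_one.trans (h1 a)
    have hsk : ∀ k a, tsupport (v' k a) ⊆ tsupport (v a) := fun k a => tsupport_mul_subset_right
    choose C hC0 hC using fun k => ih (hf.dξ k) (hvk k) (fun a => (hsk k a).trans (hs a))
      (fun a y hy => hsep a y (hsk k a hy)) (by push_cast at hj; linarith)
    refine ⟨∑ k, C k, Finset.sum_nonneg fun k _ => hC0 k, fun a => ?_⟩
    have ht : ∀ k, IsTest (osc (lam a) (W a) (v' k a)) := fun k =>
      hD.isTest (hvk k) (fun a => (hsk k a).trans (hs a)) a
    have hdec : osc (lam a) (W a) (v a) = fun y => ∑ k, (((x a - y) k : ℝ) : ℂ) *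
        osc (lam a) (W a) (v' k a) y := by
      funext y
      by_cases hy : y ∈ tsupport (v a)
      · have := sum_coord_mul_coordQuotient hr (hsep a y hy)
        calc osc (lam a) (W a) (v a) y
            = (∑ k, (((x a - y) k : ℝ) : ℂ) * coordQuotient r k (x a - y)) *
              osc (lam a) (W a) (v a) y := by rw [this, one_mul]
          _ = _ := by
              rw [Finset.sum_mul]
              refine Finset.sum_congr rfl fun k _ => ?_
              simp only [osc, hv']
              ring
      · simp [osc, hv', image_eq_zero_of_notMem_tsupport hy]
    have hsum : ∫ ξ, symbolIntegrand f (osc (lam a) (W a) (v a)) (x a, ξ) =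
        ∑ k, Complex.I * ∫ ξ, symbolIntegrand (dξ k f) (osc (lam a) (W a) (v' k a)) (x a, ξ) := by
      simp only [← integral_symbolIntegrand_coord_mul hf (ht _)]
      rw [← integral_finsetSum _ fun k _ => hf.integrable (isTest_coord_mul (ht k) (x a) k) (x a)]
      congr 1
      funext ξ
      simp only [symbolIntegrand]
      rw [hdec, hat_sum _ fun k _ => (isTest_coord_mul (ht k) (x a) k).integrable, Finset.mul_sum]
    rw [hsum, Finset.sum_mul]
    refine (norm_sum_le _ _).trans (Finset.sum_le_sum fun k _ => ?_)
    rw [norm_mul, Complex.norm_I, one_mul]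
    exact hC k a

/-- Integral operators with smooth kernels map oscillatory functions to rapidly decreasing
functions of the frequency. -/
theorem norm_kernel_integral_le (hD : OscData K δ lam W) (hc : 0 < c)
    (hg : ∀ a, ∀ x ∈ K, c ≤ ‖reGrad (W a) x‖) {κ : Rn n × Rn n → ℂ} (hκ : ContDiff ℝ ∞ κ)
    {v : β → Rn n → ℂ} (hv : USmooth K (fun a => lam a ^ δ) v) (hs : ∀ a, tsupport (v a) ⊆ K)
    {Kx : Set (Rn n)} (hKx : IsCompact Kx) (N : ℕ) :
    ∃ C : ℝ, 0 ≤ C ∧ ∀ a, ∀ x ∈ Kx,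
      ‖∫ y, κ (x, y) * osc (lam a) (W a) (v a) y‖ ≤ C * (lam a ^ N)⁻¹ := by
  have h1 : ∀ a, 1 ≤ lam a ^ δ := fun a => Real.one_le_rpow (hD.one_le a) hD.δ_nonneg
  have hk : USmooth K (fun _ => 1) fun (q : β × Kx) y => κ ((q.2 : Rn n), y) := by
    obtain ⟨B, hB⟩ := hKx.isBounded.exists_norm_le
    have h2 : USmooth K (fun _ => 1) fun (q : β × Kx) y => ((q.2 : Rn n), y) := by
      have := (USmooth.const (K := K) (α := β × Kx) (c := fun q => ((q.2 : Rn n), (0 : Rn n)))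
        (B := B) (fun q => by simpa [Prod.norm_def] using hB _ q.2.2)).add
        (USmooth.fixed (α := β × Kx) (ContinuousLinearMap.inr ℝ (Rn n) (Rn n)).contDiff
          hD.compact.isBounded)
      simpa using this
    exact h2.comp hκ
  -- The kernel becomes part of the amplitude, with x as an additional index. The integral is then a
  -- Fourier transform at frequency 0.
  have hkv : USmooth K (fun q : β × Kx => lam q.1 ^ δ) fun q y => κ ((q.2 : Rn n), y) * v q.1 y :=
    (hk.mono subset_rfl (fun _ => zero_le_one) fun q => h1 q.1).mul (hv.reindex Prod.fst)
      fun q => zero_le_one.trans (h1 q.1)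
  obtain ⟨C, hC0, hC⟩ := norm_hat_osc_le_poly hD.compact hD.δ_nonneg hD.δ_lt
    (fun q : β × Kx => hD.one_le q.1) (hD.phase.reindex Prod.fst) (fun q => hD.im_nonneg q.1) hkv
    (fun q => tsupport_mul_subset_right.trans (hs q.1)) hc (fun q => hg q.1) N
  refine ⟨C, hC0, fun a x hx => ?_⟩
  have := hC (a, ⟨x, hx⟩) 0
  simp only [norm_zero, add_zero, one_pow, mul_one] at this
  convert this using 2
  simp only [hat, osc, inner_zero_right]
  congr 1
  funext y
  simp
  ring

end OffDiagonal

end OscSum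

end

open MeasureTheory Filter Topology Set
open scoped ContDiff ENNReal

noncomputable section

namespace OscSum

/-! ### Operators whose wave front set misses Γ -/

section Microlocal

variable {ι : Type*} {n M : ℕ} {δ ϱ : ℝ} {w : ι → ℝ → Rn n → ℂ}
  {φ : ι → ℝ → Fin (M + 1) → Rn n → ℂ} {c : ℝ} {i₀ : Fin n} {R : ℝ}

namespace OscFamily

/-- The product of the symbol `b` over the ball of radius `ρ` about `x₀` and the Fourier transform
of the family, localized to that ball, is rapidly decreasing at the frequencies in `V`. -/
def NearBound (δ ϱ : ℝ) (w : ι → ℝ → Rn n → ℂ) (φ : ι → ℝ → Fin (M + 1) → Rn n → ℂ)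
    (b : Rn n × Rn n → ℂ) (N : ℕ) (x₀ : Rn n) (ρ : ℝ) (V : Set (Rn n)) : Prop :=
  ∀ χ : Rn n → ℂ, IsTest χ → tsupport χ ⊆ Metric.closedBall x₀ ρ →
    ∃ C : ℝ, 0 ≤ C ∧ ∃ L : ℝ, 1 ≤ L ∧ ∀ a : Idx ι, L ≤ a.2 → ∀ x ∈ Metric.closedBall x₀ ρ,
      ∀ ξ ∈ V, ‖b (x, ξ)‖ * ‖hat (osc a.2 (w a.1 a.2) (fun y => χ y * amp δ ϱ φ a y)) ξ‖ ≤
        C * ((a.2 : ℝ) ^ N)⁻¹ * (1 + ‖ξ‖) ^ (-((n : ℝ) + 1))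

theorem NearBound.mono {b : Rn n × Rn n → ℂ} {N : ℕ} {x₀ : Rn n} {ρ ρ' : ℝ} {V V' : Set (Rn n)}
    (h : NearBound δ ϱ w φ b N x₀ ρ V) (hρ : ρ' ≤ ρ) (hV : V' ⊆ V) :
    NearBound δ ϱ w φ b N x₀ ρ' V' := by
  intro χ hχ hs
  obtain ⟨C, hC, L, hL, H⟩ := h χ hχ (hs.trans (Metric.closedBall_subset_closedBall hρ))
  exact ⟨C, hC, L, hL, fun a ha x hx ξ hξ =>
    H a ha x (Metric.closedBall_subset_closedBall hρ hx) ξ (hV hξ)⟩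

theorem NearBound.union {b : Rn n × Rn n → ℂ} {N : ℕ} {x₀ : Rn n} {ρ : ℝ} {V V' : Set (Rn n)}
    (h : NearBound δ ϱ w φ b N x₀ ρ V) (h' : NearBound δ ϱ w φ b N x₀ ρ V') :
    NearBound δ ϱ w φ b N x₀ ρ (V ∪ V') := by
  intro χ hχ hs
  obtain ⟨C, hC, L, hL, H⟩ := h χ hχ hs
  obtain ⟨C', hC', L', _, H'⟩ := h' χ hχ hs
  refine ⟨max C C', le_max_of_le_left hC, max L L', le_max_of_le_left hL,
    fun a ha x hx ξ hξ => ?_⟩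
  have hp : 0 ≤ ((a.2 : ℝ) ^ N)⁻¹ := inv_nonneg.2 (pow_nonneg (zero_le_one.trans a.2.2) N)
  rcases hξ with hξ | hξ
  · refine (H a ((le_max_left _ _).trans ha) x hx ξ hξ).trans ?_
    gcongr
    exact le_max_left _ _
  · refine (H' a ((le_max_right _ _).trans ha) x hx ξ hξ).trans ?_
    gcongr
    exact le_max_right _ _

/-- Fourier transforms of localized families are bounded by negative powers of `λ` times powers of
the frequency. -/
theorem norm_hat_cut_le_poly (H : OscFamily δ ϱ w φ c i₀ R) {χ : Rn n → ℂ} (hχ : ContDiff ℝ ∞ χ)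
    (N : ℕ) : ∃ C : ℝ, 0 ≤ C ∧ ∀ (a : Idx ι) ξ,
      ‖hat (osc a.2 (w a.1 a.2) (fun x => χ x * amp δ ϱ φ a x)) ξ‖ ≤
        C * ((a.2 : ℝ) ^ N)⁻¹ * (1 + ‖ξ‖) ^ N := by
  have hD := H.oscData (isCompact_ball n R)
  exact norm_hat_osc_le_poly hD.compact hD.δ_nonneg hD.δ_lt hD.one_le hD.phase hD.im_nonneg
    (H.cut_amp_uSmooth hχ) (H.tsupport_cut_amp χ) H.c_pos
    (fun a x _ => H.grad_ge a.1 a.2 a.2.2 x) N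

theorem nearBound_zero (H : OscFamily δ ϱ w φ c i₀ R) {b : Rn n × Rn n → ℂ} (hb : Continuous b)
    (N : ℕ) (x₀ : Rn n) (ρ : ℝ) : NearBound δ ϱ w φ b N x₀ ρ {0} := by
  intro χ hχ _
  obtain ⟨D, hD0, hD⟩ := H.norm_hat_cut_le_poly hχ.1 N
  obtain ⟨C, hC⟩ := (isCompact_closedBall x₀ ρ).exists_bound_of_continuousOn
    (f := fun x => b (x, 0)) (hb.comp (by fun_prop)).continuousOn
  refine ⟨|C| * D, by positivity, 1, le_rfl, ?_⟩
  rintro a _ x hx _ rfl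
  have := hD a 0
  simp only [norm_zero, add_zero, one_pow, mul_one, Real.one_rpow] at this ⊢
  rw [mul_assoc]
  exact mul_le_mul ((hC x hx).trans (le_abs_self C)) this (norm_nonneg _) (abs_nonneg C)

/-- The bound near directions in which the symbol has order `-∞`. -/
theorem nearBound_of_rapid (H : OscFamily δ ϱ w φ c i₀ R) {b : Rn n × Rn n → ℂ} (N : ℕ)
    {x₀ : Rn n} {ρ : ℝ} {V : Set (Rn n)}
    (hb : ∀ m : ℝ, SymbolBound (conicSet (Metric.closedBall x₀ ρ) V) 0 m b) :
    NearBound δ ϱ w φ b N x₀ ρ {ξ | ∃ η ∈ V, ∃ t : ℝ, 0 < t ∧ ξ = t • η} := by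
  intro χ hχ _
  obtain ⟨D, hD0, hD⟩ := H.norm_hat_cut_le_poly hχ.1 N
  obtain ⟨C, hC⟩ := hb (-(N + n + 1 : ℝ))
  refine ⟨|C| * D, by positivity, 1, le_rfl, fun a _ x hx ξ hξ => ?_⟩
  have hp : 0 ≤ ((a.2 : ℝ) ^ N)⁻¹ := inv_nonneg.2 (pow_nonneg (zero_le_one.trans a.2.2) N)
  have h0 : (0 : ℝ) < 1 + ‖ξ‖ := by positivity
  have h1 : ‖b (x, ξ)‖ ≤ |C| * (1 + ‖ξ‖) ^ (-(N + n + 1 : ℝ)) :=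
    (hC (x, ξ) ⟨hx, hξ⟩).trans (mul_le_mul_of_nonneg_right (le_abs_self C) (by positivity))
  calc _ ≤ (|C| * (1 + ‖ξ‖) ^ (-(N + n + 1 : ℝ))) * (D * ((a.2 : ℝ) ^ N)⁻¹ * (1 + ‖ξ‖) ^ N) :=
        mul_le_mul h1 (hD a ξ) (norm_nonneg _) (by positivity)
    _ = |C| * D * ((a.2 : ℝ) ^ N)⁻¹ * ((1 + ‖ξ‖) ^ (-(N + n + 1 : ℝ)) * (1 + ‖ξ‖) ^ N) := by ring
    _ = _ := by
        rw [← Real.rpow_natCast (1 + ‖ξ‖) N, ← Real.rpow_add h0]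
        congr 2
        ring

/-- The bound near directions away from the cone of the family. -/
theorem nearBound_of_disjoint (H : OscFamily δ ϱ w φ c i₀ R) {b : Rn n × Rn n → ℂ} {m : ℝ} (N : ℕ)
    {x₀ : Rn n} {ρ : ℝ} {V : Set (Rn n)} (hV : IsClosed V)
    (hVc : ∀ ξ ∈ V, ∀ t : ℝ, 0 < t → t • ξ ∈ V)
    (hb : SymbolBound (Metric.closedBall x₀ ρ ×ˢ univ) 0 m b)
    (hd : Disjoint (oscCone δ w φ) (Metric.closedBall x₀ ρ ×ˢ V)) :
    NearBound δ ϱ w φ b N x₀ ρ V := by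
  intro χ hχ hs
  obtain ⟨p, hp⟩ := exists_nat_ge m
  -- Of the decay in λ + |ξ|, N powers become λ^{-N}, p compensate the growth of the symbol, and n +
  -- 1 remain for integration.
  obtain ⟨D, hD0, L, hL, hD⟩ := H.norm_hat_cut_le hχ.1 hV hVc
    (hd.mono_right (prod_mono hs subset_rfl)) (N + (p + n + 1))
  obtain ⟨C, hC⟩ := hb
  refine ⟨|C| * D, by positivity, L, hL, fun a ha x hx ξ hξ => ?_⟩
  have hl : (1 : ℝ) ≤ a.2 := a.2.2
  have hl0 : (0 : ℝ) < a.2 := by linarith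
  have h1 : (1 : ℝ) ≤ 1 + ‖ξ‖ := by linarith [norm_nonneg ξ]
  have h0 : (0 : ℝ) < 1 + ‖ξ‖ := by linarith
  have h2 : ‖b (x, ξ)‖ ≤ |C| * (1 + ‖ξ‖) ^ p := by
    refine (hC (x, ξ) ⟨hx, mem_univ _⟩).trans ?_
    rw [← Real.rpow_natCast]
    exact mul_le_mul (le_abs_self C) (Real.rpow_le_rpow_of_exponent_le h1 hp) (by positivity)
      (abs_nonneg C)
  have h3 : (((a.2 : ℝ) + ‖ξ‖) ^ (N + (p + n + 1)))⁻¹ ≤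
      ((a.2 : ℝ) ^ N)⁻¹ * ((1 + ‖ξ‖) ^ (p + n + 1))⁻¹ := by
    rw [← mul_inv, pow_add]
    have := norm_nonneg ξ
    gcongr
    linarith
  calc _ ≤ (|C| * (1 + ‖ξ‖) ^ p) *
        (D * (((a.2 : ℝ) ^ N)⁻¹ * ((1 + ‖ξ‖) ^ (p + n + 1))⁻¹)) :=
        mul_le_mul h2 ((hD a ha ξ hξ).trans (mul_le_mul_of_nonneg_left h3 hD0)) (norm_nonneg _)
          (by positivity)
    _ = |C| * D * ((a.2 : ℝ) ^ N)⁻¹ * ((1 + ‖ξ‖) ^ p * ((1 + ‖ξ‖) ^ (p + n + 1))⁻¹) := by ring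
    _ = _ := by
        rw [← Real.rpow_natCast (1 + ‖ξ‖) p, ← Real.rpow_natCast (1 + ‖ξ‖) (p + n + 1),
          ← Real.rpow_neg h0.le, ← Real.rpow_add h0]
        congr 2
        push_cast
        ring

/-- The bound at all frequencies, for a symbol whose wave front set does not meet the cone of the
family. -/
theorem exists_nearBound (H : OscFamily δ ϱ w φ c i₀ R) {W : Set (Rn n × Rn n)}
    {b : Rn n × Rn n → ℂ} (hb : SymbolAt W b) (hd : Disjoint W (oscCone δ w φ)) (N : ℕ)
    (x₀ : Rn n) : ∃ ρ : ℝ, 0 < ρ ∧ NearBound δ ϱ w φ b N x₀ ρ univ := by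
  have hsphere : ∃ ρ : ℝ, 0 < ρ ∧ NearBound δ ϱ w φ b N x₀ ρ
      {ξ | ∃ η ∈ Metric.sphere (0 : Rn n) 1, ∃ t : ℝ, 0 < t ∧ ξ = t • η} := by
    -- Compactness of the sphere of directions produces one radius that works for all of them.
    refine (isCompact_sphere (0 : Rn n) 1).induction_on
      (p := fun s => ∃ ρ : ℝ, 0 < ρ ∧ NearBound δ ϱ w φ b N x₀ ρ
        {ξ | ∃ η ∈ s, ∃ t : ℝ, 0 < t ∧ ξ = t • η}) ?_ ?_ ?_ ?_
    · refine ⟨1, one_pos, fun χ _ _ => ⟨0, le_rfl, 1, le_rfl, ?_⟩⟩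
      rintro a _ x _ ξ ⟨η, hη, _⟩
      exact absurd hη (notMem_empty η)
    · rintro s t hst ⟨ρ, hρ, h⟩
      refine ⟨ρ, hρ, h.mono le_rfl ?_⟩
      rintro ξ ⟨η, hη, h⟩
      exact ⟨η, hst hη, h⟩
    · rintro s t ⟨ρ, hρ, h⟩ ⟨ρ', hρ', h'⟩
      refine ⟨min ρ ρ', lt_min hρ hρ', ((h.mono (min_le_left _ _) subset_rfl).union
        (h'.mono (min_le_right _ _) subset_rfl)).mono le_rfl ?_⟩
      rintro ξ ⟨η, hη | hη, h⟩
      · exact Or.inl ⟨η, hη, h⟩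
      · exact Or.inr ⟨η, hη, h⟩
    · intro θ hθ
      have hθ1 : ‖θ‖ = 1 := by simpa using hθ
      have hθ0 : θ ≠ 0 := by
        rintro rfl
        simp at hθ1
      -- If (x₀, θ) ∈ W it is outside Γ and the transform decreases rapidly near θ. If not, the
      -- symbol has order -∞ near (x₀, θ), and polynomial bounds on the transform suffice.
      by_cases hW : (x₀, θ) ∈ W
      · obtain ⟨r, hr, hrd⟩ := H.exists_coneNhd_disjoint (disjoint_left.1 hd hW)
        obtain ⟨m, hm⟩ := hb.order
        refine ⟨coneNhd θ r, mem_nhdsWithin_of_mem_nhds ?_, r, hr,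
          (H.nearBound_of_disjoint N (isClosed_coneNhd θ r)
            (fun ξ hξ t ht => smul_mem_coneNhd hξ ht) (hm _ (isCompact_closedBall x₀ r) 0)
            hrd).mono le_rfl ?_⟩
        · have ho : IsOpen {ξ : Rn n | ‖ξ - ‖ξ‖ • θ‖ < r * ‖ξ‖} :=
            isOpen_lt (by fun_prop) (by fun_prop)
          exact mem_of_superset (ho.mem_nhds (by simpa [hθ1] using hr)) fun ξ hξ =>
            le_of_lt (show ‖ξ - ‖ξ‖ • θ‖ < r * ‖ξ‖ from hξ)
        · rintro _ ⟨η, hη, t, ht, rfl⟩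
          exact smul_mem_coneNhd hη ht
      · obtain ⟨U, hU, V, hV, h⟩ := hb.rapid (x₀, θ) hθ0 hW
        obtain ⟨ρ, hρ, hρU⟩ := Metric.nhds_basis_closedBall.mem_iff.1 hU
        refine ⟨V, mem_nhdsWithin_of_mem_nhds hV, ρ, hρ, H.nearBound_of_rapid N fun m =>
          (h 0 m).mono_set ?_⟩
        rintro q ⟨hq, hq'⟩
        exact ⟨hρU hq, hq'⟩
  obtain ⟨ρ, hρ, h⟩ := hsphere
  -- The rays through the sphere cover every frequency except 0.
  refine ⟨ρ, hρ, (h.union (H.nearBound_zero hb.smooth.continuous N x₀ ρ)).mono le_rfl ?_⟩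
  intro ξ _
  by_cases hξ : ξ = 0
  · exact Or.inr hξ
  · refine Or.inl ⟨‖ξ‖⁻¹ • ξ, ?_, ‖ξ‖, norm_pos_iff.2 hξ, ?_⟩
    · simp [norm_smul, inv_mul_cancel₀ (norm_ne_zero_iff.2 hξ)]
    · rw [smul_inv_smul₀ (norm_ne_zero_iff.2 hξ)]

/-- A cutoff χ equal to 1 near x₀ splits the amplitude. The part χb is controlled frequency by
frequency through `NearBound`. The other part has support at a positive distance from x, and
pseudolocality gives the decay. -/
theorem exists_norm_symbol_integral_le_near (H : OscFamily δ ϱ w φ c i₀ R) {W : Set (Rn n × Rn n)}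
    {b : Rn n × Rn n → ℂ} (hb : SymbolAt W b) (hd : Disjoint W (oscCone δ w φ)) (N : ℕ)
    (x₀ : Rn n) : ∃ U ∈ 𝓝 x₀, ∃ C : ℝ, 0 ≤ C ∧ ∃ L : ℝ, 1 ≤ L ∧ ∀ a : Idx ι, L ≤ a.2 → ∀ x ∈ U,
      ‖∫ ξ, symbolIntegrand b (osc a.2 (w a.1 a.2) (amp δ ϱ φ a)) (x, ξ)‖ ≤
        C * ((a.2 : ℝ) ^ N)⁻¹ := by
  obtain ⟨ρ, hρ, hnear⟩ := H.exists_nearBound hb hd N x₀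
  obtain ⟨χ, hχ, hχ1, hχs⟩ := exists_isTest_eq_one x₀ (half_pos hρ)
  rw [mul_div_cancel₀ ρ two_ne_zero] at hχs
  have hχ' : ContDiff ℝ ∞ fun y => 1 - χ y := contDiff_const.sub hχ.1
  obtain ⟨C, hC, L, hL, hCL⟩ := hnear χ hχ hχs
  have hDat := H.oscData (isCompact_ball n R)
  set Kx := Metric.closedBall x₀ (ρ / 4) with hKx
  obtain ⟨m, hm⟩ := hb.order
  obtain ⟨D, hD0, hD⟩ := norm_integral_symbolIntegrand_le_of_separated
    (β := Idx ι × Kx) (lam := fun q => q.1.2) (W := fun q => w q.1.1 q.1.2)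
    ⟨hDat.compact, hDat.δ_nonneg, hDat.δ_lt, fun q => hDat.one_le q.1,
      hDat.phase.reindex Prod.fst, fun q => hDat.im_nonneg q.1⟩ H.c_pos
    (fun q x _ => H.grad_ge q.1.1 q.1.2 q.1.2.2 x) (isCompact_closedBall x₀ (ρ / 4))
    (x := fun q => q.2) (fun q => q.2.2) (r := ρ / 4) (by positivity) N (f := b)
    ⟨hb.smooth, hm⟩ (v := fun q y => (1 - χ y) * amp δ ϱ φ q.1 y)
    ((H.cut_amp_uSmooth hχ').reindex Prod.fst) (fun q => H.tsupport_cut_amp _ q.1) (by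
      rintro ⟨a, x, hx⟩ y hy
      -- 1 - χ vanishes within ρ / 2 of x₀ and x stays within ρ / 4, which leaves the gap r = ρ / 4.
      have h1 : ρ / 2 ≤ dist y x₀ := by
        have hcl : IsClosed {y : Rn n | ρ / 2 ≤ dist y x₀} :=
          isClosed_le continuous_const (by fun_prop)
        refine closure_minimal (fun z hz => ?_) hcl hy
        by_contra hlt
        exact hz (by simp [hχ1 z (not_le.1 hlt).le])
      have h2 : dist x x₀ ≤ ρ / 4 := hx
      have h3 := dist_triangle_left y x₀ x
      rw [← dist_eq_norm]
      linarith)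
  have hE := norm_integral_symbolIntegrand_le (α := Idx ι)
    (p := fun a x => L ≤ a.2 ∧ x ∈ Metric.closedBall x₀ ρ) (b := b)
    (u := fun a => osc a.2 (w a.1 a.2) (fun y => χ y * amp δ ϱ φ a y))
    (μ := fun a => ((a.2 : ℝ) ^ N)⁻¹)
    (fun a => inv_nonneg.2 (pow_nonneg (zero_le_one.trans a.2.2) N))
    ⟨C, fun a x hx ξ => hCL a hx.1 x hx.2 ξ (mem_univ ξ)⟩
  obtain ⟨E, hE0, hE⟩ := hE
  refine ⟨Kx, Metric.closedBall_mem_nhds x₀ (by positivity), E + D, by positivity, L, hL,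
    fun a ha x hx => ?_⟩
  have ht1 : IsTest (osc a.2 (w a.1 a.2) (fun y => χ y * amp δ ϱ φ a y)) :=
    hDat.isTest (H.cut_amp_uSmooth hχ.1) (H.tsupport_cut_amp χ) a
  have ht2 : IsTest (osc a.2 (w a.1 a.2) (fun y => (1 - χ y) * amp δ ϱ φ a y)) :=
    hDat.isTest (H.cut_amp_uSmooth hχ') (H.tsupport_cut_amp _) a
  have hu : osc a.2 (w a.1 a.2) (amp δ ϱ φ a) = fun y =>
      osc a.2 (w a.1 a.2) (fun y => χ y * amp δ ϱ φ a y) y +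
        osc a.2 (w a.1 a.2) (fun y => (1 - χ y) * amp δ ϱ φ a y) y := by
    funext y
    simp only [osc]
    ring
  have hsplit : ∫ ξ, symbolIntegrand b (osc a.2 (w a.1 a.2) (amp δ ϱ φ a)) (x, ξ) =
      (∫ ξ, symbolIntegrand b (osc a.2 (w a.1 a.2) (fun y => χ y * amp δ ϱ φ a y)) (x, ξ)) +
      ∫ ξ, symbolIntegrand b (osc a.2 (w a.1 a.2) (fun y => (1 - χ y) * amp δ ϱ φ a y))
        (x, ξ) := by
    have hf : HasOrder m b := ⟨hb.smooth, hm⟩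
    rw [← integral_add (hf.integrable ht1 x) (hf.integrable ht2 x)]
    congr 1
    funext ξ
    simp only [symbolIntegrand]
    rw [hu, hat_add ht1.integrable ht2.integrable]
    ring
  rw [hsplit, add_mul]
  refine (norm_add_le _ _).trans (add_le_add (hE a x ⟨ha, ?_⟩) (hD (a, ⟨x, hx⟩)))
  exact Metric.closedBall_subset_closedBall (by linarith) hx

/-- Pseudodifferential operators whose wave front set does not meet the cone of the family map it to
functions that are locally uniformly rapidly decreasing as `λ → ∞`. -/
theorem exists_norm_symbol_integral_le (H : OscFamily δ ϱ w φ c i₀ R) {W : Set (Rn n × Rn n)}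
    {b : Rn n × Rn n → ℂ} (hb : SymbolAt W b) (hd : Disjoint W (oscCone δ w φ)) (N : ℕ)
    {K : Set (Rn n)} (hK : IsCompact K) :
    ∃ C : ℝ, 0 ≤ C ∧ ∃ L : ℝ, 1 ≤ L ∧ ∀ a : Idx ι, L ≤ a.2 → ∀ x ∈ K,
      ‖∫ ξ, symbolIntegrand b (osc a.2 (w a.1 a.2) (amp δ ϱ φ a)) (x, ξ)‖ ≤
        C * ((a.2 : ℝ) ^ N)⁻¹ := by
  refine hK.induction_on (p := fun K => ∃ C : ℝ, 0 ≤ C ∧ ∃ L : ℝ, 1 ≤ L ∧ ∀ a : Idx ι, L ≤ a.2 →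
    ∀ x ∈ K, ‖∫ ξ, symbolIntegrand b (osc a.2 (w a.1 a.2) (amp δ ϱ φ a)) (x, ξ)‖ ≤
      C * ((a.2 : ℝ) ^ N)⁻¹) ?_ ?_ ?_ ?_
  · exact ⟨0, le_rfl, 1, le_rfl, fun a _ x hx => absurd hx (notMem_empty x)⟩
  · rintro s t hst ⟨C, hC, L, hL, h⟩
    exact ⟨C, hC, L, hL, fun a ha x hx => h a ha x (hst hx)⟩
  · rintro s t ⟨C, hC, L, hL, h⟩ ⟨C', hC', L', _, h'⟩
    refine ⟨C + C', by positivity, max L L', le_max_of_le_left hL, fun a ha x hx => ?_⟩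
    have hp : 0 ≤ ((a.2 : ℝ) ^ N)⁻¹ := inv_nonneg.2 (pow_nonneg (zero_le_one.trans a.2.2) N)
    rcases hx with hx | hx
    · refine (h a ((le_max_left _ _).trans ha) x hx).trans ?_
      gcongr
      linarith
    · refine (h' a ((le_max_right _ _).trans ha) x hx).trans ?_
      gcongr
      linarith
  · intro x _
    obtain ⟨U, hU, h⟩ := H.exists_norm_symbol_integral_le_near hb hd N x
    exact ⟨U, mem_nhdsWithin_of_mem_nhds hU, h⟩

end OscFamily

end Microlocal

end OscSum

end

open MeasureTheory Filter Topology Set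
open scoped ContDiff ENNReal

noncomputable section

namespace OscSum

/-! ### Convergence in C^∞ and assembly -/

section Main

variable {ι : Type*} {n M : ℕ} {δ ϱ : ℝ} {w : ι → ℝ → Rn n → ℂ}
  {φ : ι → ℝ → Fin (M + 1) → Rn n → ℂ} {c : ℝ} {i₀ : Fin n} {R : ℝ}

/-- The operator `z b(x, D) + κ` with symbol `b` (quantized without the factor `(2π)^{-n}`) and
kernel `κ`, applied to `u`. -/
def opApply (z : ℂ) (b κ : Rn n × Rn n → ℂ) (u : Rn n → ℂ) (x : Rn n) : ℂ :=
  z * (∫ ξ, symbolIntegrand b u (x, ξ)) + ∫ y, κ (x, y) * u y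

theorem opApply_const_mul (z r : ℂ) (b κ : Rn n × Rn n → ℂ) (u : Rn n → ℂ) (x : Rn n) :
    opApply z b κ (fun y => r * u y) x = r * opApply z b κ u x := by
  have h1 : ∀ ξ, symbolIntegrand b (fun y => r * u y) (x, ξ) = r * symbolIntegrand b u (x, ξ) := by
    intro ξ
    simp only [symbolIntegrand, hat_const_mul]
    ring
  have h2 : ∀ y, κ (x, y) * (r * u y) = r * (κ (x, y) * u y) := fun y => by ring
  simp only [opApply, h1, h2, integral_const_mul]
  ring

theorem contDiff_opApply {W : Set (Rn n × Rn n)} (z : ℂ) {b κ : Rn n × Rn n → ℂ}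
    (hb : SymbolAt W b) (hκ : ContDiff ℝ ∞ κ) {u : Rn n → ℂ} (hu : IsTest u) :
    ContDiff ℝ ∞ (opApply z b κ u) :=
  (contDiff_const.mul (hb.contDiff_integral hu)).add (contDiff_kernel_integral hκ hu)

/-- A derivative only changes the pair (b, κ) within its class, so the sup norm estimates for all
such pairs yield all C^∞ seminorms. -/
theorem pd_opApply {W : Set (Rn n × Rn n)} (z : ℂ) {b κ : Rn n × Rn n → ℂ}
    (hb : SymbolAt W b) (hκ : ContDiff ℝ ∞ κ) {u : Rn n → ℂ} (hu : IsTest u) (k : Fin n) :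
    pd k (opApply z b κ u) = opApply z (symbolDeriv k b) (dx k κ) u := by
  funext x
  have h1 := ((hb.contDiff_integral hu).differentiable (by simp) x).hasFDerivAt.const_mul z
  have h2 := ((contDiff_kernel_integral hκ hu).differentiable (by simp) x).hasFDerivAt
  have h3 : HasFDerivAt (opApply z b κ u) _ x := h1.fun_add h2
  rw [pd, h3.fderiv]
  change z * pd k (fun x => ∫ ξ, symbolIntegrand b u (x, ξ)) x +
    pd k (fun x => ∫ y, κ (x, y) * u y) x = _
  rw [hb.pd_integral hu, pd_kernel_integral hκ hu]
  rfl

namespace OscFamily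

theorem exists_norm_opApply_le (H : OscFamily δ ϱ w φ c i₀ R) {W : Set (Rn n × Rn n)}
    (hd : Disjoint W (oscCone δ w φ)) (z : ℂ) {b κ : Rn n × Rn n → ℂ}
    (hb : SymbolAt W b) (hκ : ContDiff ℝ ∞ κ) (N : ℕ) {K : Set (Rn n)} (hK : IsCompact K) :
    ∃ C : ℝ, 0 ≤ C ∧ ∃ L : ℝ, 1 ≤ L ∧ ∀ a : Idx ι, L ≤ a.2 → ∀ x ∈ K,
      ‖opApply z b κ (osc a.2 (w a.1 a.2) (amp δ ϱ φ a)) x‖ ≤ C * ((a.2 : ℝ) ^ N)⁻¹ := by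
  obtain ⟨C, hC, L, hL, h⟩ := H.exists_norm_symbol_integral_le hb hd N hK
  obtain ⟨D, hD, h'⟩ := norm_kernel_integral_le (H.oscData (isCompact_ball n R)) H.c_pos
    (fun a x _ => H.grad_ge a.1 a.2 a.2.2 x) hκ (H.amp_uSmooth _) H.tsupport_amp_subset_ball hK N
  refine ⟨‖z‖ * C + D, by positivity, L, hL, fun a ha x hx => ?_⟩
  rw [opApply, add_mul, mul_assoc]
  refine (norm_add_le _ _).trans (add_le_add ?_ (h' a x hx))
  rw [norm_mul]
  exact mul_le_mul_of_nonneg_left (h a ha x hx) (norm_nonneg _)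

/-- Pseudodifferential operators whose wave front set does not meet the cone of the family map it to
a family that converges to zero in `C^∞`, together with all multiples by powers of `λ`. -/
theorem tendstoZeroSmooth (H : OscFamily δ ϱ w φ c i₀ R) (A : PseudoDiffOp n)
    (hA : Disjoint A.waveFront (oscCone δ w φ)) (k : ℝ) :
    TendstoZeroSmooth ((⊤ : Filter ι) ×ˢ (atTop : Filter ℝ))
      (fun a x => ((a.2 ^ k : ℝ) : ℂ) *
        A.apply (oscSum δ ϱ a.2 (w a.1 a.2) (φ a.1 a.2)) x) := by
  set z : ℂ := (((2 * Real.pi) ^ (-(n : ℝ)) : ℝ) : ℂ) with hz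
  refine tendstoZeroSmooth_of_pd_closed
    {f | ∃ b κ : Rn n × Rn n → ℂ, SymbolAt A.waveFront b ∧ ContDiff ℝ ∞ κ ∧
      f = fun a x => ((a.2 ^ k : ℝ) : ℂ) *
        opApply z b κ (oscSum δ ϱ a.2 (w a.1 a.2) (φ a.1 a.2)) x} ?_ ?_ ?_
    ⟨_, _, A.symbolAt, A.kernel_smooth, rfl⟩
  · rintro _ ⟨b, κ, hb, hκ, rfl⟩
    refine eventually_top_prod_atTop.2 ⟨1, le_rfl, fun s lam hlam => ?_⟩
    exact contDiff_const.mul (contDiff_opApply z hb hκ (H.isTest_oscSum (s, ⟨lam, hlam⟩)))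
  · rintro _ ⟨b, κ, hb, hκ, rfl⟩ j
    refine ⟨_, ⟨_, _, hb.symbolDeriv j, contDiff_dx hκ j, rfl⟩,
      eventually_top_prod_atTop.2 ⟨1, le_rfl, fun s lam hlam => ?_⟩⟩
    have hu := H.isTest_oscSum (s, ⟨lam, hlam⟩)
    rw [← pd_opApply z hb hκ hu]
    funext x
    have h1 := ((contDiff_opApply z hb hκ hu).differentiable (by simp) x).hasFDerivAt.const_mul
      ((lam ^ k : ℝ) : ℂ)
    rw [pd, h1.fderiv]
    rfl
  · rintro _ ⟨b, κ, hb, hκ, rfl⟩ K hK ε hε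
    obtain ⟨p, hp⟩ := scalar_le k (((n : ℝ) - 1) * δ / 2)
    -- One power more than the scalar factors require leaves C / λ, hence convergence to 0.
    obtain ⟨C, hC, L, hL, h⟩ := H.exists_norm_opApply_le hA z hb hκ (p + 1) hK
    refine eventually_top_prod_atTop.2 ⟨max L (C / ε), le_max_of_le_left hL,
      fun s lam hlam x hx => ?_⟩
    have h1 : 1 ≤ lam := hL.trans ((le_max_left _ _).trans hlam)
    have h0 : 0 < lam := by linarith
    have hb := h (s, ⟨lam, h1⟩) ((le_max_left _ _).trans hlam) x hx
    have hu : oscSum δ ϱ lam (w s lam) (φ s lam) = fun x =>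
        ((lam ^ (((n : ℝ) - 1) * δ / 2) : ℝ) : ℂ) *
          osc lam (w s lam) (amp δ ϱ φ (s, ⟨lam, h1⟩)) x :=
      funext fun x => oscSum_eq δ ϱ w φ (s, ⟨lam, h1⟩) x
    dsimp only at hb ⊢
    rw [hu, opApply_const_mul, ← mul_assoc, norm_mul, ← Complex.ofReal_mul, Complex.norm_real,
      Real.norm_of_nonneg (by positivity)]
    calc _ ≤ lam ^ p * (C * (lam ^ (p + 1))⁻¹) :=
          mul_le_mul (hp lam h1) hb (norm_nonneg _) (by positivity)
      _ = C / lam := by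
          field_simp
          ring
      _ ≤ ε := by
          rw [div_le_iff₀ h0, ← div_le_iff₀' hε]
          exact (le_max_right _ _).trans hlam

end OscFamily

end Main

end OscSum

end

theorem lemma8p1 {ι : Type*} (n M : ℕ) (δ ϱ : ℝ) (hδ0 : 0 < δ) (hδ1 : δ < 1) (hϱ : 0 < ϱ)
    -- the phases and the amplitudes depend on `λ ≥ 1` and on a further parameter `s ∈ ι`
    (w : ι → ℝ → OscSum.Rn n → ℂ) (φ : ι → ℝ → Fin (M + 1) → OscSum.Rn n → ℂ)
    -- `w ∈ C^∞` uniformly, `Im w ≥ 0`, `|d Re w| ≥ c > 0`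
    (hw : ∀ s, ∀ lam : ℝ, 1 ≤ lam → ContDiff ℝ ∞ (w s lam))
    (hwB : ∀ (i : ℕ) (K : Set (OscSum.Rn n)), IsCompact K → ∃ B : ℝ, ∀ s, ∀ lam : ℝ, 1 ≤ lam →
      ∀ x ∈ K, ‖iteratedFDeriv ℝ i (w s lam) x‖ ≤ B)
    (hIm : ∀ s, ∀ lam : ℝ, 1 ≤ lam → ∀ x, 0 ≤ (w s lam x).im)
    (c : ℝ) (hc : 0 < c)
    (hRe : ∀ s, ∀ lam : ℝ, 1 ≤ lam → ∀ x, c ≤ ‖OscSum.reGrad (w s lam) x‖)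
    -- `φ_j ∈ C_0^∞` uniformly, with fixed compact support in all variables but the one of index
    -- `i₀`, in which the support is bounded by `R λ^δ`
    (hφ : ∀ s, ∀ lam : ℝ, 1 ≤ lam → ∀ j, ContDiff ℝ ∞ (φ s lam j))
    (hφB : ∀ i : ℕ, ∃ B : ℝ, ∀ s, ∀ lam : ℝ, 1 ≤ lam → ∀ j x,
      ‖iteratedFDeriv ℝ i (φ s lam j) x‖ ≤ B)
    (i₀ : Fin n) (R : ℝ)
    (hsupp : ∀ s, ∀ lam : ℝ, 1 ≤ lam → ∀ j y, φ s lam j y ≠ 0 →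
      (∀ i, i ≠ i₀ → |y i| ≤ R) ∧ |y i₀| ≤ R * lam ^ δ) :
    -- the upper bound
    (∀ N : ℤ, ∃ C : ℝ, ∀ s, ∀ lam : ℝ, 1 ≤ lam →
      OscSum.sobolevNorm (-(N : ℝ)) (OscSum.oscSum δ ϱ lam (w s lam) (φ s lam)) ≤
        ENNReal.ofReal (C * lam ^ (-N))) ∧
    -- the lower bound
    (∀ (κ : ℝ) (x₀ : ι → OscSum.Rn n), 0 < κ →
      (∀ s, ∀ lam : ℝ, 1 ≤ lam →
        κ ≤ ‖φ s lam 0 (lam ^ δ • x₀ s)‖ ∧ (w s lam (x₀ s)).im = 0) →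
      ∃ lam₀ : ℝ, 1 ≤ lam₀ ∧ ∀ N : ℤ, ∃ c' : ℝ, 0 < c' ∧ ∀ s, ∀ lam : ℝ, lam₀ ≤ lam →
        ENNReal.ofReal (c' * lam ^ (-(N : ℝ) - (n : ℝ) / 2 + ((n : ℝ) - 1) * δ / 2)) ≤
          OscSum.sobolevNorm (-(N : ℝ)) (OscSum.oscSum δ ϱ lam (w s lam) (φ s lam))) ∧
    -- `λ^k u_λ → 0` in `𝓓'_Γ`, uniformly in `s`
    (∀ k : ℝ, OscSum.TendstoZeroDGamma (OscSum.oscCone δ w φ)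
      ((⊤ : Filter ι) ×ˢ (atTop : Filter ℝ))
      (fun a x => ((a.2 ^ k : ℝ) : ℂ) * OscSum.oscSum δ ϱ a.2 (w a.1 a.2) (φ a.1 a.2) x)) ∧
    -- `λ^k A u_λ → 0` in `C^∞`, uniformly in `s`, if `WF(A) ∩ Γ = ∅`
    (∀ A : OscSum.PseudoDiffOp n, Disjoint A.waveFront (OscSum.oscCone δ w φ) → ∀ k : ℝ,
      OscSum.TendstoZeroSmooth ((⊤ : Filter ι) ×ˢ (atTop : Filter ℝ))
        (fun a x => ((a.2 ^ k : ℝ) : ℂ) *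
          A.apply (OscSum.oscSum δ ϱ a.2 (w a.1 a.2) (φ a.1 a.2)) x)) ∧
    -- if `w` is fixed and the supports decrease in `λ`, then `Γ` is the cone generated by the
    -- points `(x, ∂w(x))` with `x ∈ Σ = ⋂_{λ ≥ 1} ⋃_j supp φ_j(λ^δ ·)` and `Im w(x) = 0`
    -- (for a single `s` the set below the closure is already closed)
    (∀ w₀ : OscSum.Rn n → ℂ, (∀ s, ∀ lam : ℝ, 1 ≤ lam → w s lam = w₀) →
      (∀ s, ∀ lam mu : ℝ, 1 ≤ lam → lam ≤ mu →
        OscSum.oscSupport δ mu (φ s mu) ⊆ OscSum.oscSupport δ lam (φ s lam)) →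
      OscSum.oscCone δ w φ = OscSum.coneGen
        {p | p.1 ∈ (⋂ (lam : ℝ) (_ : 1 ≤ lam), closure (⋃ s, OscSum.oscSupport δ lam (φ s lam))) ∧
          (w₀ p.1).im = 0 ∧ p.2 = OscSum.reGrad w₀ p.1}) := by
  have H : OscSum.OscFamily δ ϱ w φ c i₀ R :=
    ⟨hδ0, hδ1, hϱ, hw, hwB, hIm, hc, hRe, hφ, hφB, hsupp⟩
  exact ⟨H.sobolevNorm_le, H.sobolevNorm_ge, H.tendstoZeroDGamma, H.tendstoZeroSmooth,
    fun w₀ hw₀ hdec => OscSum.OscFamily.oscCone_eq w₀ hw₀ H hdec⟩
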